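/- **Notation.** Logarithms and powers are principal ($\operatorname{Im}\log\in(-\pi,\pi]$, $\xi^{s}=e^{s\log \xi}$). For $\nu\in(-1,0)$ and $t\in\mathbb C\smallsetminus[1,+\infty)$ put $$\mathbb D_{\nu,t}u:=\frac{u^{\nu}(1-tu)^{\nu}}{(1-u)^{\nu+1}}\,\mathrm du\quad(0<u<1),\qquad P_\nu(1-2t):=-\frac{\sin(\nu\pi)}{\pi}\int_0^1\mathbb D_{\nu,t}u={}_2F_1(-\nu,\nu+1;1;t),$$ $$\mathbb E^{u}_{\nu,t}f(u):=\frac{\int_0^1 f(u)\,\mathbb D_{\nu,t}u}{\int_0^1\mathbb D_{\nu,t}u}.$$ Define the entropy coupling $$H_\nu(\alpha\Vert\beta):=\mathbb E^U_{\nu,\alpha}\mathbb E^V_{\nu,\beta}\log\frac{1-\beta UV}{1-\beta V}-\mathbb E^U_{\nu,1-\alpha}\mathbb E^V_{-\nu-1,\beta}\log\left[1-\frac{1-\alpha}{\alpha}\frac{\beta}{1-\beta}(1-U)(1-V)\right]$$ and the group $$\Lambda_\nu(\alpha,\beta):=[P_\nu(1-2\alpha)]^2[P_\nu(2\beta-1)]^2\,\mathbb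 Z+P_\nu(1-2\alpha)P_\nu(2\alpha-1)P_\nu(1-2\beta)P_\nu(2\beta-1)\,\mathbb Z+[P_\nu(2\alpha-1)]^2[P_\nu(1-2\beta)]^2\,\mathbb Z .$$ **Proposition (Kontsevich–Zagier integrals as entropy couplings).** (a) Let $\nu\in\{-1/6,-1/4,-1/3,-1/2\}$ and let $\alpha,\,1-\alpha,\,\beta,\,1-\beta,\,\frac{\beta(1-\alpha)}{\alpha(1-\beta)}\in\mathbb C\smallsetminus[1,+\infty)$. Then $$[P_\nu(2\beta-1)]^2\int_0^\beta\frac{[P_\nu(1-2t)]^2\,\mathrm dt}{t-\alpha}-P_\nu(1-2\beta)P_\nu(2\beta-1)\int_0^\beta\frac{P_\nu(1-2t)P_\nu(2t-1)\,\mathrm dt}{t-\alpha}$$ $$\equiv P_\nu(1-2\alpha)P_\nu(2\alpha-1)P_\nu(1-2\beta)P_\nu(2\beta-1)\,H_\nu(\alpha\Vert\beta)\pmod{2\pi i\,\Lambda_\nu(\alpha,\beta)}.$$ Here each of the two integrals is taken along an arbitrary piecewise $C^1$ path from $0$ to $\beta$ (the two paths may differ) that circumvents the singularities of its integrand: the first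 path avoids $\alpha$ and $[1,+\infty)$; the second, except for its starting point $0$, stays in $[(\mathbb C\smallsetminus\mathbb R)\cup(0,1)]\smallsetminus\{\alpha\}$ and is such that the integral along it converges absolutely. The first integral always converges absolutely, and the second one does so whenever its path leaves $0$ with non-zero velocity. (b) Let $\nu\in(-1,0)$ and $\beta\in(\mathbb C\smallsetminus\mathbb R)\cup(0,1)$. Then $$\frac{\pi^2}{\sin^2(\nu\pi)}\left\{P_\nu(2\beta-1)\int_0^\beta[P_\nu(1-2t)]^2\,\mathrm dt-P_\nu(1-2\beta)\int_0^\beta P_\nu(1-2t)P_\nu(2t-1)\,\mathrm dt\right\}$$ $$=\frac{\sqrt\pi}{2^{2\nu+1}\Gamma(-\nu)\Gamma\left(\nu+\frac32\right)}\int_0^1\!\!\int_0^1U^\nu\log(1-\beta UV)\,\mathbb D_{\nu,0}U\,\mathbb D_{\nu,\beta}V,$$ where the integrals on the left are along the straight-line segment from $0$ to $\beta$, and all three integrals converge absolutely. -/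

import Mathlib

open Set MeasureTheory
open scoped Real Interval

noncomputable section

/-- The ray `[1, +∞)` on the real axis, as a subset of `ℂ`. -/
def cutRay : Set ℂ := {z | ∃ r : ℝ, 1 ≤ r ∧ z = (r : ℂ)}

/-- The double slit plane `(ℂ ∖ ℝ) ∪ (0, 1)`. -/
def doubleSlit : Set ℂ := {z | z.im ≠ 0 ∨ ∃ r : ℝ, 0 < r ∧ r < 1 ∧ z = (r : ℂ)}

/-- The density `u ^ ν (1 - t u) ^ ν / (1 - u) ^ (ν + 1)` of the measure `𝔻_{ν,t} u` on `(0, 1)`,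
with principal branches of the powers. -/
def legendreWeight (ν : ℝ) (t : ℂ) (u : ℝ) : ℂ :=
  (u : ℂ) ^ (ν : ℂ) * (1 - t * u) ^ (ν : ℂ) / (1 - (u : ℂ)) ^ ((ν : ℂ) + 1)

/-- The Legendre function of the first kind `P_ν(ξ)`, `-1 < ν < 0`, `ξ ∉ (-∞, -1]`, through Euler's
integral for `₂F₁(-ν, ν + 1; 1; (1 - ξ) / 2)`; thus
`P_ν(1 - 2 t) = - (sin (ν π) / π) ∫₀¹ u ^ ν (1 - t u) ^ ν / (1 - u) ^ (ν + 1) du`. -/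
def legendreP (ν : ℝ) (ξ : ℂ) : ℂ :=
  -((Real.sin (ν * π) / π : ℝ) : ℂ) * ∫ u in (0 : ℝ)..1, legendreWeight ν ((1 - ξ) / 2) u

/-- The Legendre expectation `𝔼^u_{ν,t} f(u)`. -/
def legendreExpect (ν : ℝ) (t : ℂ) (f : ℝ → ℂ) : ℂ :=
  (∫ u in (0 : ℝ)..1, f u * legendreWeight ν t u) / ∫ u in (0 : ℝ)..1, legendreWeight ν t u

/-- The entropy coupling `H_ν(α ‖ β)`. -/
def entropyH (ν : ℝ) (α β : ℂ) : ℂ :=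
  legendreExpect ν α (fun U => legendreExpect ν β (fun V =>
      Complex.log ((1 - β * U * V) / (1 - β * V))))
    - legendreExpect ν (1 - α) (fun U => legendreExpect (-ν - 1) β (fun V =>
      Complex.log (1 - (1 - α) / α * (β / (1 - β)) * (1 - (U : ℂ)) * (1 - (V : ℂ)))))

/-- The group of periods `Λ_ν(α, β)`, a subset of `ℂ`. -/
def periodLattice (ν : ℝ) (α β : ℂ) : Set ℂ :=
  {z | ∃ k m n : ℤ,
    z = legendreP ν (1 - 2 * α) ^ 2 * legendreP ν (2 * β - 1) ^ 2 * k
      + legendreP ν (1 - 2 * α) * legendreP ν (2 * α - 1)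
          * legendreP ν (1 - 2 * β) * legendreP ν (2 * β - 1) * m
      + legendreP ν (2 * α - 1) ^ 2 * legendreP ν (1 - 2 * β) ^ 2 * n}

/-- `γ`, restricted to `[0, 1]`, is a piecewise `C¹` path from `a` to `b`. -/
def IsPiecewiseC1Path (γ : ℝ → ℂ) (a b : ℂ) : Prop :=
  γ 0 = a ∧ γ 1 = b ∧ ∃ (n : ℕ) (s : ℕ → ℝ), s 0 = 0 ∧ s n = 1 ∧
    ∀ i < n, s i < s (i + 1) ∧ ContDiffOn ℝ 1 γ (Icc (s i) (s (i + 1)))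

/-- The integrand of the path integral `∫_γ f(t) dt`, pulled back to `[0, 1]`. -/
def pullback (f : ℂ → ℂ) (γ : ℝ → ℂ) (s : ℝ) : ℂ := f (γ s) * deriv γ s

/-- The path integral `∫_γ f(t) dt`. -/
def pathIntegral (f : ℂ → ℂ) (γ : ℝ → ℂ) : ℂ := ∫ s in (0 : ℝ)..1, pullback f γ s

/-- The straight path from `0` to `b`. -/
def segmentTo (b : ℂ) (s : ℝ) : ℂ := s * b

/-- `[P_ν(1 - 2 t)]²`. -/
def legendreSq (ν : ℝ) (t : ℂ) : ℂ := legendreP ν (1 - 2 * t) ^ 2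

/-- `P_ν(1 - 2 t) P_ν(2 t - 1)`. -/
def legendreMir (ν : ℝ) (t : ℂ) : ℂ := legendreP ν (1 - 2 * t) * legendreP ν (2 * t - 1)

end

/-! Write p(t) = P_ν(1 - 2t), q(t) = p(1 - t) and L = t(1 - t)∂² + (1 - 2t)∂ + ν(ν + 1). Both p and
q are annihilated by L, and t(1 - t)(q'p - p'q) is the constant c = -1/B(ν + 1, -ν). If L y = c φ p,
variation of constants gives y = q A - p B with A' = φ p² and B' = φ p q. If moreover y continues a
function that is holomorphic at 0 and vanishes there, then A and B tend to 0 at 0, so they are the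
integrals of φ p² and φ p q from 0 (`exists_variation_of_constants`). With φ = 1/(t - α) and φ = 1
these are the integrals in (a) and (b). What remains is to show that each right-hand side, suitably
normalised, solves the inhomogeneous equation.

Both right-hand sides are Euler transforms: y(β) is the mean of (1 - βv)^ν J(βv) over a beta
distribution in v. Integration by parts moves L under the integral, where it becomes an operator of
first order in J' (`legendreOp_weightedEuler`). If that operator sends J to a constant, then L y is
a multiple of p (`legendreOp_weightedEuler_of_eq`); a variant produces p/(β - α)
(`legendreOp_weightedEuler_of_pole`).

For (a), an involution of the V variable turns the second half of H_ν into an integral of the same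
shape as the first. For small β > 0 the coupling, times p(α)q(α)p(β), is then the Euler transform of
a combination of integrals of log(1 - xw) against w^ν(1 - w)^(-ν-1)(1 - αw)^ν dw, one over [0, 1]
and one over the segment from 1/α to 1. Each satisfies the required equation up to periods of the
first and second kind (`cycle_equation`). The weights q(α), p(α) cancel the former, and Legendre's
relation, which is the Wronskian identity again, evaluates the latter. The identity theorem on the
connected domain `entropyDomain` carries the equation to all admissible β.

Arbitrary paths change the integrals by 2πi times integer multiples of the residues p(α)² and
p(α)q(α) (`exists_int_sq`, `exists_int_mir`). This is seen without homotopy: X = (t -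
α)·exp(holomorphic) is single-valued and has logarithmic derivative f/(t - α) divided by the
residue, so the exponential of the normalised integral depends only on the endpoints. The second
integrand has a logarithmic singularity at 0, handled by the local expansion q = p(c log t + F).

For (b), J is the mean of log(1 - xu)/u over a Beta(2ν + 2, -ν) distribution, and the duplication
formula for Γ fixes the constant. On segments there is no residue and the identity is exact. -/

open ProbabilityTheory Filter Topology

/-! ### Beta distributions and integration by parts. -/

section BetaMeasure

variable {a b : ℝ}

theorem isProbabilityMeasure_betaMeasure (ha : 0 < a) (hb : 0 < b) :
    IsProbabilityMeasure (betaMeasure a b) :=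
  isProbabilityMeasureBeta ha hb

theorem ae_betaMeasure_mem_Ioo : ∀ᵐ u ∂betaMeasure a b, u ∈ Ioo (0 : ℝ) 1 := by
  unfold betaMeasure
  rw [ae_withDensity_iff (by unfold betaPDF; fun_prop)]
  refine Eventually.of_forall fun u hu => ?_
  by_contra h
  apply hu
  rw [betaPDF_eq, if_neg (by simpa only [mem_Ioo] using h), ENNReal.ofReal_zero]

theorem ae_betaMeasure_mem_Icc : ∀ᵐ u ∂betaMeasure a b, u ∈ Icc (0 : ℝ) 1 :=
  ae_betaMeasure_mem_Ioo.mono fun _ h => Ioo_subset_Icc_self h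

theorem integral_betaMeasure (ha : 0 < a) (hb : 0 < b) (F : ℝ → ℂ) :
    ∫ u, F u ∂betaMeasure a b
      = ((beta a b : ℝ) : ℂ)⁻¹ *
        ∫ u in (0 : ℝ)..1, ((u ^ (a - 1) * (1 - u) ^ (b - 1) : ℝ) : ℂ) * F u := by
  have h1 : betaMeasure a b
      = volume.withDensity fun u => ((betaPDFReal a b u).toNNReal : ENNReal) := rfl
  rw [h1, integral_withDensity_eq_integral_smul (by fun_prop),
    intervalIntegral.integral_of_le zero_le_one, integral_Ioc_eq_integral_Ioo,
    ← integral_const_mul, ← integral_indicator measurableSet_Ioo]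
  congr 1
  ext u
  by_cases hu : u ∈ Ioo (0 : ℝ) 1
  · rw [indicator_of_mem hu, NNReal.smul_def, Real.coe_toNNReal _
      (betaPDFReal_pos hu.1 hu.2 ha hb).le, betaPDFReal, if_pos (mem_Ioo.1 hu), Complex.real_smul]
    push_cast
    ring
  · rw [indicator_of_notMem hu, betaPDFReal, if_neg (by simpa only [mem_Ioo] using hu)]
    simp

theorem intervalIntegrable_beta_density (ha : 0 < a) (hb : 0 < b) :
    IntervalIntegrable (fun u : ℝ => u ^ (a - 1) * (1 - u) ^ (b - 1)) volume 0 1 := by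
  have h := Complex.betaIntegral_convergent (u := a) (v := b) (by simpa) (by simpa)
  have h2 := h.norm
  refine h2.congr_uIoo (fun u hu => ?_)
  rw [uIoo_of_le zero_le_one] at hu
  have h3 : 0 < 1 - u := by linarith [hu.2]
  dsimp only
  rw [norm_mul, Complex.norm_cpow_eq_rpow_re_of_pos hu.1]
  have : (1 - (u : ℂ)) = ((1 - u : ℝ) : ℂ) := by push_cast; rfl
  rw [this, Complex.norm_cpow_eq_rpow_re_of_pos h3]
  simp

theorem integrable_of_continuousOn_Icc {μ : Measure ℝ} [IsFiniteMeasure μ]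
    (hμ : ∀ᵐ u ∂μ, u ∈ Icc (0 : ℝ) 1) {F : ℝ → ℂ} (hF : ContinuousOn F (Icc 0 1)) :
    Integrable F μ := by
  have h := hF.integrableOn_compact (μ := μ) isCompact_Icc
  rwa [IntegrableOn, Measure.restrict_eq_self_of_ae_mem hμ] at h

/-- Integration by parts against the beta distribution. -/
theorem integral_betaMeasure_stein (ha : 0 < a) (hb : 0 < b) {k k' : ℝ → ℂ}
    (hk : ContinuousOn k (Icc 0 1)) (hk' : ContinuousOn k' (Icc 0 1))
    (hd : ∀ u ∈ Ioo (0 : ℝ) 1, HasDerivAt k (k' u) u) :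
    ∫ u, ((a - (a + b) * u) * k u + u * (1 - u) * k' u) ∂betaMeasure a b = 0 := by
  rw [integral_betaMeasure ha hb]
  have hc : ContinuousOn (fun u : ℝ => ((u ^ a * (1 - u) ^ b : ℝ) : ℂ) * k u) (Icc 0 1) := by
    refine ContinuousOn.mul (Continuous.continuousOn ?_) hk
    refine Complex.continuous_ofReal.comp ?_
    exact (Real.continuous_rpow_const ha.le).mul
      ((Real.continuous_rpow_const hb.le).comp (continuous_const.sub continuous_id))
  have key := intervalIntegral.integral_eq_sub_of_hasDerivAt_of_le (zero_le_one' ℝ) hc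
    (f' := fun u => ((u ^ (a - 1) * (1 - u) ^ (b - 1) : ℝ) : ℂ) *
      ((a - (a + b) * u) * k u + u * (1 - u) * k' u)) ?_ ?_
  · rw [key]
    -- The boundary terms carry `u ^ a * (1 - u) ^ b` with positive exponents and vanish at both
    -- ends.
    simp [Real.zero_rpow ha.ne', Real.zero_rpow hb.ne']
  · intro u hu
    have h0 : u ≠ 0 := hu.1.ne'
    have h1 : 1 - u ≠ 0 := by linarith [hu.2]
    have e1 : u ^ a = u ^ (a - 1) * u := by
      rw [← Real.rpow_add_one h0]; congr 1; ring
    have e2 : (1 - u) ^ b = (1 - u) ^ (b - 1) * (1 - u) := by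
      rw [← Real.rpow_add_one h1]; congr 1; ring
    have d1 : HasDerivAt (fun u : ℝ => u ^ a * (1 - u) ^ b)
        (u ^ (a - 1) * (1 - u) ^ (b - 1) * (a - (a + b) * u)) u := by
      have := (Real.hasDerivAt_rpow_const (x := u) (p := a) (Or.inl h0)).mul
        (((hasDerivAt_id u).const_sub 1).rpow_const (p := b) (Or.inl h1))
      convert! this using 1
      simp only [id]
      rw [e1, e2]
      ring
    have d2 := (d1.ofReal_comp).mul (hd u hu)
    convert! d2 using 1
    rw [e1, e2]
    push_cast
    ring
  · have hm : ContinuousOn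
        (fun u : ℝ => ((a - (a + b) * u) * k u + u * (1 - u) * k' u : ℂ)) (uIcc 0 1) := by
      rw [uIcc_of_le zero_le_one]
      refine ContinuousOn.add (ContinuousOn.mul ?_ hk) (ContinuousOn.mul ?_ hk')
      · exact Continuous.continuousOn (by fun_prop)
      · exact Continuous.continuousOn (by fun_prop)
    have hi : IntervalIntegrable
        (fun u : ℝ => ((u ^ (a - 1) * (1 - u) ^ (b - 1) : ℝ) : ℂ)) volume 0 1 :=
      ⟨(intervalIntegrable_beta_density ha hb).1.ofReal,
        (intervalIntegrable_beta_density ha hb).2.ofReal⟩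
    exact hi.mul_continuousOn hm

end BetaMeasure

/-! ### Differentiation under the integral sign. -/

section ParametricIntegral

variable {X : Type*} [TopologicalSpace X] [MeasurableSpace X] [OpensMeasurableSpace X]
  {μ : Measure X} [IsFiniteMeasure μ] {K : Set X}

theorem integrable_of_continuousOn_compact (hK : IsCompact K) (hKm : MeasurableSet K)
    (hμ : ∀ᵐ x ∂μ, x ∈ K) {F : X → ℂ} (hF : ContinuousOn F K) : Integrable F μ := by
  have h := Measure.restrict_eq_self_of_ae_mem hμ
  obtain ⟨C, hC⟩ := hK.exists_bound_of_continuousOn hF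
  refine Integrable.of_bound (C := C) ?_ (hμ.mono hC)
  rw [← h]
  exact hF.aestronglyMeasurable hKm

/-- Differentiation under the integral sign for kernels that are continuous on a compact set. -/
theorem hasDerivAt_integral_of_continuousOn_compact (hK : IsCompact K) (hKm : MeasurableSet K)
    (hμ : ∀ᵐ x ∂μ, x ∈ K) {U : Set ℂ} (hU : IsOpen U) {f f' : X → ℂ → ℂ}
    (hf : ∀ z ∈ U, ContinuousOn (fun x => f x z) K)
    (hf' : ContinuousOn (fun p : X × ℂ => f' p.1 p.2) (K ×ˢ U))
    (hd : ∀ x ∈ K, ∀ z ∈ U, HasDerivAt (f x) (f' x z) z) {z : ℂ} (hz : z ∈ U) :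
    HasDerivAt (fun w => ∫ x, f x w ∂μ) (∫ x, f' x z ∂μ) z := by
  obtain ⟨r, hr, hrU⟩ := Metric.nhds_basis_closedBall.mem_iff.1 (hU.mem_nhds hz)
  obtain ⟨C, hC⟩ := (hK.prod (isCompact_closedBall z r)).exists_bound_of_continuousOn
    (hf'.mono (prod_mono_right hrU))
  have hres := Measure.restrict_eq_self_of_ae_mem hμ
  have hf'z : ContinuousOn (fun x => f' x z) K :=
    hf'.comp (f := fun x => (x, z)) (by fun_prop) fun x hx => ⟨hx, hz⟩
  refine (hasDerivAt_integral_of_dominated_loc_of_deriv_le (F := fun w x => f x w)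
    (F' := fun w x => f' x w) (bound := fun _ => C) (Metric.closedBall_mem_nhds z hr) ?_ ?_ ?_ ?_ ?_ ?_).2
  · filter_upwards [hU.mem_nhds hz] with w hw
    rw [← hres]
    exact (hf w hw).aestronglyMeasurable hKm
  · exact integrable_of_continuousOn_compact hK hKm hμ (hf z hz)
  · exact (integrable_of_continuousOn_compact hK hKm hμ hf'z).aestronglyMeasurable
  · exact hμ.mono fun x hx w hw => hC (x, w) ⟨hx, hw⟩
  · exact integrable_const C
  · exact hμ.mono fun x hx w hw => hd x hx w (hrU hw)

end ParametricIntegral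

/-! ### Topology of the cut plane and the double slit plane. -/

section SlitPlanes

theorem mem_compl_cutRay_iff {z : ℂ} : z ∈ cutRayᶜ ↔ 1 - z ∈ Complex.slitPlane := by
  rw [mem_compl_iff, Complex.mem_slitPlane_iff]
  constructor
  · intro h
    by_contra hc
    push Not at hc
    simp only [Complex.sub_re, Complex.one_re, Complex.sub_im, Complex.one_im] at hc
    refine h ⟨z.re, by linarith [hc.1], ?_⟩
    apply Complex.ext <;> simp
    linarith [hc.2]
  · rintro h ⟨r, hr, rfl⟩
    simp at h
    linarith

theorem one_sub_mem_slitPlane {z : ℂ} (hz : z ∉ cutRay) : 1 - z ∈ Complex.slitPlane :=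
  mem_compl_cutRay_iff.1 hz

theorem one_sub_ne_zero_of_notMem_cutRay {z : ℂ} (hz : z ∉ cutRay) : 1 - z ≠ 0 :=
  Complex.slitPlane_ne_zero (one_sub_mem_slitPlane hz)

theorem isOpen_compl_cutRay : IsOpen cutRayᶜ := by
  have : cutRayᶜ = (fun z : ℂ => 1 - z) ⁻¹' Complex.slitPlane := by
    ext z; exact mem_compl_cutRay_iff
  rw [this]
  exact Complex.isOpen_slitPlane.preimage (by fun_prop)

theorem mul_notMem_cutRay {z : ℂ} (hz : z ∉ cutRay) {v : ℝ} (hv : v ∈ Icc (0 : ℝ) 1) :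
    z * v ∉ cutRay := by
  rintro ⟨r, hr, h⟩
  have hv0 : v ≠ 0 := by
    rintro rfl
    have := congrArg Complex.re h
    simp at this
    linarith
  have hv1 : 0 < v := lt_of_le_of_ne hv.1 hv0.symm
  refine hz ⟨r / v, ?_, ?_⟩
  · rw [le_div_iff₀ hv1]; linarith [hv.2]
  · push_cast
    rw [← h, mul_div_cancel_right₀ _ (Complex.ofReal_ne_zero.2 hv0)]

theorem zero_notMem_cutRay : (0 : ℂ) ∉ cutRay := by
  rintro ⟨r, hr, h⟩
  have := congrArg Complex.re h
  simp at this
  linarith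

theorem starConvex_compl_cutRay : StarConvex ℝ 0 cutRayᶜ := by
  rw [starConvex_zero_iff]
  intro z hz a ha ha'
  have := mul_notMem_cutRay hz ⟨ha, ha'⟩
  rwa [mem_compl_iff, Complex.real_smul, mul_comm]

theorem isPreconnected_compl_cutRay : IsPreconnected cutRayᶜ :=
  (starConvex_compl_cutRay.isPathConnected zero_notMem_cutRay).isConnected.isPreconnected

theorem mem_doubleSlit_iff {z : ℂ} : z ∈ doubleSlit ↔ z ∉ cutRay ∧ 1 - z ∉ cutRay := by
  constructor
  · intro h
    constructor
    · rintro ⟨r, hr, rfl⟩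
      rcases h with h | ⟨s, hs0, hs1, h⟩
      · simp at h
      · have := Complex.ofReal_injective h
        linarith
    · rintro ⟨r, hr, h'⟩
      rcases h with h | ⟨s, hs0, hs1, rfl⟩
      · have := congrArg Complex.im h'
        simp at this
        exact h this
      · have := congrArg Complex.re h'
        simp at this
        linarith
  · rintro ⟨h0, h1⟩
    by_cases h : z.im = 0
    · right
      have hz : z = (z.re : ℂ) := by apply Complex.ext <;> simp [h]
      refine ⟨z.re, ?_, ?_, hz⟩
      · by_contra hc
        push Not at hc
        refine h1 ⟨1 - z.re, by linarith, ?_⟩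
        push_cast
        rw [← hz]
      · by_contra hc
        push Not at hc
        exact h0 ⟨z.re, hc, hz⟩
    · exact Or.inl h

theorem doubleSlit_eq : doubleSlit = cutRayᶜ ∩ (fun z : ℂ => 1 - z) ⁻¹' cutRayᶜ := by
  ext z
  exact mem_doubleSlit_iff

theorem isOpen_doubleSlit : IsOpen doubleSlit := by
  rw [doubleSlit_eq]
  exact isOpen_compl_cutRay.inter (isOpen_compl_cutRay.preimage (by fun_prop))

theorem one_sub_mem_doubleSlit {z : ℂ} (hz : z ∈ doubleSlit) : 1 - z ∈ doubleSlit := by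
  rw [mem_doubleSlit_iff] at hz ⊢
  rw [sub_sub_cancel]
  exact ⟨hz.2, hz.1⟩

theorem mem_slitPlane_of_mem_doubleSlit {z : ℂ} (hz : z ∈ doubleSlit) :
    z ∈ Complex.slitPlane := by
  have := one_sub_mem_slitPlane (mem_doubleSlit_iff.1 hz).2
  rwa [sub_sub_cancel] at this

theorem ne_zero_of_mem_doubleSlit {z : ℂ} (hz : z ∈ doubleSlit) : z ≠ 0 :=
  Complex.slitPlane_ne_zero (mem_slitPlane_of_mem_doubleSlit hz)

theorem one_sub_ne_zero_of_mem_doubleSlit {z : ℂ} (hz : z ∈ doubleSlit) : 1 - z ≠ 0 :=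
  ne_zero_of_mem_doubleSlit (one_sub_mem_doubleSlit hz)

theorem ofReal_mem_doubleSlit {r : ℝ} (h0 : 0 < r) (h1 : r < 1) : (r : ℂ) ∈ doubleSlit :=
  Or.inr ⟨r, h0, h1, rfl⟩

theorem mem_doubleSlit_of_mem_slitPlane {z : ℂ} (hz : z ∈ Complex.slitPlane) (h : ‖z‖ < 1) :
    z ∈ doubleSlit := by
  rw [mem_doubleSlit_iff]
  constructor
  · rintro ⟨r, hr, rfl⟩
    rw [Complex.norm_real, Real.norm_eq_abs] at h
    linarith [le_abs_self r]
  · rw [← mem_compl_iff, mem_compl_cutRay_iff, sub_sub_cancel]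
    exact hz

theorem starConvex_doubleSlit : StarConvex ℝ (1 / 2 : ℂ) doubleSlit := by
  rw [starConvex_iff_segment_subset]
  intro z hz w hw
  obtain ⟨a, b, ha, hb, hab, rfl⟩ := hw
  rcases eq_or_lt_of_le hb with rfl | hb
  · obtain rfl : a = 1 := by linarith
    refine Or.inr ⟨1 / 2, by norm_num, by norm_num, by simp⟩
  rcases hz with hz | ⟨r, hr0, hr1, rfl⟩
  · left
    simp only [Complex.real_smul, Complex.add_im, Complex.mul_im, Complex.ofReal_re,
      Complex.ofReal_im, zero_mul, add_zero]
    have : (1 / 2 : ℂ).im = 0 := by norm_num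
    rw [this, mul_zero, zero_add]
    exact mul_ne_zero hb.ne' hz
  · right
    refine ⟨a * (1 / 2) + b * r, by positivity, ?_, ?_⟩
    · nlinarith
    · simp

theorem isPreconnected_doubleSlit : IsPreconnected doubleSlit :=
  (starConvex_doubleSlit.isPathConnected
    (Or.inr ⟨1 / 2, by norm_num, by norm_num, by simp⟩)).isConnected.isPreconnected

end SlitPlanes

/-! ### Action of the Legendre operator on an Euler transform. -/

section EulerTransform

variable {ν : ℝ}

/-- The hypergeometric function `₂F₁(-ν, ν + 1; 1; t) = P_ν(1 - 2 t)`, as a mean over a beta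
distribution. -/
noncomputable def legendreF (ν : ℝ) (t : ℂ) : ℂ :=
  ∫ u, (1 - t * (u : ℂ)) ^ (ν : ℂ) ∂betaMeasure (ν + 1) (-ν)

/-- The `n`-th moment `∫ v ^ n h (β v)` over a beta distribution. -/
noncomputable def eulerMoment (ν : ℝ) (n : ℕ) (h : ℂ → ℂ) (β : ℂ) : ℂ :=
  ∫ v, (v : ℂ) ^ n * h (β * v) ∂betaMeasure (ν + 1) (-ν)

/-- The Legendre operator in the variable `t = (1 - ξ) / 2`. -/
noncomputable def legendreOp (ν : ℝ) (y : ℂ → ℂ) (t : ℂ) : ℂ :=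
  t * (1 - t) * deriv (deriv y) t + (1 - 2 * t) * deriv y t + ν * (ν + 1) * y t

theorem continuousOn_comp_mul {h : ℂ → ℂ} {U : Set ℂ}
    (hs : ∀ z ∈ U, ∀ v ∈ Icc (0 : ℝ) 1, z * v ∈ U) (hc : ContinuousOn h U) {β : ℂ} (hβ : β ∈ U) :
    ContinuousOn (fun v : ℝ => h (β * v)) (Icc 0 1) :=
  hc.comp (f := fun v : ℝ => β * v) (by fun_prop) fun v hv => hs β hβ v hv

theorem hasDerivAt_eulerMoment (h1 : -1 < ν) (h2 : ν < 0) {h h' : ℂ → ℂ} {U : Set ℂ}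
    (hU : IsOpen U) (hs : ∀ z ∈ U, ∀ v ∈ Icc (0 : ℝ) 1, z * v ∈ U)
    (hd : ∀ z ∈ U, HasDerivAt h (h' z) z) (hc : ContinuousOn h' U) (n : ℕ) {β : ℂ} (hβ : β ∈ U) :
    HasDerivAt (eulerMoment ν n h) (eulerMoment ν (n + 1) h' β) β := by
  have := isProbabilityMeasure_betaMeasure (a := ν + 1) (b := -ν) (by linarith) (by linarith)
  refine hasDerivAt_integral_of_continuousOn_compact (K := Icc (0 : ℝ) 1) isCompact_Icc
    measurableSet_Icc ae_betaMeasure_mem_Icc hU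
    (f := fun (v : ℝ) β => (v : ℂ) ^ n * h (β * v))
    (f' := fun (v : ℝ) β => (v : ℂ) ^ (n + 1) * h' (β * v)) ?_ ?_ ?_ hβ
  · intro z hz
    refine ContinuousOn.mul (by fun_prop)
      (continuousOn_comp_mul hs (fun z hz => (hd z hz).continuousAt.continuousWithinAt) hz)
  · refine ContinuousOn.mul (by fun_prop) ?_
    exact hc.comp (f := fun p : ℝ × ℂ => p.2 * p.1) (by fun_prop) fun p hp => hs _ hp.2 _ hp.1
  · intro v hv z hz
    have := ((hd _ (hs z hz v hv)).comp z ((hasDerivAt_id z).mul_const (v : ℂ))).const_mul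
      ((v : ℂ) ^ n)
    convert! this using 1
    ring

/-- Differentiating under the integral leaves coefficients that depend on `β` and `v` separately.
Adding the null integral from integration by parts with `k = h' (β v)` makes every coefficient a
function of `x = β v` alone. -/
theorem legendreOp_eulerMoment (h1 : -1 < ν) (h2 : ν < 0) {h h' h'' : ℂ → ℂ} {U : Set ℂ}
    (hU : IsOpen U) (hs : ∀ z ∈ U, ∀ v ∈ Icc (0 : ℝ) 1, z * v ∈ U)
    (hd : ∀ z ∈ U, HasDerivAt h (h' z) z) (hd' : ∀ z ∈ U, HasDerivAt h' (h'' z) z)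
    (hc : ContinuousOn h'' U) {β : ℂ} (hβ : β ∈ U) :
    legendreOp ν (eulerMoment ν 0 h) β =
      ∫ v, (β * v * (1 - β * v) * h'' (β * v) + (ν + 1 - 2 * (β * v)) * h' (β * v)
        + ν * (ν + 1) * h (β * v)) ∂betaMeasure (ν + 1) (-ν) := by
  have := isProbabilityMeasure_betaMeasure (a := ν + 1) (b := -ν) (by linarith) (by linarith)
  have hch : ContinuousOn h U := fun z hz => (hd z hz).continuousAt.continuousWithinAt
  have hch' : ContinuousOn h' U := fun z hz => (hd' z hz).continuousAt.continuousWithinAt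
  have e1 : ∀ z ∈ U, deriv (eulerMoment ν 0 h) z = eulerMoment ν 1 h' z := fun z hz =>
    (hasDerivAt_eulerMoment h1 h2 hU hs hd hch' 0 hz).deriv
  have e2 : deriv (deriv (eulerMoment ν 0 h)) β = eulerMoment ν 2 h'' β := by
    have : deriv (eulerMoment ν 0 h) =ᶠ[𝓝 β] eulerMoment ν 1 h' := by
      filter_upwards [hU.mem_nhds hβ] with z hz using e1 z hz
    rw [this.deriv_eq]
    exact (hasDerivAt_eulerMoment h1 h2 hU hs hd' hc 1 hβ).deriv
  have c0 := continuousOn_comp_mul hs hch hβ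
  have c1 := continuousOn_comp_mul hs hch' hβ
  have c2 := continuousOn_comp_mul hs hc hβ
  have stein := integral_betaMeasure_stein (a := ν + 1) (b := -ν) (by linarith) (by linarith)
    (k := fun v : ℝ => h' (β * v)) (k' := fun v : ℝ => β * h'' (β * v)) c1
    (continuousOn_const.mul c2) (by
      intro v hv
      have := HasDerivAt.scomp (𝕜' := ℂ) v (hd' _ (hs β hβ v (Ioo_subset_Icc_self hv)))
        ((Complex.ofRealCLM.hasDerivAt (x := v)).const_mul β)
      simpa [Function.comp_def, smul_eq_mul] using this)
  have i0 : Integrable (fun v : ℝ => h (β * v)) (betaMeasure (ν + 1) (-ν)) :=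
    integrable_of_continuousOn_Icc ae_betaMeasure_mem_Icc c0
  have i1 : Integrable (fun v : ℝ => (v : ℂ) * h' (β * v)) (betaMeasure (ν + 1) (-ν)) :=
    integrable_of_continuousOn_Icc ae_betaMeasure_mem_Icc (ContinuousOn.mul (by fun_prop) c1)
  have i2 : Integrable (fun v : ℝ => (v : ℂ) ^ 2 * h'' (β * v)) (betaMeasure (ν + 1) (-ν)) :=
    integrable_of_continuousOn_Icc ae_betaMeasure_mem_Icc (ContinuousOn.mul (by fun_prop) c2)
  have i3 : Integrable (fun v : ℝ => (((ν + 1 : ℝ) : ℂ) - (((ν + 1 : ℝ) : ℂ) + ((-ν : ℝ) : ℂ)) * v)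
      * h' (β * v) + v * (1 - v) * (β * h'' (β * v))) (betaMeasure (ν + 1) (-ν)) :=
    integrable_of_continuousOn_Icc ae_betaMeasure_mem_Icc
      ((ContinuousOn.mul (by fun_prop) c1).add
        (ContinuousOn.mul (by fun_prop) (continuousOn_const.mul c2)))
  have i12 : Integrable (fun v : ℝ => β * (1 - β) * ((v : ℂ) ^ 2 * h'' (β * v))
      + (1 - 2 * β) * ((v : ℂ) * h' (β * v))) (betaMeasure (ν + 1) (-ν)) :=
    (i2.const_mul _).add (i1.const_mul _)
  have i120 : Integrable (fun v : ℝ => β * (1 - β) * ((v : ℂ) ^ 2 * h'' (β * v))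
      + (1 - 2 * β) * ((v : ℂ) * h' (β * v)) + ν * (ν + 1) * h (β * v))
      (betaMeasure (ν + 1) (-ν)) := i12.add (i0.const_mul _)
  unfold legendreOp
  rw [e2, e1 β hβ, ← add_zero (_ + _ + _), ← stein]
  unfold eulerMoment
  simp only [pow_zero, one_mul, pow_one]
  rw [← integral_const_mul, ← integral_const_mul, ← integral_const_mul,
    ← integral_add (i2.const_mul _) (i1.const_mul _),
    ← integral_add i12 (i0.const_mul _), ← integral_add i120 i3]
  congr 1
  ext v
  push_cast
  ring

end EulerTransform

/-! ### Euler transforms with the weight (1 - x)^ν. -/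

section WeightedEuler

variable {ν : ℝ}

/-- The Euler transform of `(1 - x) ^ ν J(x)`. -/
noncomputable def weightedEuler (ν : ℝ) (J : ℂ → ℂ) : ℂ → ℂ :=
  eulerMoment ν 0 fun x => (1 - x) ^ (ν : ℂ) * J x

theorem weightedEuler_apply (J : ℂ → ℂ) (β : ℂ) :
    weightedEuler ν J β =
      ∫ v, (1 - β * (v : ℂ)) ^ (ν : ℂ) * J (β * v) ∂betaMeasure (ν + 1) (-ν) := by
  simp [weightedEuler, eulerMoment]

theorem weightedEuler_one : weightedEuler ν (fun _ => 1) = legendreF ν := by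
  ext t
  simp [weightedEuler_apply, legendreF]

theorem hasDerivAt_one_sub_cpow {x : ℂ} (hx : x ∉ cutRay) (s : ℂ) :
    HasDerivAt (fun x : ℂ => (1 - x) ^ s) (-s * ((1 - x) ^ s / (1 - x))) x := by
  have := ((hasDerivAt_id x).const_sub 1).cpow_const (c := s) (one_sub_mem_slitPlane hx)
  convert! this using 1
  simp only [id]
  rw [Complex.cpow_sub _ _ (one_sub_ne_zero_of_notMem_cutRay hx), Complex.cpow_one]
  ring

variable {J J' J'' : ℂ → ℂ} {U : Set ℂ}

theorem hasDerivAt_weight_mul (hJ : ∀ z ∈ U, HasDerivAt J (J' z) z) (hUc : U ⊆ cutRayᶜ) {x : ℂ}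
    (hx : x ∈ U) : HasDerivAt (fun x => (1 - x) ^ (ν : ℂ) * J x)
      ((1 - x) ^ (ν : ℂ) * (J' x - ν * J x / (1 - x))) x := by
  convert! (hasDerivAt_one_sub_cpow (hUc hx) ν).mul (hJ x hx) using 1
  ring

theorem hasDerivAt_weight_mul' (hJ : ∀ z ∈ U, HasDerivAt J (J' z) z)
    (hJ' : ∀ z ∈ U, HasDerivAt J' (J'' z) z) (hUc : U ⊆ cutRayᶜ) {x : ℂ} (hx : x ∈ U) :
    HasDerivAt (fun x => (1 - x) ^ (ν : ℂ) * (J' x - ν * J x / (1 - x)))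
      ((1 - x) ^ (ν : ℂ) * (J'' x - 2 * ν * J' x / (1 - x) + ν * (ν - 1) * J x / (1 - x) ^ 2))
      x := by
  have h0 := one_sub_ne_zero_of_notMem_cutRay (hUc hx)
  convert! (hasDerivAt_one_sub_cpow (hUc hx) ν).mul ((hJ' x hx).sub
    (((hJ x hx).const_mul (ν : ℂ)).div ((hasDerivAt_id x).const_sub 1) h0)) using 1
  simp only [id, Pi.sub_apply, Pi.div_apply]
  field_simp
  ring

theorem continuousOn_weight (hUc : U ⊆ cutRayᶜ) :
    ContinuousOn (fun x : ℂ => (1 - x) ^ (ν : ℂ)) U := fun _ hx =>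
  (hasDerivAt_one_sub_cpow (hUc hx) ν).continuousAt.continuousWithinAt

theorem differentiableOn_weightedEuler (h1 : -1 < ν) (h2 : ν < 0) (hU : IsOpen U)
    (hs : ∀ z ∈ U, ∀ v ∈ Icc (0 : ℝ) 1, z * v ∈ U) (hUc : U ⊆ cutRayᶜ)
    (hJ : DifferentiableOn ℂ J U) : DifferentiableOn ℂ (weightedEuler ν J) U := by
  have hd : ∀ z ∈ U, HasDerivAt J (deriv J z) z := fun z hz =>
    (hJ.differentiableAt (hU.mem_nhds hz)).hasDerivAt
  intro β hβ
  refine (hasDerivAt_eulerMoment h1 h2 hU hs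
    (fun z hz => hasDerivAt_weight_mul hd hUc hz) ?_ 0 hβ).differentiableAt.differentiableWithinAt
  refine (continuousOn_weight hUc).mul (((hJ.deriv hU).continuousOn).sub
    ((continuousOn_const.mul hJ.continuousOn).div (by fun_prop) fun x hx => ?_))
  exact one_sub_ne_zero_of_notMem_cutRay (hUc hx)

/-- Conjugation by `(1 - x) ^ ν`, which is itself annihilated by the operator under the integral,
removes the term without derivatives of `J`. What is left is of first order in `J'`. -/
theorem legendreOp_weightedEuler (h1 : -1 < ν) (h2 : ν < 0) (hU : IsOpen U)
    (hs : ∀ z ∈ U, ∀ v ∈ Icc (0 : ℝ) 1, z * v ∈ U) (hUc : U ⊆ cutRayᶜ)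
    (hJ : ∀ z ∈ U, HasDerivAt J (J' z) z) (hJ' : ∀ z ∈ U, HasDerivAt J' (J'' z) z)
    (hc : ContinuousOn J'' U) {β : ℂ} (hβ : β ∈ U) :
    legendreOp ν (weightedEuler ν J) β =
      ∫ v, (1 - β * (v : ℂ)) ^ (ν : ℂ) *
        (β * v * ((1 - β * v) * J'' (β * v) - (ν + 1) * J' (β * v))
          + (ν + 1) * (1 - β * v) * J' (β * v)) ∂betaMeasure (ν + 1) (-ν) := by
  have hcJ : ContinuousOn J U := fun z hz => (hJ z hz).continuousAt.continuousWithinAt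
  have hcJ' : ContinuousOn J' U := fun z hz => (hJ' z hz).continuousAt.continuousWithinAt
  have hne : ∀ x ∈ U, 1 - x ≠ 0 := fun x hx => one_sub_ne_zero_of_notMem_cutRay (hUc hx)
  unfold weightedEuler
  rw [legendreOp_eulerMoment h1 h2 hU hs (fun z hz => hasDerivAt_weight_mul hJ hUc hz)
    (fun z hz => hasDerivAt_weight_mul' hJ hJ' hUc hz) ?_ hβ]
  · refine integral_congr_ae (ae_betaMeasure_mem_Icc.mono fun v hv => ?_)
    have h0 := hne _ (hs β hβ v hv)
    dsimp only
    field_simp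
    ring
  · refine (continuousOn_weight hUc).mul ((hc.sub ?_).add ?_)
    · exact (continuousOn_const.mul hcJ').div (by fun_prop) hne
    · exact (continuousOn_const.mul hcJ).div (by fun_prop) fun x hx => pow_ne_zero 2 (hne x hx)

theorem legendreOp_weightedEuler_of_eq (h1 : -1 < ν) (h2 : ν < 0) (hU : IsOpen U)
    (hs : ∀ z ∈ U, ∀ v ∈ Icc (0 : ℝ) 1, z * v ∈ U) (hUc : U ⊆ cutRayᶜ)
    (hJ : ∀ z ∈ U, HasDerivAt J (J' z) z) (hJ' : ∀ z ∈ U, HasDerivAt J' (J'' z) z)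
    (hc : ContinuousOn J'' U) {c : ℂ}
    (heq : ∀ x ∈ U, x * ((1 - x) * J'' x - (ν + 1) * J' x) + (ν + 1) * (1 - x) * J' x = c)
    {β : ℂ} (hβ : β ∈ U) :
    legendreOp ν (weightedEuler ν J) β = c * legendreF ν β := by
  rw [legendreOp_weightedEuler h1 h2 hU hs hUc hJ hJ' hc hβ, legendreF, ← integral_const_mul]
  refine integral_congr_ae (ae_betaMeasure_mem_Icc.mono fun v hv => ?_)
  dsimp only
  rw [heq _ (hs β hβ v hv), mul_comm]

/-- The factor `β - α` stands outside the integral, while the hypothesis has `x - α` with `x = β v`.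
The discrepancy is `β` times the derivative of `v ^ (ν + 1) (1 - v) ^ (-ν) (1 - β v) ^ (ν + 1) J' (β
v)`, up to normalisation, and so integrates to zero. -/
theorem legendreOp_weightedEuler_of_pole (h1 : -1 < ν) (h2 : ν < 0) (hU : IsOpen U)
    (hs : ∀ z ∈ U, ∀ v ∈ Icc (0 : ℝ) 1, z * v ∈ U) (hUc : U ⊆ cutRayᶜ)
    (hJ : ∀ z ∈ U, HasDerivAt J (J' z) z) (hJ' : ∀ z ∈ U, HasDerivAt J' (J'' z) z)
    (hc : ContinuousOn J'' U) {c α : ℂ}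
    (heq : ∀ x ∈ U, x * (x - α) * ((1 - x) * J'' x - (ν + 1) * J' x)
      + (x - α * (ν + 1)) * (1 - x) * J' x = c)
    {β : ℂ} (hβ : β ∈ U) :
    (β - α) * legendreOp ν (weightedEuler ν J) β = c * legendreF ν β := by
  have := isProbabilityMeasure_betaMeasure (a := ν + 1) (b := -ν) (by linarith) (by linarith)
  have hcJ' : ContinuousOn J' U := fun z hz => (hJ' z hz).continuousAt.continuousWithinAt
  have cw := continuousOn_comp_mul hs (continuousOn_weight (ν := ν) hUc) hβ
  have c1 := continuousOn_comp_mul hs hcJ' hβ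
  have c2 := continuousOn_comp_mul hs hc hβ
  have hv : Continuous fun v : ℝ => (v : ℂ) := Complex.continuous_ofReal
  have stein := integral_betaMeasure_stein (a := ν + 1) (b := -ν) (by linarith) (by linarith)
    (k := fun v : ℝ => (1 - β * v) ^ (ν : ℂ) * ((1 - β * v) * J' (β * v)))
    (k' := fun v : ℝ => β * ((1 - β * v) ^ (ν : ℂ) *
      ((1 - β * v) * J'' (β * v) - (ν + 1) * J' (β * v))))
    (cw.mul (ContinuousOn.mul (by fun_prop) c1))
    (continuousOn_const.mul (cw.mul
      ((ContinuousOn.mul (by fun_prop) c2).sub (continuousOn_const.mul c1)))) (by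
      intro v hv
      have hm := hs β hβ v (Ioo_subset_Icc_self hv)
      have h0 := one_sub_ne_zero_of_notMem_cutRay (hUc hm)
      have d := (hasDerivAt_one_sub_cpow (hUc hm) ν).mul
        (((hasDerivAt_id (β * (v : ℂ))).const_sub 1).mul (hJ' _ hm))
      have := HasDerivAt.scomp (𝕜' := ℂ) v d
        ((Complex.ofRealCLM.hasDerivAt (x := v)).const_mul β)
      convert! this using 1
      simp only [id, Complex.ofRealCLM_apply, Complex.ofReal_one, smul_eq_mul, Pi.mul_apply]
      field_simp
      ring)
  rw [legendreOp_weightedEuler h1 h2 hU hs hUc hJ hJ' hc hβ, legendreF, ← integral_const_mul,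
    ← integral_const_mul, ← sub_eq_zero, ← integral_sub, ← mul_zero β, ← stein,
    ← integral_const_mul]
  · refine integral_congr_ae (ae_betaMeasure_mem_Icc.mono fun v hv => ?_)
    dsimp only
    rw [← heq _ (hs β hβ v hv)]
    push_cast
    ring
  · refine integrable_of_continuousOn_Icc ae_betaMeasure_mem_Icc
      (continuousOn_const.mul (cw.mul (ContinuousOn.add ?_ ?_)))
    · exact ContinuousOn.mul (by fun_prop)
        ((ContinuousOn.mul (by fun_prop) c2).sub (continuousOn_const.mul c1))
    · exact ContinuousOn.mul (by fun_prop) c1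
  · exact integrable_of_continuousOn_Icc ae_betaMeasure_mem_Icc (continuousOn_const.mul cw)

end WeightedEuler

/-! ### The identity theorem from a real interval. -/

section IdentityTheorem

theorem eqOn_of_eqOn_real_interval {f g : ℂ → ℂ} {U : Set ℂ} (hU : IsOpen U)
    (hc : IsPreconnected U) (hf : DifferentiableOn ℂ f U) (hg : DifferentiableOn ℂ g U)
    {a b : ℝ} (hab : a < b) (hs : ∀ r ∈ Ioo a b, (r : ℂ) ∈ U)
    (he : ∀ r ∈ Ioo a b, f (r : ℂ) = g (r : ℂ)) : EqOn f g U := by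
  obtain ⟨x, hx⟩ := exists_between hab
  refine (hf.analyticOnNhd hU).eqOn_of_preconnected_of_frequently_eq (hg.analyticOnNhd hU) hc
    (hs x hx) ?_
  have ht : Tendsto (fun r : ℝ => (r : ℂ)) (𝓝[>] x) (𝓝[≠] (x : ℂ)) := by
    refine tendsto_nhdsWithin_of_tendsto_nhds_of_eventually_within _
      ((Complex.continuous_ofReal.tendsto x).mono_left nhdsWithin_le_nhds) ?_
    filter_upwards [self_mem_nhdsWithin] with r hr
    simpa using (ne_of_gt hr)
  refine ht.frequently (Eventually.frequently ?_)
  filter_upwards [Ioo_mem_nhdsGT hx.2] with r hr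
  exact he r ⟨hx.1.trans hr.1, hr.2⟩

end IdentityTheorem

/-! ### The weighted Wronskian and the symmetry t ↦ 1 - t. -/

section LegendreWronskian

variable {ν : ℝ}

/-- The Wronskian of `f` and `g` with the weight `t (1 - t)`. -/
noncomputable def legendreWronskian (f g : ℂ → ℂ) (t : ℂ) : ℂ :=
  t * (1 - t) * (deriv f t * g t - deriv g t * f t)

/-- The weight `t (1 - t)` puts the Legendre operator in self-adjoint form, so this is Lagrange's
identity: the Wronskian of two solutions is locally constant, and an inhomogeneous term in `f` is
picked up multiplied by `g`. -/
theorem hasDerivAt_legendreWronskian (ν : ℝ) {f g : ℂ → ℂ} {U : Set ℂ} (hU : IsOpen U)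
    (hf : DifferentiableOn ℂ f U) (hg : DifferentiableOn ℂ g U) {t : ℂ} (ht : t ∈ U) :
    HasDerivAt (legendreWronskian f g)
      (legendreOp ν f t * g t - legendreOp ν g t * f t) t := by
  have df := (hf.differentiableAt (hU.mem_nhds ht)).hasDerivAt
  have dg := (hg.differentiableAt (hU.mem_nhds ht)).hasDerivAt
  have ddf := ((hf.deriv hU).differentiableAt (hU.mem_nhds ht)).hasDerivAt
  have ddg := ((hg.deriv hU).differentiableAt (hU.mem_nhds ht)).hasDerivAt
  have := ((hasDerivAt_id t).mul ((hasDerivAt_id t).const_sub 1)).mul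
    ((ddf.mul dg).sub (ddg.mul df))
  convert! this using 1
  simp only [id, Pi.mul_apply, Pi.sub_apply, legendreOp]
  ring

theorem deriv_comp_one_sub (f : ℂ → ℂ) :
    deriv (fun t => f (1 - t)) = fun t => -deriv f (1 - t) := by
  ext t
  exact deriv_comp_const_sub (f := f) 1 t

theorem legendreOp_comp_one_sub (f : ℂ → ℂ) (t : ℂ) :
    legendreOp ν (fun t => f (1 - t)) t = legendreOp ν f (1 - t) := by
  unfold legendreOp
  rw [deriv_comp_one_sub, deriv.fun_neg, deriv_comp_one_sub]
  ring

end LegendreWronskian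

/-! ### The Legendre function as a beta mean: equation, contiguity, absence of zeros. -/

section LegendreF

variable {ν : ℝ}

theorem legendreF_zero (h1 : -1 < ν) (h2 : ν < 0) : legendreF ν 0 = 1 := by
  have := isProbabilityMeasure_betaMeasure (a := ν + 1) (b := -ν) (by linarith) (by linarith)
  simp [legendreF]

theorem differentiableOn_legendreF (h1 : -1 < ν) (h2 : ν < 0) :
    DifferentiableOn ℂ (legendreF ν) cutRayᶜ := by
  rw [← weightedEuler_one]
  exact differentiableOn_weightedEuler h1 h2 isOpen_compl_cutRay
    (fun _ hz _ hv => mul_notMem_cutRay hz hv) le_rfl (differentiableOn_const _)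

theorem legendreOp_legendreF (h1 : -1 < ν) (h2 : ν < 0) {t : ℂ} (ht : t ∉ cutRay) :
    legendreOp ν (legendreF ν) t = 0 := by
  have := legendreOp_weightedEuler_of_eq (c := 0) (J := fun _ => 1) (J' := fun _ => 0)
    (J'' := fun _ => 0) h1 h2 isOpen_compl_cutRay
    (fun _ hz _ hv => mul_notMem_cutRay hz hv) le_rfl (fun z _ => hasDerivAt_const z 1)
    (fun z _ => hasDerivAt_const z 0) continuousOn_const (by simp) ht
  rwa [weightedEuler_one, zero_mul] at this

theorem deriv_legendreF (h1 : -1 < ν) (h2 : ν < 0) {t : ℂ} (ht : t ∉ cutRay) :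
    deriv (legendreF ν) t =
      ∫ u, (u : ℂ) * (-ν * ((1 - t * u) ^ (ν : ℂ) / (1 - t * u))) ∂betaMeasure (ν + 1) (-ν) := by
  have := hasDerivAt_eulerMoment h1 h2 isOpen_compl_cutRay
    (fun _ hz _ hv => mul_notMem_cutRay hz hv) (h := fun x => (1 - x) ^ (ν : ℂ))
    (fun _ hz => hasDerivAt_one_sub_cpow hz (ν : ℂ)) ?_ 0 ht
  · have e : legendreF ν = eulerMoment ν 0 fun x => (1 - x) ^ (ν : ℂ) := by
      ext t; simp [legendreF, eulerMoment]
    rw [e, this.deriv]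
    simp [eulerMoment]
  · exact continuousOn_const.mul ((continuousOn_weight le_rfl).div (by fun_prop)
      fun x hx => one_sub_ne_zero_of_notMem_cutRay hx)

theorem continuousOn_weight_mul {t : ℂ} (ht : t ∉ cutRay) :
    ContinuousOn (fun u : ℝ => (1 - t * (u : ℂ)) ^ (ν : ℂ)) (Icc 0 1) :=
  continuousOn_comp_mul (U := cutRayᶜ) (fun _ hz _ hv => mul_notMem_cutRay hz hv)
    (continuousOn_weight le_rfl) ht

theorem one_sub_mul_ne_zero {t : ℂ} (ht : t ∉ cutRay) {u : ℝ} (hu : u ∈ Icc (0 : ℝ) 1) :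
    1 - t * (u : ℂ) ≠ 0 :=
  one_sub_ne_zero_of_notMem_cutRay (mul_notMem_cutRay ht hu)

theorem hasDerivAt_weight_mul_real {t : ℂ} (ht : t ∉ cutRay) (s : ℂ) {u : ℝ}
    (hu : u ∈ Icc (0 : ℝ) 1) :
    HasDerivAt (fun u : ℝ => (1 - t * (u : ℂ)) ^ s)
      (-s * t * ((1 - t * u) ^ s / (1 - t * u))) u := by
  have := HasDerivAt.scomp (𝕜' := ℂ) u (hasDerivAt_one_sub_cpow (mul_notMem_cutRay ht hu) s)
    ((Complex.ofRealCLM.hasDerivAt (x := u)).const_mul t)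
  convert! this using 1
  simp
  ring

/-- The contiguity relation for the first moment. -/
theorem integral_mul_weight (h1 : -1 < ν) (h2 : ν < 0) {t : ℂ} (ht : t ∉ cutRay) :
    (ν + 1) * ∫ u, (u : ℂ) * (1 - t * u) ^ (ν : ℂ) ∂betaMeasure (ν + 1) (-ν)
      = (ν + 1) * legendreF ν t - (1 - t) * deriv (legendreF ν) t := by
  have := isProbabilityMeasure_betaMeasure (a := ν + 1) (b := -ν) (by linarith) (by linarith)
  have cw := continuousOn_weight_mul (ν := ν) ht
  have cd : ContinuousOn (fun u : ℝ => (1 - t * (u : ℂ)) ^ (ν : ℂ) / (1 - t * u)) (Icc 0 1) :=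
    cw.div (by fun_prop) fun u hu => one_sub_mul_ne_zero ht hu
  have stein := integral_betaMeasure_stein (a := ν + 1) (b := -ν) (by linarith) (by linarith)
    (k' := fun u : ℝ => -ν * t * ((1 - t * (u : ℂ)) ^ (ν : ℂ) / (1 - t * u)))
    cw (continuousOn_const.mul cd)
    (fun u hu => hasDerivAt_weight_mul_real ht (ν : ℂ) (Ioo_subset_Icc_self hu))
  have ii {F : ℝ → ℂ} (hF : ContinuousOn F (Icc 0 1)) : Integrable F (betaMeasure (ν + 1) (-ν)) :=
    integrable_of_continuousOn_Icc ae_betaMeasure_mem_Icc hF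
  have hv : Continuous fun v : ℝ => (v : ℂ) := Complex.continuous_ofReal
  rw [deriv_legendreF h1 h2 ht, legendreF, eq_comm, ← sub_eq_zero, ← stein, ← integral_const_mul,
    ← integral_const_mul, ← integral_const_mul, ← integral_sub, ← integral_sub, ← sub_eq_zero,
    ← integral_sub]
  · rw [← integral_zero (α := ℝ) (G := ℂ) (μ := betaMeasure (ν + 1) (-ν))]
    refine integral_congr_ae (ae_betaMeasure_mem_Icc.mono fun u hu => ?_)
    have := one_sub_mul_ne_zero ht hu
    push_cast
    field_simp
    ring
  all_goals refine ii ?_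
  all_goals fun_prop

theorem integral_ne_zero_of_re_mul_pos {μ : Measure ℝ} [IsProbabilityMeasure μ] {F : ℝ → ℂ}
    (hF : Integrable F μ) (c : ℂ) (hpos : ∀ᵐ u ∂μ, 0 < (c * F u).re) : ∫ u, F u ∂μ ≠ 0 := by
  intro h0
  have h1 : ∫ u, (c * F u).re ∂μ = 0 := by
    have h2 := integral_re (hF.const_mul c)
    rw [integral_const_mul, h0, mul_zero] at h2
    simpa using h2
  have h3 := (integral_eq_zero_iff_of_nonneg_ae (hpos.mono fun u hu => hu.le)
    (hF.const_mul c).re).1 h1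
  have : ∀ᵐ u ∂μ, False := by
    filter_upwards [h3, hpos] with u hu hu'
    exact hu'.ne' hu
  rw [eventually_false_iff_eq_bot, ae_eq_bot] at this
  exact IsProbabilityMeasure.ne_zero μ this

/-- For fixed `t` the numbers `1 - t u` lie on one side of the real axis, or are all positive when
`t` is real. As `|ν| < 1`, the powers `(1 - t u) ^ ν` then stay in one open half-plane, and so does
their mean, away from zero. -/
theorem legendreF_ne_zero (h1 : -1 < ν) (h2 : ν < 0) {t : ℂ} (ht : t ∉ cutRay) :
    legendreF ν t ≠ 0 := by
  have := isProbabilityMeasure_betaMeasure (a := ν + 1) (b := -ν) (by linarith) (by linarith)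
  have hF : Integrable (fun u : ℝ => (1 - t * (u : ℂ)) ^ (ν : ℂ)) (betaMeasure (ν + 1) (-ν)) :=
    integrable_of_continuousOn_Icc ae_betaMeasure_mem_Icc (continuousOn_weight_mul ht)
  have key : ∀ u ∈ Ioo (0 : ℝ) 1, ∃ ρ : ℝ, 0 < ρ ∧ (1 - t * (u : ℂ)) ^ (ν : ℂ)
      = ρ * (Complex.cos ((ν * (1 - t * u).arg : ℝ))
        + Complex.sin ((ν * (1 - t * u).arg : ℝ)) * Complex.I) := by
    intro u hu
    have hne := one_sub_mul_ne_zero ht (Ioo_subset_Icc_self hu)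
    refine ⟨Real.exp (ν * Real.log ‖1 - t * (u : ℂ)‖), Real.exp_pos _, ?_⟩
    rw [Complex.cpow_def_of_ne_zero hne, ← Complex.exp_mul_I, Complex.ofReal_exp, ← Complex.exp_add,
      Complex.log]
    congr 1
    push_cast
    ring
  have him : ∀ u : ℝ, (1 - t * (u : ℂ)).im = -(t.im * u) := fun u => by simp
  rcases lt_trichotomy t.im 0 with hi | hi | hi
  · refine integral_ne_zero_of_re_mul_pos hF Complex.I (ae_betaMeasure_mem_Ioo.mono fun u hu => ?_)
    obtain ⟨ρ, hρ, e⟩ := key u hu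
    have ha : 0 < (1 - t * (u : ℂ)).im := by rw [him]; nlinarith [hu.1]
    have ha0 := Complex.arg_nonneg_iff.2 ha.le
    have ha1 : (1 - t * (u : ℂ)).arg ≠ 0 := fun h => by
      rw [Complex.arg_eq_zero_iff] at h; linarith [h.2]
    have ha2 := lt_of_le_of_ne ha0 ha1.symm
    have ha3 := Complex.arg_le_pi (1 - t * (u : ℂ))
    have hs : Real.sin (ν * (1 - t * (u : ℂ)).arg) < 0 :=
      Real.sin_neg_of_neg_of_neg_pi_lt (by nlinarith) (by nlinarith [Real.pi_pos])
    rw [e, ← Complex.ofReal_cos, ← Complex.ofReal_sin]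
    simp [-Complex.ofReal_sin, -Complex.ofReal_cos, -Complex.ofReal_mul]
    nlinarith
  · refine integral_ne_zero_of_re_mul_pos hF 1 (ae_betaMeasure_mem_Ioo.mono fun u hu => ?_)
    obtain ⟨ρ, hρ, e⟩ := key u hu
    have hsl := one_sub_mem_slitPlane (mul_notMem_cutRay ht (Ioo_subset_Icc_self hu))
    have ha : (1 - t * (u : ℂ)).arg = 0 := by
      rw [Complex.arg_eq_zero_iff]
      have h0 : (1 - t * (u : ℂ)).im = 0 := by rw [him, hi]; simp
      refine ⟨?_, h0⟩
      rcases hsl with h | h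
      · exact h.le
      · exact absurd h0 h
    rw [e, ha]
    simpa using hρ
  · refine integral_ne_zero_of_re_mul_pos hF (-Complex.I)
      (ae_betaMeasure_mem_Ioo.mono fun u hu => ?_)
    obtain ⟨ρ, hρ, e⟩ := key u hu
    have ha : (1 - t * (u : ℂ)).im < 0 := by rw [him]; nlinarith [hu.1]
    have ha2 := Complex.arg_neg_iff.2 ha
    have ha3 := Complex.neg_pi_lt_arg (1 - t * (u : ℂ))
    have hs : 0 < Real.sin (ν * (1 - t * (u : ℂ)).arg) :=
      Real.sin_pos_of_pos_of_lt_pi (by nlinarith) (by nlinarith [Real.pi_pos])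
    rw [e, ← Complex.ofReal_cos, ← Complex.ofReal_sin]
    simp [-Complex.ofReal_sin, -Complex.ofReal_cos, -Complex.ofReal_mul]
    nlinarith

end LegendreF

/-! ### The symmetry ν ↔ -ν - 1. -/

section Reflection

variable {ν : ℝ}

theorem beta_comm (a b : ℝ) : beta a b = beta b a := by
  unfold beta
  rw [mul_comm, add_comm]

/-- The involution `v ↦ (1 - v) / (1 - β v)` exchanges the degrees `ν` and `-ν - 1`. -/
theorem integral_betaMeasure_involution (h1 : -1 < ν) (h2 : ν < 0) {β : ℝ} (hβ : β < 1)
    (f : ℝ → ℂ) :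
    ∫ v, (1 - β * (v : ℂ)) ^ ((-ν - 1 : ℝ) : ℂ) * f ((1 - v) / (1 - β * v))
        ∂betaMeasure (-ν) (ν + 1)
      = ∫ v, (1 - β * (v : ℂ)) ^ (ν : ℂ) * f v ∂betaMeasure (ν + 1) (-ν) := by
  have hpos : ∀ v ∈ Ioo (0 : ℝ) 1, 0 < 1 - β * v := fun v hv => by nlinarith [hv.1, hv.2]
  have himg : (fun v : ℝ => (1 - v) / (1 - β * v)) '' Ioo 0 1 = Ioo 0 1 := by
    have hmaps : ∀ v ∈ Ioo (0 : ℝ) 1, (1 - v) / (1 - β * v) ∈ Ioo (0 : ℝ) 1 := fun v hv =>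
      ⟨div_pos (by linarith [hv.2]) (hpos v hv), by
        rw [div_lt_one (hpos v hv)]; nlinarith [hv.1]⟩
    refine Subset.antisymm ?_ fun v hv => ⟨(1 - v) / (1 - β * v), hmaps v hv, ?_⟩
    · rintro _ ⟨v, hv, rfl⟩
      exact hmaps v hv
    · have h := (hpos v hv).ne'
      have hb : 1 - β ≠ 0 := by linarith
      dsimp only
      have e1 : 1 - (1 - v) / (1 - β * v) = (1 - β) * v / (1 - β * v) := by
        rw [eq_div_iff h, sub_mul, div_mul_cancel₀ _ h]; ring
      have e2 : 1 - β * ((1 - v) / (1 - β * v)) = (1 - β) / (1 - β * v) := by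
        field_simp; ring
      rw [e1, e2]
      field_simp
  have hd : ∀ v ∈ Ioo (0 : ℝ) 1, HasDerivWithinAt (fun v : ℝ => (1 - v) / (1 - β * v))
      (-(1 - β) / (1 - β * v) ^ 2) (Ioo 0 1) v := fun v hv => by
    have := ((hasDerivAt_id v).const_sub 1).div (((hasDerivAt_id v).const_mul β).const_sub 1)
      (hpos v hv).ne'
    convert! this.hasDerivWithinAt using 1
    simp only [id]
    ring
  have hinj : InjOn (fun v : ℝ => (1 - v) / (1 - β * v)) (Ioo 0 1) := by
    intro v hv w hw h
    have h' := (div_eq_div_iff (hpos v hv).ne' (hpos w hw).ne').1 h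
    have : (1 - β) * (v - w) = 0 := by linarith
    rcases mul_eq_zero.1 this with h | h <;> linarith
  rw [integral_betaMeasure (by linarith) (by linarith),
    integral_betaMeasure (by linarith) (by linarith), beta_comm,
    intervalIntegral.integral_of_le zero_le_one, intervalIntegral.integral_of_le zero_le_one,
    integral_Ioc_eq_integral_Ioo, integral_Ioc_eq_integral_Ioo]
  congr 1
  conv_rhs => rw [← himg]
  rw [integral_image_eq_integral_abs_deriv_smul measurableSet_Ioo hd hinj]
  refine setIntegral_congr_fun measurableSet_Ioo fun v hv => ?_
  have hp := hpos v hv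
  have hb : 0 < 1 - β := by linarith
  have hv1 : 0 < 1 - v := by linarith [hv.2]
  have e1 : 1 - (1 - v) / (1 - β * v) = (1 - β) * v / (1 - β * v) := by
    rw [eq_div_iff hp.ne', sub_mul, div_mul_cancel₀ _ hp.ne']; ring
  have e2 : 1 - β * ((1 - v) / (1 - β * v)) = (1 - β) / (1 - β * v) := by
    field_simp; ring
  have c1 : (1 - β * (v : ℂ)) ^ ((-ν - 1 : ℝ) : ℂ) = (((1 - β * v) ^ (-ν - 1) : ℝ) : ℂ) := by
    rw [Complex.ofReal_cpow hp.le]; push_cast; rfl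
  have c2 : (1 - β * (((1 - v) / (1 - β * v) : ℝ) : ℂ)) ^ (ν : ℂ)
      = ((((1 - β) / (1 - β * v)) ^ ν : ℝ) : ℂ) := by
    rw [Complex.ofReal_cpow (by positivity), ← e2]; push_cast; rfl
  -- The Jacobian `(1 - β) / (1 - β v) ^ 2` absorbs the powers of `1 - β` and `1 - β v` created by
  -- the substitution.
  have hreal : v ^ (-ν - 1) * (1 - v) ^ (ν + 1 - 1) * (1 - β * v) ^ (-ν - 1)
      = |-(1 - β) / (1 - β * v) ^ 2| * (((1 - v) / (1 - β * v)) ^ (ν + 1 - 1) *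
        (1 - (1 - v) / (1 - β * v)) ^ (-ν - 1)) * ((1 - β) / (1 - β * v)) ^ ν := by
    have ha : |-(1 - β) / (1 - β * v) ^ 2| = (1 - β) / (1 - β * v) ^ 2 := by
      rw [neg_div, abs_neg, abs_of_pos (by positivity)]
    rw [ha, e1, Real.div_rpow hv1.le hp.le, Real.div_rpow (mul_nonneg hb.le hv.1.le) hp.le,
      Real.div_rpow hb.le hp.le, Real.mul_rpow hb.le hv.1.le]
    have f1 : ν + 1 - 1 = ν := by ring
    have f2 : (1 - β) ^ (-ν - 1) = ((1 - β) ^ ν)⁻¹ / (1 - β) := by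
      rw [Real.rpow_sub_one hb.ne', Real.rpow_neg hb.le]
    have f3 : (1 - β * v) ^ (-ν - 1) = ((1 - β * v) ^ ν)⁻¹ / (1 - β * v) := by
      rw [Real.rpow_sub_one hp.ne', Real.rpow_neg hp.le]
    rw [f1, f2, f3]
    have g1 : (1 - β) ^ ν ≠ 0 := (Real.rpow_pos_of_pos hb ν).ne'
    have g2 : (1 - β * v) ^ ν ≠ 0 := (Real.rpow_pos_of_pos hp ν).ne'
    have g3 := hb.ne'
    have g4 := hp.ne'
    field_simp
  rw [c1, c2, Complex.real_smul, ← mul_assoc, ← Complex.ofReal_mul, hreal]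
  push_cast
  ring

/-- The involution with `f = 1` gives the equality on `(0, 1)`, and the identity theorem extends it.
It lets both expectations over `V` in the entropy coupling share one denominator. -/
theorem legendreF_neg_sub_one (h1 : -1 < ν) (h2 : ν < 0) {t : ℂ} (ht : t ∉ cutRay) :
    legendreF (-ν - 1) t = legendreF ν t := by
  refine eqOn_of_eqOn_real_interval isOpen_compl_cutRay isPreconnected_compl_cutRay
    (differentiableOn_legendreF (by linarith) (by linarith)) (differentiableOn_legendreF h1 h2)
    (zero_lt_one' ℝ) ?_ ?_ ht
  · intro r hr
    exact (mem_doubleSlit_iff.1 (ofReal_mem_doubleSlit hr.1 hr.2)).1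
  · intro r hr
    have := integral_betaMeasure_involution h1 h2 hr.2 (fun _ => 1)
    simp only [mul_one] at this
    unfold legendreF
    rw [← this]
    congr 2 <;> ring

end Reflection

/-! ### Passing from the weights of the statement to beta means. -/

section Normalization

variable {ν : ℝ}

/-- Euler's reflection formula for Γ; this is what makes the prefactor `-sin (ν π) / π` in
`legendreP` normalise the measure to mass one. -/
theorem beta_add_one_neg : beta (ν + 1) (-ν) = -(π / Real.sin (ν * π)) := by
  have := Real.Gamma_mul_Gamma_one_sub (-ν)
  unfold beta
  rw [add_neg_cancel_comm, Real.Gamma_one, div_one, mul_comm, add_comm, ← sub_neg_eq_add, this,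
    mul_neg, Real.sin_neg, div_neg, mul_comm]

theorem beta_add_one_neg_ne_zero (h1 : -1 < ν) (h2 : ν < 0) :
    ((beta (ν + 1) (-ν) : ℝ) : ℂ) ≠ 0 :=
  Complex.ofReal_ne_zero.2 (beta_pos (by linarith) (by linarith)).ne'

theorem legendreWeight_eq {u : ℝ} (hu : u ∈ Ioo (0 : ℝ) 1) (t : ℂ) :
    legendreWeight ν t u
      = ((u ^ (ν + 1 - 1) * (1 - u) ^ (-ν - 1) : ℝ) : ℂ) * (1 - t * u) ^ (ν : ℂ) := by
  have h1 : 0 < 1 - u := by linarith [hu.2]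
  have e1 : (1 - (u : ℂ)) ^ ((ν : ℂ) + 1) = (((1 - u) ^ (ν + 1) : ℝ) : ℂ) := by
    rw [Complex.ofReal_cpow h1.le]; push_cast; rfl
  rw [legendreWeight, e1, ← Complex.ofReal_cpow hu.1.le, add_sub_cancel_right,
    show -ν - 1 = -(ν + 1) by ring, Real.rpow_neg h1.le]
  push_cast
  ring

theorem integral_mul_legendreWeight (h1 : -1 < ν) (h2 : ν < 0) (f : ℝ → ℂ) (t : ℂ) :
    ∫ u in (0 : ℝ)..1, f u * legendreWeight ν t u
      = (beta (ν + 1) (-ν) : ℝ) *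
        ∫ u, (1 - t * (u : ℂ)) ^ (ν : ℂ) * f u ∂betaMeasure (ν + 1) (-ν) := by
  rw [integral_betaMeasure (by linarith) (by linarith),
    mul_inv_cancel_left₀ (beta_add_one_neg_ne_zero h1 h2),
    intervalIntegral.integral_of_le zero_le_one, intervalIntegral.integral_of_le zero_le_one,
    integral_Ioc_eq_integral_Ioo, integral_Ioc_eq_integral_Ioo]
  refine setIntegral_congr_fun measurableSet_Ioo fun u hu => ?_
  rw [legendreWeight_eq hu]
  ring

theorem integral_legendreWeight (h1 : -1 < ν) (h2 : ν < 0) (t : ℂ) :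
    ∫ u in (0 : ℝ)..1, legendreWeight ν t u = (beta (ν + 1) (-ν) : ℝ) * legendreF ν t := by
  simpa [legendreF] using integral_mul_legendreWeight h1 h2 (fun _ => 1) t

theorem legendreP_eq (h1 : -1 < ν) (h2 : ν < 0) (ξ : ℂ) :
    legendreP ν ξ = legendreF ν ((1 - ξ) / 2) := by
  have hs : Real.sin (ν * π) ≠ 0 := (Real.sin_neg_of_neg_of_neg_pi_lt
    (by nlinarith [Real.pi_pos]) (by nlinarith [Real.pi_pos])).ne
  rw [legendreP, integral_legendreWeight h1 h2, beta_add_one_neg, ← mul_assoc]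
  have : -((Real.sin (ν * π) / π : ℝ) : ℂ) * ((-(π / Real.sin (ν * π)) : ℝ) : ℂ) = 1 := by
    rw [← Complex.ofReal_neg, ← Complex.ofReal_mul, neg_mul_neg, div_mul_div_cancel₀ Real.pi_ne_zero,
      div_self hs, Complex.ofReal_one]
  rw [this, one_mul]

theorem legendreP_one_sub (h1 : -1 < ν) (h2 : ν < 0) (t : ℂ) :
    legendreP ν (1 - 2 * t) = legendreF ν t := by
  rw [legendreP_eq h1 h2]; congr 1; ring

theorem legendreP_sub_one (h1 : -1 < ν) (h2 : ν < 0) (t : ℂ) :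
    legendreP ν (2 * t - 1) = legendreF ν (1 - t) := by
  rw [legendreP_eq h1 h2]; congr 1; ring

theorem legendreExpect_eq (h1 : -1 < ν) (h2 : ν < 0) (f : ℝ → ℂ) (t : ℂ) :
    legendreExpect ν t f
      = (∫ u, (1 - t * (u : ℂ)) ^ (ν : ℂ) * f u ∂betaMeasure (ν + 1) (-ν)) / legendreF ν t := by
  rw [legendreExpect, integral_mul_legendreWeight h1 h2, integral_legendreWeight h1 h2,
    mul_div_mul_left _ _ (beta_add_one_neg_ne_zero h1 h2)]

end Normalization

/-! ### The constant value of the Wronskian of q and p. -/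

section MirrorWronskian

variable {ν : ℝ}

theorem differentiableOn_mirror (h1 : -1 < ν) (h2 : ν < 0) :
    DifferentiableOn ℂ (fun t => legendreF ν (1 - t)) doubleSlit :=
  (differentiableOn_legendreF h1 h2).comp (f := fun t => 1 - t) (by fun_prop)
    fun _ ht => (mem_doubleSlit_iff.1 ht).2

theorem differentiableOn_legendreF_doubleSlit (h1 : -1 < ν) (h2 : ν < 0) :
    DifferentiableOn ℂ (legendreF ν) doubleSlit :=
  (differentiableOn_legendreF h1 h2).mono fun _ ht => (mem_doubleSlit_iff.1 ht).1

theorem legendreOp_mirror (h1 : -1 < ν) (h2 : ν < 0) {t : ℂ} (ht : t ∈ doubleSlit) :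
    legendreOp ν (fun t => legendreF ν (1 - t)) t = 0 := by
  rw [legendreOp_comp_one_sub, legendreOp_legendreF h1 h2 (mem_doubleSlit_iff.1 ht).2]

/-- Every `1 - (1 - t) u` is at least `t`, and `ν < 0`, so the mean is at most `t ^ ν`; the extra
factor `t` then leaves `t ^ (ν + 1)`. -/
theorem tendsto_mul_mirror (h1 : -1 < ν) (h2 : ν < 0) :
    Tendsto (fun t : ℝ => (t : ℂ) * legendreF ν (1 - t)) (𝓝[>] 0) (𝓝 0) := by
  have := isProbabilityMeasure_betaMeasure (a := ν + 1) (b := -ν) (by linarith) (by linarith)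
  have hlim : Tendsto (fun t : ℝ => t ^ (ν + 1)) (𝓝[>] 0) (𝓝 0) := by
    have := (Real.continuous_rpow_const (q := ν + 1) (by linarith)).tendsto 0
    rw [Real.zero_rpow (by linarith)] at this
    exact this.mono_left nhdsWithin_le_nhds
  refine squeeze_zero_norm' ?_ hlim
  filter_upwards [Ioo_mem_nhdsGT (zero_lt_one' ℝ)] with t ht
  have hb : ‖legendreF ν (1 - t)‖ ≤ t ^ ν := by
    unfold legendreF
    have := norm_integral_le_of_norm_le_const (μ := betaMeasure (ν + 1) (-ν)) (C := t ^ ν)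
      (f := fun u : ℝ => (1 - (1 - (t : ℂ)) * (u : ℂ)) ^ (ν : ℂ))
      (ae_betaMeasure_mem_Icc.mono fun u hu => ?_)
    · simpa using this
    · have e : (1 - (1 - (t : ℂ)) * (u : ℂ)) = ((1 - (1 - t) * u : ℝ) : ℂ) := by push_cast; ring
      have hle : t ≤ 1 - (1 - t) * u := by nlinarith [hu.2, ht.2]
      rw [e, Complex.norm_cpow_eq_rpow_re_of_pos (by linarith [ht.1]), Complex.ofReal_re]
      exact Real.rpow_le_rpow_of_nonpos ht.1 hle h2.le
  rw [norm_mul, Complex.norm_real, Real.norm_of_nonneg ht.1.le, Real.rpow_add_one ht.1.ne',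
    mul_comm]
  exact mul_le_mul_of_nonneg_right hb ht.1.le

/-- The integral for the derivative degenerates as `t → 0`. The involution with parameter `1 - t`
turns `t v / (1 - (1 - t) v)` into `1 - y`, and the transformed integrand is bounded uniformly in
`t`. -/
theorem mul_deriv_mirror (h1 : -1 < ν) (h2 : ν < 0) {t : ℝ} (ht : t ∈ Ioo (0 : ℝ) 1) :
    (t : ℂ) * deriv (fun t => legendreF ν (1 - t)) (t : ℂ)
      = ν * ∫ y, (1 - (1 - (t : ℂ)) * y) ^ ((-ν - 1 : ℝ) : ℂ) * (1 - (y : ℂ))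
          ∂betaMeasure (-ν) (ν + 1) := by
  have hm : 1 - (t : ℂ) ∉ cutRay := (mem_doubleSlit_iff.1 (ofReal_mem_doubleSlit ht.1 ht.2)).2
  have inv := integral_betaMeasure_involution h1 h2 (β := 1 - t) (by linarith [ht.1])
    (fun v => (t : ℂ) * v / (1 - (1 - (t : ℂ)) * v))
  have e1 : ∫ y, (1 - (1 - (t : ℂ)) * y) ^ ((-ν - 1 : ℝ) : ℂ) * (1 - (y : ℂ))
          ∂betaMeasure (-ν) (ν + 1) = ∫ v, (1 - (1 - (t : ℂ)) * (v : ℂ)) ^ (ν : ℂ) *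
          ((t : ℂ) * v / (1 - (1 - (t : ℂ)) * v)) ∂betaMeasure (ν + 1) (-ν) := by
    push_cast at inv
    push_cast
    rw [← inv]
    refine integral_congr_ae (ae_betaMeasure_mem_Icc.mono fun u hu => ?_)
    have hne := one_sub_mul_ne_zero hm hu
    have ht0 : (t : ℂ) ≠ 0 := Complex.ofReal_ne_zero.2 ht.1.ne'
    have e2 : 1 - (1 - (t : ℂ)) * ((1 - u) / (1 - (1 - t) * u)) = t / (1 - (1 - t) * u) := by
      rw [eq_div_iff hne, sub_mul, mul_assoc, div_mul_cancel₀ _ hne]; ring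
    dsimp only
    rw [e2]
    congr 1
    rw [eq_div_iff (div_ne_zero ht0 hne)]
    ring
  simp only [deriv_comp_one_sub]
  rw [deriv_legendreF h1 h2 hm, e1, ← integral_const_mul, ← integral_neg,
    ← integral_const_mul]
  congr 1
  ext v
  ring

/-- Dominated convergence in the transformed integral, with bound `(1 - u) ^ (-ν) ≤ 1`. In the limit
the powers of `1 - u` cancel against the beta density and `∫ u ^ (-ν - 1) = -1 / ν` remains. -/
theorem tendsto_mul_deriv_mirror (h1 : -1 < ν) (h2 : ν < 0) :
    Tendsto (fun t : ℝ => (t : ℂ) * deriv (fun t => legendreF ν (1 - t)) (t : ℂ)) (𝓝[>] 0)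
      (𝓝 (-((beta (ν + 1) (-ν) : ℝ) : ℂ)⁻¹)) := by
  have := isProbabilityMeasure_betaMeasure (a := -ν) (b := ν + 1) (by linarith) (by linarith)
  have hval : -((beta (ν + 1) (-ν) : ℝ) : ℂ)⁻¹
      = ν * ∫ y, (1 - (y : ℂ)) ^ ((-ν - 1 : ℝ) : ℂ) * (1 - (y : ℂ))
          ∂betaMeasure (-ν) (ν + 1) := by
    rw [integral_betaMeasure (by linarith) (by linarith), beta_comm]
    have : ∫ u in (0 : ℝ)..1, ((u ^ (-ν - 1) * (1 - u) ^ (ν + 1 - 1) : ℝ) : ℂ) *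
        ((1 - (u : ℂ)) ^ ((-ν - 1 : ℝ) : ℂ) * (1 - (u : ℂ)))
        = ((∫ u in (0 : ℝ)..1, u ^ (-ν - 1) : ℝ) : ℂ) := by
      rw [← intervalIntegral.integral_ofReal]
      rw [intervalIntegral.integral_of_le zero_le_one,
        intervalIntegral.integral_of_le zero_le_one, integral_Ioc_eq_integral_Ioo,
        integral_Ioc_eq_integral_Ioo]
      refine setIntegral_congr_fun measurableSet_Ioo fun u hu => ?_
      have hp : 0 < 1 - u := by linarith [hu.2]
      have e : (1 - (u : ℂ)) = ((1 - u : ℝ) : ℂ) := by push_cast; rfl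
      rw [e, ← Complex.ofReal_cpow hp.le, ← Complex.ofReal_mul, ← Complex.ofReal_mul, mul_assoc,
        ← Real.rpow_add_one hp.ne', ← Real.rpow_add hp]
      ring_nf
      simp
    have hν : (ν : ℂ) ≠ 0 := Complex.ofReal_ne_zero.2 h2.ne
    rw [this, integral_rpow (Or.inl (by linarith)), sub_add_cancel, Real.one_rpow,
      Real.zero_rpow (by linarith)]
    push_cast
    rw [sub_zero]
    field_simp
  rw [hval]
  have hcongr : (fun t : ℝ => (ν : ℂ) *
      ∫ y, (1 - (1 - (t : ℂ)) * y) ^ ((-ν - 1 : ℝ) : ℂ) * (1 - (y : ℂ))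
          ∂betaMeasure (-ν) (ν + 1)) =ᶠ[𝓝[>] 0]
      fun t : ℝ => (t : ℂ) * deriv (fun t => legendreF ν (1 - t)) (t : ℂ) := by
    filter_upwards [Ioo_mem_nhdsGT (zero_lt_one' ℝ)] with t ht
    exact (mul_deriv_mirror h1 h2 ht).symm
  refine Tendsto.congr' hcongr (Tendsto.const_mul _ ?_)
  have hcast : ∀ t u : ℝ, (1 - (1 - (t : ℂ)) * (u : ℂ)) = ((1 - (1 - t) * u : ℝ) : ℂ) :=
    fun t u => by push_cast; ring
  refine tendsto_integral_filter_of_dominated_convergence (fun _ => 1) ?_ ?_ (integrable_const _) ?_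
  · filter_upwards [Ioo_mem_nhdsGT (zero_lt_one' ℝ)] with t ht
    refine (integrable_of_continuousOn_Icc ae_betaMeasure_mem_Icc
      (ContinuousOn.mul (continuousOn_comp_mul (U := cutRayᶜ) (h := fun x => (1 - x) ^
        ((-ν - 1 : ℝ) : ℂ)) (fun _ hz _ hv => mul_notMem_cutRay hz hv)
        (continuousOn_weight le_rfl) ?_) (by fun_prop))).aestronglyMeasurable
    exact (mem_doubleSlit_iff.1 (ofReal_mem_doubleSlit ht.1 ht.2)).2
  · filter_upwards [Ioo_mem_nhdsGT (zero_lt_one' ℝ)] with t ht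
    refine ae_betaMeasure_mem_Ioo.mono fun u hu => ?_
    have hp : 0 < 1 - u := by linarith [hu.2]
    have hle : 1 - u ≤ 1 - (1 - t) * u := by nlinarith [hu.1, ht.1]
    have e : (1 - (u : ℂ)) = ((1 - u : ℝ) : ℂ) := by push_cast; rfl
    rw [hcast, e, norm_mul, Complex.norm_cpow_eq_rpow_re_of_pos (by linarith), Complex.norm_real,
      Real.norm_of_nonneg hp.le, Complex.ofReal_re]
    calc (1 - (1 - t) * u) ^ (-ν - 1) * (1 - u) ≤ (1 - u) ^ (-ν - 1) * (1 - u) :=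
          mul_le_mul_of_nonneg_right
            (Real.rpow_le_rpow_of_nonpos hp hle (by linarith)) hp.le
      _ = (1 - u) ^ (-ν) := by rw [← Real.rpow_add_one hp.ne']; congr 1; ring
      _ ≤ 1 := Real.rpow_le_one hp.le (by linarith [hu.1]) (by linarith)
  · refine ae_betaMeasure_mem_Ioo.mono fun u hu => ?_
    refine Tendsto.mul_const _ ?_
    have hc : ContinuousAt (fun t : ℝ => (1 - (1 - (t : ℂ)) * (u : ℂ)) ^ ((-ν - 1 : ℝ) : ℂ)) 0 := by
      refine ContinuousAt.cpow (by fun_prop) continuousAt_const ?_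
      rw [hcast]
      refine Complex.ofReal_mem_slitPlane.2 ?_
      linarith [hu.2]
    have := hc.tendsto
    simp only [Complex.ofReal_zero, sub_zero, one_mul] at this
    exact this.mono_left nhdsWithin_le_nhds

/-- The Wronskian of `P_ν(2 t - 1)` and `P_ν(1 - 2 t)`. -/
theorem legendreWronskian_mirror (h1 : -1 < ν) (h2 : ν < 0) {t : ℂ} (ht : t ∈ doubleSlit) :
    legendreWronskian (fun t => legendreF ν (1 - t)) (legendreF ν) t
      = -((beta (ν + 1) (-ν) : ℝ) : ℂ)⁻¹ := by
  have hd : ∀ z ∈ doubleSlit, HasDerivAt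
      (legendreWronskian (fun t => legendreF ν (1 - t)) (legendreF ν)) 0 z := fun z hz => by
    have := hasDerivAt_legendreWronskian ν isOpen_doubleSlit (differentiableOn_mirror h1 h2)
      (differentiableOn_legendreF_doubleSlit h1 h2) hz
    rwa [legendreOp_mirror h1 h2 hz, legendreOp_legendreF h1 h2 (mem_doubleSlit_iff.1 hz).1,
      zero_mul, zero_mul, sub_zero] at this
  have hconst : ∀ r ∈ Ioo (0 : ℝ) 1,
      legendreWronskian (fun t => legendreF ν (1 - t)) (legendreF ν) (r : ℂ)
        = legendreWronskian (fun t => legendreF ν (1 - t)) (legendreF ν) t := fun r hr =>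
    isOpen_doubleSlit.is_const_of_deriv_eq_zero isPreconnected_doubleSlit
      (fun z hz => (hd z hz).differentiableAt.differentiableWithinAt)
      (fun z hz => (hd z hz).deriv) (ofReal_mem_doubleSlit hr.1 hr.2) ht
  have hcast : Tendsto (fun r : ℝ => (r : ℂ)) (𝓝[>] 0) (𝓝 0) := by
    have := Complex.continuous_ofReal.tendsto (0 : ℝ)
    rw [Complex.ofReal_zero] at this
    exact this.mono_left nhdsWithin_le_nhds
  have h0 : cutRayᶜ ∈ 𝓝 (0 : ℂ) := isOpen_compl_cutRay.mem_nhds zero_notMem_cutRay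
  have lp : Tendsto (fun r : ℝ => legendreF ν r) (𝓝[>] 0) (𝓝 1) := by
    have := ((differentiableOn_legendreF h1 h2).differentiableAt h0).continuousAt.tendsto
    rw [legendreF_zero h1 h2] at this
    exact this.comp hcast
  have lp' : Tendsto (fun r : ℝ => deriv (legendreF ν) r) (𝓝[>] 0)
      (𝓝 (deriv (legendreF ν) 0)) :=
    (((differentiableOn_legendreF h1 h2).deriv
      isOpen_compl_cutRay).differentiableAt h0).continuousAt.tendsto.comp hcast
  -- The singular factors are paired with `t`: the Wronskian is regrouped as `(1 - t) ((t q') p - (t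
  -- q) p')`.
  have lim : Tendsto (fun r : ℝ =>
      legendreWronskian (fun t => legendreF ν (1 - t)) (legendreF ν) (r : ℂ)) (𝓝[>] 0)
      (𝓝 ((1 - 0) * (-((beta (ν + 1) (-ν) : ℝ) : ℂ)⁻¹ * 1 - 0 * deriv (legendreF ν) 0))) := by
    refine Tendsto.congr (fun r => ?_) ((hcast.const_sub 1).mul
      (((tendsto_mul_deriv_mirror h1 h2).mul lp).sub ((tendsto_mul_mirror h1 h2).mul lp')))
    unfold legendreWronskian
    ring
  have lim' := tendsto_const_nhds.congr' (f₁ := fun _ : ℝ =>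
    legendreWronskian (fun t => legendreF ν (1 - t)) (legendreF ν) t) (by
      filter_upwards [Ioo_mem_nhdsGT (zero_lt_one' ℝ)] with r hr using (hconst r hr).symm)
  rw [tendsto_nhds_unique lim' lim]
  ring

end MirrorWronskian

/-! ### Primitives on star-shaped domains. -/

section Primitives

/-- Holomorphic functions on star-shaped domains have primitives. -/
theorem exists_primitive_of_starConvex {U : Set ℂ} (hU : IsOpen U) {c : ℂ}
    (hs : StarConvex ℝ c U) {g : ℂ → ℂ} (hg : DifferentiableOn ℂ g U) :
    ∃ G : ℂ → ℂ, ∀ z ∈ U, HasDerivAt G (g z) z := by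
  have hm : ∀ z ∈ U, ∀ s ∈ Icc (0 : ℝ) 1, c + s * (z - c) ∈ U := fun z hz s hs' => by
    have := hs.add_smul_sub_mem hz hs'.1 hs'.2
    simpa [Complex.real_smul] using this
  have hd : ∀ z ∈ U, HasDerivAt g (deriv g z) z := fun z hz =>
    (hg.differentiableAt (hU.mem_nhds hz)).hasDerivAt
  have hgc := hg.continuousOn
  have hgc' := (hg.deriv hU).continuousOn
  -- The radial integral. Its `z`-derivative has integrand `d/ds (s * g (c + s (z - c)))`, whose
  -- integral over `[0, 1]` is `g z`.
  refine ⟨fun z => ∫ s in Icc (0 : ℝ) 1, g (c + s * (z - c)) * (z - c), fun z hz => ?_⟩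
  have hint : ∀ z ∈ U, ∫ s in Icc (0 : ℝ) 1,
      (deriv g (c + s * (z - c)) * s * (z - c) + g (c + s * (z - c))) = g z := fun z hz => by
    have hline : ∀ s : ℝ, HasDerivAt (fun s : ℝ => c + s * (z - c)) (z - c) s := fun s => by
      simpa using ((Complex.ofRealCLM.hasDerivAt (x := s)).mul_const (z - c)).const_add c
    have hcont : ContinuousOn (fun s : ℝ => g (c + s * (z - c))) (Icc 0 1) :=
      hgc.comp (f := fun s : ℝ => c + s * (z - c)) (by fun_prop) (hm z hz)
    have hcont' : ContinuousOn (fun s : ℝ => deriv g (c + s * (z - c))) (Icc 0 1) :=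
      hgc'.comp (f := fun s : ℝ => c + s * (z - c)) (by fun_prop) (hm z hz)
    have := intervalIntegral.integral_eq_sub_of_hasDerivAt_of_le (zero_le_one' ℝ)
      (f := fun s : ℝ => (s : ℂ) * g (c + s * (z - c)))
      (f' := fun s : ℝ => deriv g (c + s * (z - c)) * s * (z - c) + g (c + s * (z - c)))
      (ContinuousOn.mul (by fun_prop) hcont) ?_ ?_
    · rw [integral_Icc_eq_integral_Ioc, ← intervalIntegral.integral_of_le zero_le_one, this]
      simp
    · intro s hs
      have h1 := HasDerivAt.scomp (𝕜' := ℂ) s (hd _ (hm z hz s (Ioo_subset_Icc_self hs))) (hline s)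
      have h2 := (Complex.ofRealCLM.hasDerivAt (x := s)).mul h1
      convert! h2 using 1
      simp
      ring
    · refine ContinuousOn.intervalIntegrable ?_
      rw [uIcc_of_le zero_le_one]
      exact ((hcont'.mul (by fun_prop)).mul (by fun_prop)).add hcont
  have := hasDerivAt_integral_of_continuousOn_compact (μ := volume.restrict (Icc (0 : ℝ) 1))
    (K := Icc (0 : ℝ) 1) isCompact_Icc measurableSet_Icc (ae_restrict_mem measurableSet_Icc) hU
    (f := fun (s : ℝ) z => g (c + s * (z - c)) * (z - c))
    (f' := fun (s : ℝ) z => deriv g (c + s * (z - c)) * s * (z - c) + g (c + s * (z - c)))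
    ?_ ?_ ?_ hz
  · rwa [hint z hz] at this
  · intro z hz
    exact (hgc.comp (f := fun s : ℝ => c + s * (z - c)) (by fun_prop) (hm z hz)).mul (by fun_prop)
  · have hcp : ContinuousOn (fun p : ℝ × ℂ => c + p.1 * (p.2 - c)) (Icc (0 : ℝ) 1 ×ˢ U) := by
      fun_prop
    exact (((hgc'.comp hcp fun p hp => hm _ hp.2 _ hp.1).mul (by fun_prop)).mul (by fun_prop)).add
      (hgc.comp hcp fun p hp => hm _ hp.2 _ hp.1)
  · intro s hs z hz
    have hline : HasDerivAt (fun z : ℂ => c + s * (z - c)) s z := by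
      simpa using (((hasDerivAt_id z).sub_const c).const_mul (s : ℂ)).const_add c
    have := ((hd _ (hm z hz s hs)).comp z hline).mul ((hasDerivAt_id z).sub_const c)
    convert! this using 1
    simp

theorem exists_primitive_zero_of_ball {r : ℝ} {g : ℂ → ℂ}
    (hg : DifferentiableOn ℂ g (Metric.ball 0 r)) :
    ∃ G : ℂ → ℂ, G 0 = 0 ∧ ∀ z ∈ Metric.ball (0 : ℂ) r, HasDerivAt G (g z) z :=
  hg.isExactOn_ball.with_val_at 0 0

end Primitives

/-! ### The logarithmic singularity of q at the origin. -/

section LogSingularity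

variable {ν : ℝ}

theorem ball_subset_compl_cutRay : Metric.ball (0 : ℂ) 1 ⊆ cutRayᶜ := by
  rintro z hz ⟨r, hr, rfl⟩
  rw [mem_ball_zero_iff, Complex.norm_real, Real.norm_eq_abs] at hz
  linarith [le_abs_self r]

/-- The disk of radius `r` around the origin, slit along the negative real axis. -/
def slitBall (r : ℝ) : Set ℂ := Metric.ball 0 r ∩ Complex.slitPlane

theorem isOpen_slitBall (r : ℝ) : IsOpen (slitBall r) :=
  Metric.isOpen_ball.inter Complex.isOpen_slitPlane

theorem isPreconnected_slitBall {r : ℝ} (hr : 0 < r) : IsPreconnected (slitBall r) := by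
  have hm : ((r / 2 : ℝ) : ℂ) ∈ Metric.ball (0 : ℂ) r := by
    rw [mem_ball_zero_iff, Complex.norm_real, Real.norm_eq_abs, abs_of_pos (by linarith)]
    linarith
  have hs : StarConvex ℝ ((r / 2 : ℝ) : ℂ) (slitBall r) :=
    ((convex_ball (0 : ℂ) r).starConvex hm).inter
      (Complex.starConvex_ofReal_slitPlane (by linarith))
  exact (hs.isPathConnected
    ⟨hm, Complex.ofReal_mem_slitPlane.2 (by linarith)⟩).isConnected.isPreconnected

theorem slitBall_subset_doubleSlit {r : ℝ} (hr : r ≤ 1) : slitBall r ⊆ doubleSlit := fun _ hz =>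
  mem_doubleSlit_of_mem_slitPlane hz.2 ((mem_ball_zero_iff.1 hz.1).trans_le hr)

theorem ofReal_mem_slitBall {r s : ℝ} (h : s ∈ Ioo 0 r) : (s : ℂ) ∈ slitBall r := by
  refine ⟨?_, Complex.ofReal_mem_slitPlane.2 h.1⟩
  rw [mem_ball_zero_iff, Complex.norm_real, Real.norm_eq_abs, abs_of_pos h.1]
  exact h.2

/-- The logarithmic singularity of `P_ν(2 t - 1)` at the origin. -/
theorem exists_mirror_eq_log (h1 : -1 < ν) (h2 : ν < 0) :
    ∃ (c : ℂ) (F : ℂ → ℂ), DifferentiableOn ℂ F (Metric.ball 0 1) ∧ ∀ t ∈ slitBall 1,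
      legendreF ν (1 - t) = legendreF ν t * (c * Complex.log t + F t) := by
  set c : ℂ := -((beta (ν + 1) (-ν) : ℝ) : ℂ)⁻¹ with hc
  have hp := (differentiableOn_legendreF h1 h2).mono ball_subset_compl_cutRay
  have hpne : ∀ t ∈ Metric.ball (0 : ℂ) 1, legendreF ν t ≠ 0 := fun t ht =>
    legendreF_ne_zero h1 h2 (ball_subset_compl_cutRay ht)
  have hone : ∀ t ∈ Metric.ball (0 : ℂ) 1, 1 - t ≠ 0 := fun t ht =>
    one_sub_ne_zero_of_notMem_cutRay (ball_subset_compl_cutRay ht)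
  -- By the Wronskian identity `(q / p)' = c f / t`. Since `f 0 = 1`, this is `c (1 / t + dslope f 0
  -- t)`, a logarithm plus a holomorphic part.
  set f : ℂ → ℂ := fun t => ((1 - t) * legendreF ν t ^ 2)⁻¹ with hf
  have hfd : DifferentiableOn ℂ f (Metric.ball 0 1) :=
    ((by fun_prop : DifferentiableOn ℂ (fun t : ℂ => 1 - t) _).mul (hp.pow 2)).inv
      fun t ht => mul_ne_zero (hone t ht) (pow_ne_zero 2 (hpne t ht))
  have hf0 : f 0 = 1 := by simp [hf, legendreF_zero h1 h2]
  have hdf := (Complex.differentiableOn_dslope (Metric.ball_mem_nhds (0 : ℂ) one_pos)).2 hfd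
  obtain ⟨F₁, -, hF₁⟩ := exists_primitive_zero_of_ball hdf
  have hds : ∀ t, t * dslope f 0 t = f t - 1 := fun t => by
    have := sub_smul_dslope f 0 t
    rwa [sub_zero, smul_eq_mul, hf0] at this
  have hsub := slitBall_subset_doubleSlit le_rfl
  have hderiv : ∀ t ∈ slitBall 1, HasDerivAt (fun t => legendreF ν (1 - t) / legendreF ν t
      - c * (Complex.log t + F₁ t)) 0 t := fun t ht => by
    have hD := hsub ht
    have dq := ((differentiableOn_mirror h1 h2).differentiableAt
      (isOpen_doubleSlit.mem_nhds hD)).hasDerivAt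
    have dp := ((differentiableOn_legendreF_doubleSlit h1 h2).differentiableAt
      (isOpen_doubleSlit.mem_nhds hD)).hasDerivAt
    have hp0 := hpne t ht.1
    have ht0 := ne_zero_of_mem_doubleSlit hD
    have ht1 := hone t ht.1
    have := (dq.div dp hp0).sub (((Complex.hasDerivAt_log ht.2).add (hF₁ t ht.1)).const_mul c)
    convert! this using 1
    have hw := legendreWronskian_mirror h1 h2 hD
    rw [← hc, legendreWronskian] at hw
    have hds' : dslope f 0 t = (f t - 1) / t := by rw [← hds t, mul_div_cancel_left₀ _ ht0]
    rw [hds', ← hw]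
    simp only [hf]
    field_simp
    ring
  obtain ⟨a, ha⟩ := (isOpen_slitBall 1).exists_is_const_of_deriv_eq_zero
    (isPreconnected_slitBall one_pos)
    (fun t ht => (hderiv t ht).differentiableAt.differentiableWithinAt)
    (fun t ht => (hderiv t ht).deriv)
  refine ⟨c, fun t => c * F₁ t + a, ?_, fun t ht => ?_⟩
  · exact fun t ht =>
      (((hF₁ t ht).differentiableAt.const_mul c).add_const a).differentiableWithinAt
  · have hp0 := hpne t ht.1
    rw [← ha t ht]
    field_simp
    ring

theorem norm_log_le_abs_log_norm_add_pi (t : ℂ) : ‖Complex.log t‖ ≤ |Real.log ‖t‖| + π := by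
  refine (Complex.norm_le_abs_re_add_abs_im _).trans ?_
  rw [Complex.log_re, Complex.log_im]
  linarith [Complex.abs_arg_le_pi t]

theorem tendsto_mul_log_zero : Tendsto (fun t : ℂ => t * Complex.log t) (𝓝 0) (𝓝 0) := by
  have h : Tendsto (fun t : ℂ => |‖t‖ * Real.log ‖t‖| + ‖t‖ * π) (𝓝 0) (𝓝 0) := by
    have hc : Continuous fun t : ℂ => |‖t‖ * Real.log ‖t‖| + ‖t‖ * π :=
      ((Real.continuous_mul_log.comp continuous_norm).abs).add (by fun_prop)
    simpa using hc.tendsto 0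
  refine squeeze_zero_norm (fun t => ?_) h
  rw [norm_mul, abs_mul, abs_norm, ← mul_add]
  exact mul_le_mul_of_nonneg_left (norm_log_le_abs_log_norm_add_pi t) (norm_nonneg t)

theorem exists_bound_mirror (h1 : -1 < ν) (h2 : ν < 0) :
    ∃ C : ℝ, 0 ≤ C ∧ ∀ t ∈ slitBall (1 / 2),
      ‖legendreF ν (1 - t)‖ ≤ C * (1 + |Real.log ‖t‖|) := by
  obtain ⟨c, F, hF, he⟩ := exists_mirror_eq_log h1 h2
  have hsub : Metric.closedBall (0 : ℂ) (1 / 2) ⊆ Metric.ball 0 1 :=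
    Metric.closedBall_subset_ball (by norm_num)
  obtain ⟨A, hA⟩ := (isCompact_closedBall (0 : ℂ) (1 / 2)).exists_bound_of_continuousOn
    (hF.continuousOn.mono hsub)
  obtain ⟨B, hB⟩ := (isCompact_closedBall (0 : ℂ) (1 / 2)).exists_bound_of_continuousOn
    ((differentiableOn_legendreF h1 h2).continuousOn.mono (hsub.trans ball_subset_compl_cutRay))
  have hA0 : 0 ≤ A := (norm_nonneg _).trans (hA 0 (by simp))
  have hB0 : 0 ≤ B := (norm_nonneg _).trans (hB 0 (by simp))
  have hpi := Real.pi_pos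
  refine ⟨B * (‖c‖ * (1 + π) + A), by positivity, fun t ht => ?_⟩
  have hc := Metric.ball_subset_closedBall ht.1
  rw [he t ⟨hsub hc, ht.2⟩, norm_mul, mul_assoc]
  refine mul_le_mul (hB t hc) ?_ (norm_nonneg _) hB0
  refine (norm_add_le _ _).trans ?_
  rw [norm_mul]
  have hl := norm_log_le_abs_log_norm_add_pi t
  have ha := hA t hc
  have hL : 0 ≤ |Real.log ‖t‖| := abs_nonneg _
  have : ‖c‖ * ‖Complex.log t‖ ≤ ‖c‖ * ((1 + π) * (1 + |Real.log ‖t‖|)) :=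
    mul_le_mul_of_nonneg_left (by nlinarith) (norm_nonneg c)
  nlinarith

/-- A primitive, vanishing at the origin, of a holomorphic multiple of
`P_ν(1 - 2 t) P_ν(2 t - 1)`. -/
theorem exists_local_primitive (h1 : -1 < ν) (h2 : ν < 0) {r : ℝ} (hr : 0 < r) (hr1 : r ≤ 1)
    {φ : ℂ → ℂ} (hφ : DifferentiableOn ℂ φ (Metric.ball 0 r)) :
    ∃ Q : ℂ → ℂ, (∀ t ∈ slitBall r,
        HasDerivAt Q (φ t * (legendreF ν t * legendreF ν (1 - t))) t) ∧
      Tendsto Q (𝓝 0) (𝓝 0) := by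
  obtain ⟨c, F, hF, he⟩ := exists_mirror_eq_log h1 h2
  have hsub : Metric.ball (0 : ℂ) r ⊆ Metric.ball 0 1 := Metric.ball_subset_ball hr1
  have hp := (differentiableOn_legendreF h1 h2).mono (hsub.trans ball_subset_compl_cutRay)
  have h0 : Metric.ball (0 : ℂ) r ∈ 𝓝 0 := Metric.ball_mem_nhds 0 hr
  obtain ⟨R, hR0, hR⟩ := exists_primitive_zero_of_ball ((hφ.mul (hp.pow 2)).const_mul c)
  have hRd : DifferentiableOn ℂ R (Metric.ball 0 r) := fun t ht =>
    (hR t ht).differentiableAt.differentiableWithinAt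
  have hds := (Complex.differentiableOn_dslope h0).2 hRd
  obtain ⟨S, hS0, hS⟩ := exists_primitive_zero_of_ball hds
  obtain ⟨T, hT0, hT⟩ := exists_primitive_zero_of_ball ((hφ.mul (hp.pow 2)).mul (hF.mono hsub))
  have hdt : ∀ t, t * dslope R 0 t = R t := fun t => by
    have := sub_smul_dslope R 0 t
    rwa [sub_zero, smul_eq_mul, hR0, sub_zero] at this
  -- Integration by parts for `φ p² (c log t + F)`: `R` is a primitive of `c φ p²`, `S` of `R / t`,
  -- and `T` of `φ p² F`. Because `R 0 = 0`, the product `R log t` tends to 0.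
  refine ⟨fun t => R t * Complex.log t - S t + T t, fun t ht => ?_, ?_⟩
  · have ht0 : t ≠ 0 := Complex.slitPlane_ne_zero ht.2
    have := (((hR t ht.1).mul (Complex.hasDerivAt_log ht.2)).sub (hS t ht.1)).add (hT t ht.1)
    convert! this using 1
    rw [he t ⟨hsub ht.1, ht.2⟩, ← hdt t]
    simp only [Pi.mul_apply, Pi.pow_apply]
    field_simp
    ring
  · have hm := Metric.mem_ball_self (x := (0 : ℂ)) hr
    have l1 : Tendsto (fun t => dslope R 0 t * (t * Complex.log t)) (𝓝 0)
        (𝓝 (dslope R 0 0 * 0)) :=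
      ((hds.differentiableAt h0).continuousAt.tendsto).mul tendsto_mul_log_zero
    have l2 := (hS 0 hm).continuousAt.tendsto
    have l3 := (hT 0 hm).continuousAt.tendsto
    rw [hS0] at l2
    rw [hT0] at l3
    have := (l1.sub l2).add l3
    simp only [mul_zero, sub_zero, add_zero] at this
    refine this.congr fun t => ?_
    rw [← hdt t]
    ring

end LogSingularity

/-! ### Piecewise C¹ paths and their logarithmic integrals. -/

section Paths

variable {γ : ℝ → ℂ} {a b : ℂ}

/-- The last clause says that the first `m` pieces cover `[0, s m]`; it allows a point of `[0, 1]`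
to be located in a piece. -/
theorem IsPiecewiseC1Path.exists_partition (h : IsPiecewiseC1Path γ a b) :
    ∃ (n : ℕ) (s : ℕ → ℝ), 0 < n ∧ s 0 = 0 ∧ s n = 1 ∧ (∀ i < n, s i < s (i + 1)) ∧
      (∀ i < n, ContDiffOn ℝ 1 γ (Icc (s i) (s (i + 1)))) ∧
      ∀ m ≤ n, ∀ x ∈ Icc 0 (s m), m = 0 ∨ ∃ i < m, x ∈ Icc (s i) (s (i + 1)) := by
  obtain ⟨-, -, n, s, h0, hn, hs⟩ := h
  refine ⟨n, s, ?_, h0, hn, fun i hi => (hs i hi).1, fun i hi => (hs i hi).2, ?_⟩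
  · rcases Nat.eq_zero_or_pos n with rfl | h
    · rw [h0] at hn; norm_num at hn
    · exact h
  · intro m
    induction m with
    | zero => exact fun _ _ _ => Or.inl rfl
    | succ m ih =>
      intro hm x hx
      right
      rcases le_total x (s m) with h | h
      · rcases ih (by omega) x ⟨hx.1, h⟩ with h' | ⟨i, hi, hxi⟩
        · subst h'
          rw [h0] at h
          exact ⟨0, by omega, by rw [h0]; exact hx.1, hx.2⟩
        · exact ⟨i, by omega, hxi⟩
      · exact ⟨m, by omega, h, hx.2⟩

theorem IsPiecewiseC1Path.continuousOn (h : IsPiecewiseC1Path γ a b) :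
    ContinuousOn γ (Icc 0 1) := by
  obtain ⟨n, s, hn0, h0, hn, hlt, hc, -⟩ := h.exists_partition
  have key : ∀ m ≤ n, 0 ≤ s m ∧ ContinuousOn γ (Icc 0 (s m)) := by
    intro m
    induction m with
    | zero => intro _; rw [h0]; simp
    | succ m ih =>
      intro hm
      obtain ⟨ih0, ih1⟩ := ih (by omega)
      have hl := hlt m (by omega)
      refine ⟨ih0.trans hl.le, ?_⟩
      rw [← Icc_union_Icc_eq_Icc ih0 hl.le]
      exact ih1.union_of_isClosed (hc m (by omega)).continuousOn isClosed_Icc isClosed_Icc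
  have := (key n le_rfl).2
  rwa [hn] at this

theorem IsPiecewiseC1Path.exists_regular (h : IsPiecewiseC1Path γ a b) :
    ∃ (S : Set ℝ) (M : ℝ), S.Finite ∧ ∀ s ∈ Ioo (0 : ℝ) 1 \ S,
      HasDerivAt γ (deriv γ s) s ∧ ContinuousAt (deriv γ) s ∧ ‖deriv γ s‖ ≤ M := by
  obtain ⟨n, s, hn0, h0, hn, hlt, hc, hcov⟩ := h.exists_partition
  have hb : ∀ i, ∃ M, i < n → ∀ x ∈ Icc (s i) (s (i + 1)),
      ‖derivWithin γ (Icc (s i) (s (i + 1))) x‖ ≤ M := fun i => by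
    by_cases hi : i < n
    · obtain ⟨M, hM⟩ := isCompact_Icc.exists_bound_of_continuousOn
        ((hc i hi).continuousOn_derivWithin (uniqueDiffOn_Icc (hlt i hi)) le_rfl)
      exact ⟨M, fun _ => hM⟩
    · exact ⟨0, fun h => absurd h hi⟩
  choose M hM using hb
  refine ⟨s '' Iic n, ∑ i ∈ Finset.range n, |M i|, (finite_Iic n).image s, fun x hx => ?_⟩
  rcases hcov n le_rfl x (by rw [hn]; exact Ioo_subset_Icc_self hx.1) with h | ⟨i, hi, hxi⟩
  · omega
  have hne1 : x ≠ s i := fun h => hx.2 ⟨i, hi.le, h.symm⟩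
  have hne2 : x ≠ s (i + 1) := fun h => hx.2 ⟨i + 1, hi, h.symm⟩
  have hxo : x ∈ Ioo (s i) (s (i + 1)) :=
    ⟨lt_of_le_of_ne hxi.1 hne1.symm, lt_of_le_of_ne hxi.2 hne2⟩
  have hnh : Icc (s i) (s (i + 1)) ∈ 𝓝 x := Icc_mem_nhds hxo.1 hxo.2
  have hcd : ContDiffAt ℝ 1 γ x := (hc i hi).contDiffAt hnh
  refine ⟨(hcd.differentiableAt one_ne_zero).hasDerivAt, ?_, ?_⟩
  · have : ContDiffOn ℝ 1 γ (Ioo (s i) (s (i + 1))) := (hc i hi).mono Ioo_subset_Icc_self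
    exact (this.continuousOn_deriv_of_isOpen isOpen_Ioo le_rfl).continuousAt
      (isOpen_Ioo.mem_nhds hxo)
  · rw [← derivWithin_of_mem_nhds hnh]
    exact (hM i hi x hxi).trans ((le_abs_self _).trans
      (Finset.single_le_sum (f := fun i => |M i|) (fun _ _ => abs_nonneg _)
        (Finset.mem_range.2 hi)))

theorem IsPiecewiseC1Path.hasDerivWithinAt_zero (h : IsPiecewiseC1Path γ a b) :
    HasDerivWithinAt γ (derivWithin γ (Ici 0) 0) (Ici 0) 0 := by
  obtain ⟨n, s, hn0, h0, hn, hlt, hc, -⟩ := h.exists_partition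
  have h1 := hlt 0 hn0
  have hd := (hc 0 hn0).differentiableOn one_ne_zero 0 (by rw [h0] at h1 ⊢; exact ⟨le_rfl, h1.le⟩)
  rw [h0] at h1 hd
  exact (hd.mono_of_mem_nhdsWithin (Icc_mem_nhdsGE h1)).hasDerivWithinAt

theorem IsPiecewiseC1Path.intervalIntegrable_pullback (h : IsPiecewiseC1Path γ a b)
    {f : ℂ → ℂ} (hf : IntegrableOn (fun s => f (γ s)) (Ioc 0 1)) :
    IntervalIntegrable (pullback f γ) volume 0 1 := by
  obtain ⟨S, M, hS, hreg⟩ := h.exists_regular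
  rw [intervalIntegrable_iff_integrableOn_Ioc_of_le zero_le_one]
  refine Integrable.mul_bdd (c := M) hf (measurable_deriv γ).aestronglyMeasurable ?_
  have h1 : ∀ᵐ s : ℝ, s ∉ S ∪ {1} :=
    measure_eq_zero_iff_ae_notMem.1 ((hS.union (finite_singleton 1)).measure_zero _)
  refine (ae_restrict_iff' measurableSet_Ioc).2 (h1.mono fun s hs hs' => ?_)
  rw [mem_union, not_or] at hs
  exact (hreg s ⟨⟨hs'.1, lt_of_le_of_ne hs'.2 hs.2⟩, hs.1⟩).2.2

theorem IsPiecewiseC1Path.intervalIntegrable_of_continuousOn (h : IsPiecewiseC1Path γ a b)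
    {f : ℂ → ℂ} {Ω : Set ℂ} (hf : ContinuousOn f Ω) (hΩ : ∀ s ∈ Icc (0 : ℝ) 1, γ s ∈ Ω) :
    IntervalIntegrable (pullback f γ) volume 0 1 :=
  h.intervalIntegrable_pullback
    ((hf.comp h.continuousOn hΩ).integrableOn_Icc.mono_set Ioc_subset_Icc_self)

/-- Path integrals of logarithmic derivatives. -/
theorem IsPiecewiseC1Path.exp_pathIntegral (h : IsPiecewiseC1Path γ a b) {f X : ℂ → ℂ}
    {Ω : Set ℂ} {r C : ℂ} (hX : ∀ t ∈ Ω, HasDerivAt X (X t * f t / r) t)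
    (hf : ∀ t ∈ Ω, ContinuousAt f t) (hΩ : ∀ s ∈ Ioc (0 : ℝ) 1, γ s ∈ Ω)
    (hint : IntervalIntegrable (pullback f γ) volume 0 1)
    (hlim : Tendsto (fun s => X (γ s)) (𝓝[>] 0) (𝓝 C)) :
    X b = C * Complex.exp (pathIntegral f γ / r) := by
  obtain ⟨S, M, hS, hreg⟩ := h.exists_regular
  set I : ℝ → ℂ := fun s => ∫ x in (0 : ℝ)..s, pullback f γ x with hI
  -- `W` has zero derivative off the break points and is continuous on `(0, 1]`, hence constant. Its
  -- value is read off from the limit at `0`, where `X` need not be differentiable.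
  set W : ℝ → ℂ := fun s => Complex.exp (-(I s / r)) * X (γ s) with hW
  have hIc : ContinuousOn I (Icc 0 1) := by
    have := intervalIntegral.continuousOn_primitive_interval (μ := volume) (f := pullback f γ)
      (a := 0) (b := 1) (by
        rw [uIcc_of_le zero_le_one, integrableOn_Icc_iff_integrableOn_Ioc]
        exact (intervalIntegrable_iff_integrableOn_Ioc_of_le zero_le_one).1 hint)
    rwa [uIcc_of_le zero_le_one] at this
  have hopen : IsOpen (Ioo (0 : ℝ) 1 \ S) := isOpen_Ioo.sdiff hS.isClosed
  have hpc : ∀ s ∈ Ioo (0 : ℝ) 1 \ S, ContinuousAt (pullback f γ) s := fun s hs =>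
    ((hf _ (hΩ s (Ioo_subset_Ioc_self hs.1))).comp (hreg s hs).1.continuousAt).mul (hreg s hs).2.1
  have hdI : ∀ s ∈ Ioo (0 : ℝ) 1 \ S, HasDerivAt I (pullback f γ s) s := fun s hs =>
    intervalIntegral.integral_hasDerivAt_right
      (hint.mono_set (by
        rw [uIcc_of_le hs.1.1.le, uIcc_of_le zero_le_one]
        exact Icc_subset_Icc_right hs.1.2.le))
      (ContinuousAt.stronglyMeasurableAtFilter hopen hpc s hs) (hpc s hs)
  have hWc : ContinuousOn W (Ioc 0 1) := by
    refine ContinuousOn.mul ?_ fun s hs => ?_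
    · exact ((hIc.mono Ioc_subset_Icc_self).div_const r).neg.cexp
    · exact (hX _ (hΩ s hs)).continuousAt.comp_continuousWithinAt
        ((h.continuousOn s (Ioc_subset_Icc_self hs)).mono Ioc_subset_Icc_self)
  have hWd : ∀ s ∈ Ioo (0 : ℝ) 1 \ S, HasDerivAt W 0 s := fun s hs => by
    have d1 := (((hdI s hs).div_const r).neg).cexp
    have d2 := HasDerivAt.scomp (𝕜' := ℂ) s (hX _ (hΩ s (Ioo_subset_Ioc_self hs.1)))
      (hreg s hs).1
    convert! d1.mul d2 using 1
    simp only [smul_eq_mul, pullback, Function.comp_apply]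
    ring
  have hconst : ∀ s ∈ Ioo (0 : ℝ) 1, W s = W 1 := fun s hs => by
    have := integral_eq_of_hasDerivAt_off_countable_of_le W (fun _ => 0) hs.2.le hS.countable
      (hWc.mono fun x hx => ⟨hs.1.trans_le hx.1, hx.2⟩)
      (fun x hx => hWd x ⟨⟨hs.1.trans hx.1.1, hx.1.2⟩, hx.2⟩) (by simp)
    rw [intervalIntegral.integral_zero] at this
    exact (sub_eq_zero.1 this.symm).symm
  have hI0 : Tendsto I (𝓝[>] 0) (𝓝 0) := by
    have h0 := hIc 0 ⟨le_rfl, zero_le_one⟩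
    have e : I 0 = 0 := by simp [hI]
    rw [ContinuousWithinAt, e] at h0
    refine h0.mono_left ?_
    rw [← nhdsWithin_Ioc_eq_nhdsGT (zero_lt_one' ℝ)]
    exact nhdsWithin_mono _ Ioc_subset_Icc_self
  have lim : Tendsto W (𝓝[>] 0) (𝓝 (Complex.exp (-(0 / r)) * C)) :=
    ((hI0.div_const r).neg.cexp).mul hlim
  have lim' : Tendsto W (𝓝[>] 0) (𝓝 (W 1)) := by
    refine tendsto_const_nhds.congr' ?_
    filter_upwards [Ioo_mem_nhdsGT (zero_lt_one' ℝ)] with s hs using (hconst s hs).symm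
  have e := tendsto_nhds_unique lim' lim
  simp only [hW, h.2.1, zero_div, neg_zero, Complex.exp_zero, one_mul] at e
  rw [← e, mul_right_comm, show pathIntegral f γ = I 1 from rfl, ← Complex.exp_add]
  simp

end Paths

/-! ### Logarithmic kernels over a cycle and their differential equation. -/

section LogKernel

variable {ν r : ℝ} {ω w : ℝ → ℂ}

theorem mul_notMem_cutRay_of_mem_ball (hw : ∀ u ∈ Icc (0 : ℝ) 1, ‖w u‖ * r ≤ 1) {x : ℂ}
    (hx : x ∈ Metric.ball (0 : ℂ) r) {u : ℝ} (hu : u ∈ Icc (0 : ℝ) 1) : x * w u ∉ cutRay := by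
  refine ball_subset_compl_cutRay ?_
  rw [mem_ball_zero_iff] at hx ⊢
  rw [norm_mul]
  rcases eq_or_ne (w u) 0 with h | h
  · simp [h]
  · calc ‖x‖ * ‖w u‖ < r * ‖w u‖ := mul_lt_mul_of_pos_right hx (norm_pos_iff.2 h)
      _ ≤ 1 := by rw [mul_comm]; exact hw u hu

/-- The `n`-th logarithmic kernel `∫ ω w ^ n / (1 - x w) ^ n`. -/
noncomputable def poleKernel (ν : ℝ) (ω w : ℝ → ℂ) (n : ℕ) (x : ℂ) : ℂ :=
  ∫ u, ω u * (w u / (1 - x * w u)) ^ n ∂betaMeasure (ν + 1) (-ν)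

/-- The kernel `∫ ω log (1 - x w)`. -/
noncomputable def logKernel (ν : ℝ) (ω w : ℝ → ℂ) (x : ℂ) : ℂ :=
  ∫ u, ω u * Complex.log (1 - x * w u) ∂betaMeasure (ν + 1) (-ν)

theorem continuousOn_pole (hwc : ContinuousOn w (Icc 0 1))
    (hw : ∀ u ∈ Icc (0 : ℝ) 1, ‖w u‖ * r ≤ 1) :
    ContinuousOn (fun p : ℝ × ℂ => w p.1 / (1 - p.2 * w p.1))
      (Icc (0 : ℝ) 1 ×ˢ Metric.ball 0 r) := by
  have h : ContinuousOn (fun p : ℝ × ℂ => w p.1) (Icc (0 : ℝ) 1 ×ˢ Metric.ball 0 r) :=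
    hwc.comp continuousOn_fst fun p hp => hp.1
  exact h.div (continuousOn_const.sub (continuousOn_snd.mul h)) fun p hp =>
    one_sub_ne_zero_of_notMem_cutRay (mul_notMem_cutRay_of_mem_ball hw hp.2 hp.1)

theorem continuousOn_log_kernel (hwc : ContinuousOn w (Icc 0 1))
    (hw : ∀ u ∈ Icc (0 : ℝ) 1, ‖w u‖ * r ≤ 1) :
    ContinuousOn (fun p : ℝ × ℂ => Complex.log (1 - p.2 * w p.1))
      (Icc (0 : ℝ) 1 ×ˢ Metric.ball 0 r) := by
  have h : ContinuousOn (fun p : ℝ × ℂ => w p.1) (Icc (0 : ℝ) 1 ×ˢ Metric.ball 0 r) :=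
    hwc.comp continuousOn_fst fun p hp => hp.1
  exact (continuousOn_const.sub (continuousOn_snd.mul h)).clog fun p hp =>
    one_sub_mem_slitPlane (mul_notMem_cutRay_of_mem_ball hw hp.2 hp.1)

theorem continuousOn_slice {X Y : Type*} [TopologicalSpace X] [TopologicalSpace Y] {g : X × Y → ℂ}
    {A : Set X} {B : Set Y} (hg : ContinuousOn g (A ×ˢ B)) {y : Y} (hy : y ∈ B) :
    ContinuousOn (fun x => g (x, y)) A :=
  hg.comp (f := fun x => (x, y)) (by fun_prop) fun _ hx => ⟨hx, hy⟩

theorem hasDerivAt_poleKernel (h1 : -1 < ν) (h2 : ν < 0) (hω : ContinuousOn ω (Icc 0 1))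
    (hwc : ContinuousOn w (Icc 0 1)) (hw : ∀ u ∈ Icc (0 : ℝ) 1, ‖w u‖ * r ≤ 1) (n : ℕ) {x : ℂ}
    (hx : x ∈ Metric.ball (0 : ℂ) r) :
    HasDerivAt (poleKernel ν ω w n) (n * poleKernel ν ω w (n + 1) x) x := by
  have := isProbabilityMeasure_betaMeasure (a := ν + 1) (b := -ν) (by linarith) (by linarith)
  have hω' : ContinuousOn (fun p : ℝ × ℂ => ω p.1) (Icc (0 : ℝ) 1 ×ˢ Metric.ball 0 r) :=
    hω.comp continuousOn_fst fun p hp => hp.1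
  rw [poleKernel, ← integral_const_mul]
  refine hasDerivAt_integral_of_continuousOn_compact (K := Icc (0 : ℝ) 1) isCompact_Icc
    measurableSet_Icc ae_betaMeasure_mem_Icc (Metric.isOpen_ball (x := (0 : ℂ)) (ε := r))
    (f := fun u x => ω u * (w u / (1 - x * w u)) ^ n)
    (f' := fun u x => n * (ω u * (w u / (1 - x * w u)) ^ (n + 1))) ?_ ?_ ?_ hx
  · intro z hz
    exact hω.mul ((continuousOn_slice (continuousOn_pole hwc hw) hz).pow n)
  · exact continuousOn_const.mul (hω'.mul ((continuousOn_pole hwc hw).pow (n + 1)))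
  · intro u hu z hz
    have hne := one_sub_ne_zero_of_notMem_cutRay (mul_notMem_cutRay_of_mem_ball hw hz hu)
    have d := ((hasDerivAt_const z (w u)).div
      (((hasDerivAt_id z).mul_const (w u)).const_sub 1) hne).pow n
    convert! d.const_mul (ω u) using 1
    simp only [id, Pi.div_apply]
    rcases n with _ | n
    · simp
    · simp only [Nat.add_sub_cancel]
      generalize 1 - z * w u = q at hne ⊢
      ring

theorem hasDerivAt_logKernel (h1 : -1 < ν) (h2 : ν < 0) (hω : ContinuousOn ω (Icc 0 1))
    (hwc : ContinuousOn w (Icc 0 1)) (hw : ∀ u ∈ Icc (0 : ℝ) 1, ‖w u‖ * r ≤ 1) {x : ℂ}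
    (hx : x ∈ Metric.ball (0 : ℂ) r) :
    HasDerivAt (logKernel ν ω w) (-poleKernel ν ω w 1 x) x := by
  have := isProbabilityMeasure_betaMeasure (a := ν + 1) (b := -ν) (by linarith) (by linarith)
  have hω' : ContinuousOn (fun p : ℝ × ℂ => ω p.1) (Icc (0 : ℝ) 1 ×ˢ Metric.ball 0 r) :=
    hω.comp continuousOn_fst fun p hp => hp.1
  rw [poleKernel, ← integral_neg]
  refine hasDerivAt_integral_of_continuousOn_compact (K := Icc (0 : ℝ) 1) isCompact_Icc
    measurableSet_Icc ae_betaMeasure_mem_Icc (Metric.isOpen_ball (x := (0 : ℂ)) (ε := r))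
    (f := fun u x => ω u * Complex.log (1 - x * w u))
    (f' := fun u x => -(ω u * (w u / (1 - x * w u)) ^ 1)) ?_ ?_ ?_ hx
  · intro z hz
    exact hω.mul (continuousOn_slice (continuousOn_log_kernel hwc hw) hz)
  · exact (hω'.mul ((continuousOn_pole hwc hw).pow 1)).neg
  · intro u hu z hz
    have d := (((hasDerivAt_id z).mul_const (w u)).const_sub 1).clog
      (one_sub_mem_slitPlane (mul_notMem_cutRay_of_mem_ball hw hz hu))
    convert! d.const_mul (ω u) using 1
    simp only [id]
    ring

/-- The differential equation satisfied by a logarithmic kernel over a cycle of the elliptic-type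
differential `w ^ ν (1 - w) ^ (-ν - 1) (1 - α w) ^ ν dw`. -/
theorem cycle_equation (h1 : -1 < ν) (h2 : ν < 0) (hω : ContinuousOn ω (Icc 0 1))
    (hwc : ContinuousOn w (Icc 0 1)) (hw : ∀ u ∈ Icc (0 : ℝ) 1, ‖w u‖ * r ≤ 1) {x α : ℂ}
    (hx : x ∈ Metric.ball (0 : ℂ) r)
    (hS : ∫ u, ω u * ((ν + 1 - w u) * (1 - α * w u) / (1 - x * w u)
        - α * (ν + 1) * w u * (1 - w u) / (1 - x * w u)
        + w u * (1 - w u) * (1 - α * w u) * x / (1 - x * w u) ^ 2)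
      ∂betaMeasure (ν + 1) (-ν) = 0) :
    x * (x - α) * ((1 - x) * -poleKernel ν ω w 2 x - (ν + 1) * -poleKernel ν ω w 1 x)
      + (x - α * (ν + 1)) * (1 - x) * -poleKernel ν ω w 1 x
      = (ν + 1) * (α * ∫ u, ω u * w u ∂betaMeasure (ν + 1) (-ν)
        - x * ∫ u, ω u ∂betaMeasure (ν + 1) (-ν)) := by
  have := isProbabilityMeasure_betaMeasure (a := ν + 1) (b := -ν) (by linarith) (by linarith)
  have hp := continuousOn_slice (continuousOn_pole hwc hw) hx
  have ii {F : ℝ → ℂ} (hF : ContinuousOn F (Icc 0 1)) : Integrable F (betaMeasure (ν + 1) (-ν)) :=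
    integrable_of_continuousOn_Icc ae_betaMeasure_mem_Icc hF
  have i1 : Integrable (fun u => ω u * (w u / (1 - x * w u)) ^ 1) (betaMeasure (ν + 1) (-ν)) :=
    ii (hω.mul (hp.pow 1))
  have i2 : Integrable (fun u => ω u * (w u / (1 - x * w u)) ^ 2) (betaMeasure (ν + 1) (-ν)) :=
    ii (hω.mul (hp.pow 2))
  have i3 : Integrable (fun u => ω u * w u) (betaMeasure (ν + 1) (-ν)) := ii (hω.mul hwc)
  have i4 := ii hω
  have hne : ∀ u ∈ Icc (0 : ℝ) 1, 1 - x * w u ≠ 0 := fun u hu =>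
    one_sub_ne_zero_of_notMem_cutRay (mul_notMem_cutRay_of_mem_ball hw hx hu)
  set A := x * (x - α) * (ν + 1) - (x - α * (ν + 1)) * (1 - x) with hA
  set B := -(x * (x - α) * (1 - x)) with hB
  have e : x * (x - α) * ((1 - x) * -poleKernel ν ω w 2 x - (ν + 1) * -poleKernel ν ω w 1 x)
      + (x - α * (ν + 1)) * (1 - x) * -poleKernel ν ω w 1 x
      - (ν + 1) * (α * ∫ u, ω u * w u ∂betaMeasure (ν + 1) (-ν)
        - x * ∫ u, ω u ∂betaMeasure (ν + 1) (-ν))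
      = A * poleKernel ν ω w 1 x + B * poleKernel ν ω w 2 x
        - (ν + 1) * α * (∫ u, ω u * w u ∂betaMeasure (ν + 1) (-ν))
        + (ν + 1) * x * ∫ u, ω u ∂betaMeasure (ν + 1) (-ν) := by
    rw [hA, hB]; ring
  rw [← sub_eq_zero, e, ← mul_zero x, ← hS]
  unfold poleKernel
  have j12 : Integrable (fun u => A * (ω u * (w u / (1 - x * w u)) ^ 1)
      + B * (ω u * (w u / (1 - x * w u)) ^ 2)) (betaMeasure (ν + 1) (-ν)) :=
    (i1.const_mul A).add (i2.const_mul B)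
  have j123 : Integrable (fun u => A * (ω u * (w u / (1 - x * w u)) ^ 1)
      + B * (ω u * (w u / (1 - x * w u)) ^ 2) - (ν + 1) * α * (ω u * w u))
      (betaMeasure (ν + 1) (-ν)) := j12.sub (i3.const_mul _)
  rw [← integral_const_mul, ← integral_const_mul, ← integral_const_mul, ← integral_const_mul,
    ← integral_const_mul, ← integral_add (i1.const_mul A) (i2.const_mul B),
    ← integral_sub j12 (i3.const_mul _), ← integral_add j123 (i4.const_mul _)]
  refine integral_congr_ae (ae_betaMeasure_mem_Icc.mono fun u hu => ?_)
  have := hne u hu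
  simp only [hA, hB]
  field_simp
  ring

end LogKernel

/-! ### Third-kind periods on two cycles and Legendre's relation. -/

section SmallBeta

variable {ν : ℝ} {α : ℂ}

/-- The parametrization of the segment from `1 / α` to `1`. -/
noncomputable def secondCycle (α : ℂ) (u : ℝ) : ℂ := (1 - (1 - α) * u) / α

/-- A radius of convergence. -/
noncomputable def cycleRadius (α : ℂ) : ℝ := ‖α‖ / (1 + ‖α‖)

theorem cycleRadius_pos (hα : α ≠ 0) : 0 < cycleRadius α := by
  have := norm_pos_iff.2 hα
  unfold cycleRadius
  positivity

theorem cycleRadius_lt_one : cycleRadius α < 1 := by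
  have := norm_nonneg α
  rw [cycleRadius, div_lt_one (by positivity)]
  linarith

theorem continuousOn_secondCycle : ContinuousOn (secondCycle α) (Icc 0 1) := by
  unfold secondCycle
  fun_prop

theorem norm_firstCycle_mul_le {u : ℝ} (hu : u ∈ Icc (0 : ℝ) 1) :
    ‖(u : ℂ)‖ * cycleRadius α ≤ 1 := by
  rw [Complex.norm_real, Real.norm_of_nonneg hu.1]
  have h0 : 0 ≤ cycleRadius α := by unfold cycleRadius; positivity
  nlinarith [hu.2, cycleRadius_lt_one (α := α)]

theorem norm_secondCycle_mul_le (hα : α ≠ 0) {u : ℝ} (hu : u ∈ Icc (0 : ℝ) 1) :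
    ‖secondCycle α u‖ * cycleRadius α ≤ 1 := by
  have hp := norm_pos_iff.2 hα
  have h : ‖1 - (1 - α) * (u : ℂ)‖ ≤ 1 + ‖α‖ := by
    -- A convex combination of `1` and `α`. This bounds the second cycle by `(1 + ‖α‖) / ‖α‖`, the
    -- reciprocal of `cycleRadius α`.
    have e : 1 - (1 - α) * (u : ℂ) = ((1 - u : ℝ) : ℂ) + α * u := by push_cast; ring
    rw [e]
    refine (norm_add_le _ _).trans ?_
    rw [norm_mul, Complex.norm_real, Complex.norm_real, Real.norm_of_nonneg hu.1,
      Real.norm_of_nonneg (by linarith [hu.2])]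
    nlinarith [hu.1, hu.2]
  rw [secondCycle, norm_div, cycleRadius, div_mul_div_cancel₀ hp.ne', div_le_one (by positivity)]
  exact h

/-- The combination of third-kind periods whose Euler transform is the entropy coupling. -/
noncomputable def thirdKindPeriod (ν : ℝ) (α x : ℂ) : ℂ :=
  legendreF ν (1 - α) * logKernel ν (fun u => (1 - α * (u : ℂ)) ^ (ν : ℂ)) (fun u => u) x
    - legendreF ν α *
      logKernel ν (fun u => (1 - (1 - α) * (u : ℂ)) ^ (ν : ℂ)) (secondCycle α) x

/-- Its `n`-th rational analogue. -/
noncomputable def thirdKindPole (ν : ℝ) (α : ℂ) (n : ℕ) (x : ℂ) : ℂ :=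
  legendreF ν (1 - α) * poleKernel ν (fun u => (1 - α * (u : ℂ)) ^ (ν : ℂ)) (fun u => u) n x
    - legendreF ν α *
      poleKernel ν (fun u => (1 - (1 - α) * (u : ℂ)) ^ (ν : ℂ)) (secondCycle α) n x

theorem hasDerivAt_thirdKindPeriod (h1 : -1 < ν) (h2 : ν < 0) (hα : α ∈ doubleSlit) {x : ℂ}
    (hx : x ∈ Metric.ball (0 : ℂ) (cycleRadius α)) :
    HasDerivAt (thirdKindPeriod ν α) (-thirdKindPole ν α 1 x) x := by
  obtain ⟨m1, m2⟩ := mem_doubleSlit_iff.1 hα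
  have d1 := hasDerivAt_logKernel h1 h2 (continuousOn_weight_mul (ν := ν) m1)
    Complex.continuous_ofReal.continuousOn (fun u hu => norm_firstCycle_mul_le hu) hx
  have d2 := hasDerivAt_logKernel h1 h2 (continuousOn_weight_mul (ν := ν) m2)
    continuousOn_secondCycle
    (fun u hu => norm_secondCycle_mul_le (ne_zero_of_mem_doubleSlit hα) hu) hx
  convert! (d1.const_mul (legendreF ν (1 - α))).sub (d2.const_mul (legendreF ν α)) using 1
  rw [thirdKindPole]
  ring

theorem hasDerivAt_thirdKindPole (h1 : -1 < ν) (h2 : ν < 0) (hα : α ∈ doubleSlit) (n : ℕ) {x : ℂ}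
    (hx : x ∈ Metric.ball (0 : ℂ) (cycleRadius α)) :
    HasDerivAt (thirdKindPole ν α n) (n * thirdKindPole ν α (n + 1) x) x := by
  obtain ⟨m1, m2⟩ := mem_doubleSlit_iff.1 hα
  have d1 := hasDerivAt_poleKernel h1 h2 (continuousOn_weight_mul (ν := ν) m1)
    Complex.continuous_ofReal.continuousOn (fun u hu => norm_firstCycle_mul_le hu) n hx
  have d2 := hasDerivAt_poleKernel h1 h2 (continuousOn_weight_mul (ν := ν) m2)
    continuousOn_secondCycle
    (fun u hu => norm_secondCycle_mul_le (ne_zero_of_mem_doubleSlit hα) hu) n hx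
  convert! (d1.const_mul (legendreF ν (1 - α))).sub (d2.const_mul (legendreF ν α)) using 1
  rw [thirdKindPole]
  ring

/-- Against the beta density the integrand is, up to normalisation, the derivative of `w ^ (ν + 1)
(1 - w) ^ (-ν) (1 - α w) ^ (ν + 1) / (1 - x w)`, which vanishes at `w = 0` and `w = 1`. -/
theorem firstCycle_exact (h1 : -1 < ν) (h2 : ν < 0) (hα : α ∈ doubleSlit) {x : ℂ}
    (hx : x ∈ Metric.ball (0 : ℂ) (cycleRadius α)) :
    ∫ u, (1 - α * (u : ℂ)) ^ (ν : ℂ) * ((ν + 1 - (u : ℂ)) * (1 - α * u) / (1 - x * u)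
        - α * (ν + 1) * u * (1 - u) / (1 - x * u)
        + u * (1 - u) * (1 - α * u) * x / (1 - x * u) ^ 2) ∂betaMeasure (ν + 1) (-ν) = 0 := by
  have hm := (mem_doubleSlit_iff.1 hα).1
  have hne : ∀ u ∈ Icc (0 : ℝ) 1, 1 - x * (u : ℂ) ≠ 0 := fun u hu =>
    one_sub_ne_zero_of_notMem_cutRay (mul_notMem_cutRay_of_mem_ball (w := fun u => (u : ℂ))
      (fun u hu => norm_firstCycle_mul_le hu) hx hu)
  have cw := continuousOn_weight_mul (ν := ν) hm
  rw [← integral_betaMeasure_stein (a := ν + 1) (b := -ν) (by linarith) (by linarith)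
    (k := fun u : ℝ => (1 - α * (u : ℂ)) ^ (ν : ℂ) * ((1 - α * u) / (1 - x * u)))
    (k' := fun u : ℝ => (1 - α * (u : ℂ)) ^ (ν : ℂ) * (-(α * (ν + 1)) / (1 - x * u)
      + (1 - α * u) * x / (1 - x * u) ^ 2))]
  · congr 1
    ext u
    push_cast
    ring
  · exact cw.mul (ContinuousOn.div (by fun_prop) (by fun_prop) hne)
  · refine cw.mul (ContinuousOn.add ?_ ?_)
    · exact ContinuousOn.div (by fun_prop) (by fun_prop) hne
    · exact ContinuousOn.div (by fun_prop) (by fun_prop) fun u hu => pow_ne_zero 2 (hne u hu)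
  · intro u hu
    have hu' := Ioo_subset_Icc_self hu
    have h0 := hne u hu'
    have h3 := one_sub_mul_ne_zero hm hu'
    have hof := Complex.ofRealCLM.hasDerivAt (x := u)
    have := (hasDerivAt_weight_mul_real hm (ν : ℂ) hu').mul
      (((hof.const_mul α).const_sub 1).div ((hof.const_mul x).const_sub 1) h0)
    convert! this using 1
    simp only [Complex.ofRealCLM_apply, Complex.ofReal_one, Pi.div_apply]
    field_simp
    ring

/-- The same exact differential as on the first cycle, pulled back along `w = (1 - (1 - α) u) / α`.
There `1 - α w = (1 - α) u` and `1 - w = -(1 - α) (1 - u) / α`, so the endpoints `1 / α` and `1` are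
again zeros of the primitive. -/
theorem secondCycle_exact (h1 : -1 < ν) (h2 : ν < 0) (hα : α ∈ doubleSlit) {x : ℂ}
    (hx : x ∈ Metric.ball (0 : ℂ) (cycleRadius α)) :
    ∫ u, (1 - (1 - α) * (u : ℂ)) ^ (ν : ℂ) *
        ((ν + 1 - secondCycle α u) * (1 - α * secondCycle α u) / (1 - x * secondCycle α u)
        - α * (ν + 1) * secondCycle α u * (1 - secondCycle α u) / (1 - x * secondCycle α u)
        + secondCycle α u * (1 - secondCycle α u) * (1 - α * secondCycle α u) * x
          / (1 - x * secondCycle α u) ^ 2) ∂betaMeasure (ν + 1) (-ν) = 0 := by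
  have hm := (mem_doubleSlit_iff.1 hα).2
  have ha := ne_zero_of_mem_doubleSlit hα
  have hne : ∀ u ∈ Icc (0 : ℝ) 1, 1 - x * ((1 - (1 - α) * (u : ℂ)) / α) ≠ 0 := fun u hu =>
    one_sub_ne_zero_of_notMem_cutRay (mul_notMem_cutRay_of_mem_ball (w := secondCycle α)
      (fun u hu => norm_secondCycle_mul_le ha hu) hx hu)
  have cw := continuousOn_weight_mul (ν := ν) hm
  unfold secondCycle
  rw [← mul_zero ((1 - α) / α), ← integral_betaMeasure_stein (a := ν + 1) (b := -ν)
    (by linarith) (by linarith)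
    (k := fun u : ℝ => (1 - (1 - α) * (u : ℂ)) ^ (ν : ℂ) *
      ((1 - (1 - α) * u) / (1 - x * ((1 - (1 - α) * (u : ℂ)) / α))))
    (k' := fun u : ℝ => (1 - (1 - α) * (u : ℂ)) ^ (ν : ℂ) *
      (-((1 - α) * (ν + 1)) / (1 - x * ((1 - (1 - α) * (u : ℂ)) / α))
      + (1 - (1 - α) * u) * (x * (-(1 - α) / α))
        / (1 - x * ((1 - (1 - α) * (u : ℂ)) / α)) ^ 2)), ← integral_const_mul]
  · refine integral_congr_ae (ae_betaMeasure_mem_Icc.mono fun u hu => ?_)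
    have h0 := hne u hu
    have h3 : α - x * (1 - (1 - α) * u) ≠ 0 := fun h => h0 (by
      rw [← mul_div_assoc, one_sub_div ha, h, zero_div])
    dsimp only
    rw [← mul_div_assoc x, one_sub_div ha]
    push_cast
    field_simp
    ring
  · exact cw.mul (ContinuousOn.div (by fun_prop) (by fun_prop) hne)
  · refine cw.mul (ContinuousOn.add ?_ ?_)
    · exact ContinuousOn.div (by fun_prop) (by fun_prop) hne
    · exact ContinuousOn.div (by fun_prop) (by fun_prop) fun u hu => pow_ne_zero 2 (hne u hu)
  · intro u hu
    have hu' := Ioo_subset_Icc_self hu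
    have h0 := hne u hu'
    have h3 := one_sub_mul_ne_zero hm hu'
    have h4 : α - x * (1 - (1 - α) * u) ≠ 0 := fun h => h0 (by
      rw [← mul_div_assoc, one_sub_div ha, h, zero_div])
    have hof := Complex.ofRealCLM.hasDerivAt (x := u)
    have hl := (hof.const_mul (1 - α)).const_sub 1
    have := (hasDerivAt_weight_mul_real hm (ν : ℂ) hu').mul
      (hl.div (((hl.div_const α).const_mul x).const_sub 1) h0)
    convert! this using 1
    simp only [Complex.ofRealCLM_apply, Complex.ofReal_one, Pi.div_apply]
    rw [← mul_div_assoc x, one_sub_div ha]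
    field_simp
    ring

/-- Legendre's relation between the periods of the first and second kind. -/
theorem legendre_relation (h1 : -1 < ν) (h2 : ν < 0) (hα : α ∈ doubleSlit) :
    (ν + 1) * (α * (legendreF ν (1 - α) *
        ∫ u, (1 - α * (u : ℂ)) ^ (ν : ℂ) * u ∂betaMeasure (ν + 1) (-ν)
      - legendreF ν α * ∫ u, (1 - (1 - α) * (u : ℂ)) ^ (ν : ℂ) * secondCycle α u
        ∂betaMeasure (ν + 1) (-ν)))
      = -((beta (ν + 1) (-ν) : ℝ) : ℂ)⁻¹ := by
  have := isProbabilityMeasure_betaMeasure (a := ν + 1) (b := -ν) (by linarith) (by linarith)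
  obtain ⟨m1, m2⟩ := mem_doubleSlit_iff.1 hα
  have ha := ne_zero_of_mem_doubleSlit hα
  have ii {F : ℝ → ℂ} (hF : ContinuousOn F (Icc 0 1)) : Integrable F (betaMeasure (ν + 1) (-ν)) :=
    integrable_of_continuousOn_Icc ae_betaMeasure_mem_Icc hF
  have cw := continuousOn_weight_mul (ν := ν) m2
  have r1 := integral_mul_weight h1 h2 m1
  have r2 := integral_mul_weight h1 h2 m2
  have e1 : ∫ u, (1 - α * (u : ℂ)) ^ (ν : ℂ) * u ∂betaMeasure (ν + 1) (-ν)
      = ∫ u, (u : ℂ) * (1 - α * u) ^ (ν : ℂ) ∂betaMeasure (ν + 1) (-ν) := by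
    congr 1; ext u; ring
  have e2 : α * ∫ u, (1 - (1 - α) * (u : ℂ)) ^ (ν : ℂ) * secondCycle α u
        ∂betaMeasure (ν + 1) (-ν)
      = legendreF ν (1 - α) - (1 - α) *
        ∫ u, (u : ℂ) * (1 - (1 - α) * u) ^ (ν : ℂ) ∂betaMeasure (ν + 1) (-ν) := by
    rw [legendreF, ← integral_const_mul, ← integral_const_mul, ← integral_sub (ii cw)]
    · congr 1
      ext u
      rw [secondCycle]
      field_simp
    · exact ii (continuousOn_const.mul (Complex.continuous_ofReal.continuousOn.mul cw))
  have hw := legendreWronskian_mirror h1 h2 hα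
  rw [← hw, legendreWronskian, e1]
  simp only [deriv_comp_one_sub]
  rw [sub_sub_cancel] at r2
  -- The contiguity relations at `α` and `1 - α` express the second-kind periods through `F` and
  -- `F'`. The products of undifferentiated functions cancel and the Wronskian remains.
  linear_combination α * legendreF ν (1 - α) * r1 - (ν + 1) * legendreF ν α * e2
    + (1 - α) * legendreF ν α * r2

/-- The cycle equations leave `(ν + 1) (α ∫ ω w - x ∫ ω)`. The weights `F (1 - α)` and `F α` are
chosen so that the terms in `x` cancel, and Legendre's relation gives the remaining constant. -/
theorem legendreOp_weightedEuler_thirdKind (h1 : -1 < ν) (h2 : ν < 0) (hα : α ∈ doubleSlit)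
    {β : ℂ} (hβ : β ∈ Metric.ball (0 : ℂ) (cycleRadius α)) :
    (β - α) * legendreOp ν (weightedEuler ν (thirdKindPeriod ν α)) β
      = -((beta (ν + 1) (-ν) : ℝ) : ℂ)⁻¹ * legendreF ν β := by
  obtain ⟨m1, m2⟩ := mem_doubleSlit_iff.1 hα
  have ha := ne_zero_of_mem_doubleSlit hα
  refine legendreOp_weightedEuler_of_pole h1 h2 Metric.isOpen_ball (J := thirdKindPeriod ν α)
    (J' := fun x => -thirdKindPole ν α 1 x) (J'' := fun x => -thirdKindPole ν α 2 x) ?_ ?_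
    (fun z hz => hasDerivAt_thirdKindPeriod h1 h2 hα hz) (fun z hz => ?_) (fun z hz => ?_) ?_ hβ
  · intro z hz v hv
    rw [mem_ball_zero_iff] at hz ⊢
    rw [norm_mul, Complex.norm_real, Real.norm_of_nonneg hv.1]
    exact (mul_le_of_le_one_right (norm_nonneg z) hv.2).trans_lt hz
  · exact (Metric.ball_subset_ball cycleRadius_lt_one.le).trans ball_subset_compl_cutRay
  · have := (hasDerivAt_thirdKindPole h1 h2 hα 1 hz).neg
    convert! this using 1
    simp
  · exact (hasDerivAt_thirdKindPole h1 h2 hα 2 hz).continuousAt.neg.continuousWithinAt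
  · intro x hx
    have c1 := cycle_equation h1 h2 (α := α) (continuousOn_weight_mul (ν := ν) m1)
      Complex.continuous_ofReal.continuousOn (fun u hu => norm_firstCycle_mul_le hu) hx
      (firstCycle_exact h1 h2 hα hx)
    have c2 := cycle_equation h1 h2 (α := α) (continuousOn_weight_mul (ν := ν) m2)
      continuousOn_secondCycle (fun u hu => norm_secondCycle_mul_le ha hu) hx
      (secondCycle_exact h1 h2 hα hx)
    have hl := legendre_relation h1 h2 hα
    rw [← hl]
    have f1 : ∫ u, (1 - α * (u : ℂ)) ^ (ν : ℂ) ∂betaMeasure (ν + 1) (-ν) = legendreF ν α := rfl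
    have f2 : ∫ u, (1 - (1 - α) * (u : ℂ)) ^ (ν : ℂ) ∂betaMeasure (ν + 1) (-ν)
      = legendreF ν (1 - α) := rfl
    rw [f1] at c1
    rw [f2] at c2
    simp only [thirdKindPole]
    linear_combination legendreF ν (1 - α) * c1 - legendreF ν α * c2

end SmallBeta

/-! ### Holomorphy of parametric integrals without a formula for the derivative. -/

section HolomorphicIntegral

variable {X : Type*} [TopologicalSpace X] [MeasurableSpace X] [OpensMeasurableSpace X]
  {μ : Measure X} [IsFiniteMeasure μ] {K : Set X}

/-- Integrals of kernels that are continuous on a compact set and holomorphic in a parameter. -/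
theorem differentiableOn_integral_of_continuousOn_compact (hK : IsCompact K)
    (hKm : MeasurableSet K) (hμ : ∀ᵐ x ∂μ, x ∈ K) {U : Set ℂ} (hU : IsOpen U) {k : X → ℂ → ℂ}
    (hk : ContinuousOn (fun p : X × ℂ => k p.1 p.2) (K ×ˢ U))
    (hd : ∀ x ∈ K, DifferentiableOn ℂ (k x) U) :
    DifferentiableOn ℂ (fun z => ∫ x, k x z ∂μ) U := by
  intro z hz
  obtain ⟨r, hr, hrU⟩ := Metric.nhds_basis_closedBall.mem_iff.1 (hU.mem_nhds hz)
  obtain ⟨C, hC⟩ := (hK.prod (isCompact_closedBall z r)).exists_bound_of_continuousOn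
    (hk.mono (prod_mono_right hrU))
  have hres := Measure.restrict_eq_self_of_ae_mem hμ
  have hmeas : ∀ w ∈ U, AEStronglyMeasurable (fun x => k x w) μ := fun w hw => by
    rw [← hres]
    exact (continuousOn_slice hk hw).aestronglyMeasurable hKm
  have hdiff : ∀ x ∈ K, ∀ w ∈ U, HasDerivAt (k x) (deriv (k x) w) w := fun x hx w hw =>
    ((hd x hx).differentiableAt (hU.mem_nhds hw)).hasDerivAt
  have hsub : Metric.ball z (r / 2) ⊆ U := (Metric.ball_subset_closedBall.trans
    (Metric.closedBall_subset_closedBall (by linarith))).trans hrU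
  refine (hasDerivAt_integral_of_dominated_loc_of_deriv_le (F := fun w x => k x w)
    (F' := fun w x => deriv (k x) w) (bound := fun _ => C / (r / 2))
    (Metric.ball_mem_nhds z (half_pos hr)) ?_ ?_ ?_ ?_ ?_ ?_).2.differentiableAt.differentiableWithinAt
  · filter_upwards [hU.mem_nhds hz] with w hw using hmeas w hw
  · exact integrable_of_continuousOn_compact hK hKm hμ (continuousOn_slice hk hz)
  -- Measurability in `x` of the complex derivative: it is a pointwise limit of difference quotients
  -- along this sequence.
  · have hseq : ∀ n : ℕ, z + ((r / (n + 1) : ℝ) : ℂ) ∈ U := fun n => hrU (by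
      rw [Metric.mem_closedBall, dist_eq_norm, add_sub_cancel_left, Complex.norm_real,
        Real.norm_of_nonneg (by positivity), div_le_iff₀ (by positivity)]
      nlinarith [(Nat.cast_nonneg n : (0 : ℝ) ≤ n)])
    refine aestronglyMeasurable_of_tendsto_ae (u := atTop)
      (f := fun (n : ℕ) x => slope (k x) z (z + ((r / (n + 1) : ℝ) : ℂ))) (fun n => ?_) ?_
    · simp only [slope_def_module, smul_eq_mul]
      exact ((hmeas _ (hseq n)).sub (hmeas z hz)).const_mul _
    · refine hμ.mono fun x hx => (hdiff x hx z hz).tendsto_slope.comp ?_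
      refine tendsto_nhdsWithin_iff.2 ⟨?_, Eventually.of_forall fun n => ?_⟩
      · have h0 : Tendsto (fun n : ℕ => r / ((n : ℝ) + 1)) atTop (𝓝 0) := by
          simpa using (tendsto_one_div_add_atTop_nhds_zero_nat (𝕜 := ℝ)).const_mul r
            |>.congr fun n => by ring
        have := ((Complex.continuous_ofReal.tendsto 0).comp h0).const_add z
        simpa using this
      · have : (r / ((n : ℝ) + 1)) ≠ 0 := by positivity
        rw [mem_compl_singleton_iff]
        intro h
        rw [add_eq_left, Complex.ofReal_eq_zero] at h
        exact this h
  · refine hμ.mono fun x hx w hw => ?_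
    -- Cauchy's estimate on circles of radius `r / 2` about points of the ball of radius `r / 2`;
    -- these circles stay in the compact ball where `C` bounds the kernel.
    refine Complex.norm_deriv_le_of_forall_mem_sphere_norm_le (half_pos hr) ?_ fun ζ hζ => ?_
    · refine DifferentiableOn.diffContOnCl ((hd x hx).mono ?_)
      refine Metric.closure_ball_subset_closedBall.trans (subset_trans ?_ hrU)
      refine Metric.closedBall_subset_closedBall' ?_
      linarith [Metric.mem_ball.1 hw]
    · refine hC (x, ζ) ⟨hx, ?_⟩
      rw [Metric.mem_closedBall]
      have h1 := Metric.mem_sphere.1 hζ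
      have h2 := Metric.mem_ball.1 hw
      linarith [dist_triangle ζ w z]
  · exact integrable_const _
  · exact hμ.mono fun x hx w hw => hdiff x hx w (hsub hw)

end HolomorphicIntegral

/-! ### The domain of the entropy coupling: connectedness, and branches of its logarithms. -/

section EntropyDomain

variable {α : ℂ}

/-- The domain of analyticity of the entropy coupling in `β`. -/
def entropyDomain (α : ℂ) : Set ℂ :=
  {β | β ∈ doubleSlit ∧ (1 - α) / α * (β / (1 - β)) ∉ cutRay}

theorem isOpen_entropyDomain : IsOpen (entropyDomain α) := by
  have hc : ContinuousOn (fun β : ℂ => (1 - α) / α * (β / (1 - β))) doubleSlit :=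
    continuousOn_const.mul (continuousOn_id.div (by fun_prop) fun β hβ =>
      one_sub_ne_zero_of_mem_doubleSlit hβ)
  exact hc.isOpen_inter_preimage isOpen_doubleSlit isOpen_compl_cutRay

/-- With `div_one_sub_mem_slitPlane`, this says that the Möbius map `β ↦ β / (1 - β)` identifies the
double slit plane with the slit plane. In the new coordinate the second condition defining
`entropyDomain` removes a single ray. -/
theorem div_one_add_mem_doubleSlit {x : ℂ} (hx : x ∈ Complex.slitPlane) :
    x / (1 + x) ∈ doubleSlit := by
  have h1 : 1 + x ≠ 0 := fun h => by
    have : x = ((-1 : ℝ) : ℂ) := by push_cast; linear_combination h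
    rw [this, Complex.ofReal_mem_slitPlane] at hx
    linarith
  rw [mem_doubleSlit_iff]
  constructor
  · rintro ⟨r, hr, h⟩
    rw [div_eq_iff h1] at h
    have hr1 : (1 - (r : ℂ)) ≠ 0 := fun h' => by
      have e : (r : ℂ) = 1 := by linear_combination -h'
      rw [e] at h
      exact one_ne_zero (α := ℂ) (by linear_combination -h)
    have hr2 : 1 < r := lt_of_le_of_ne hr fun h' => hr1 (by rw [← h']; simp)
    have : x = ((r / (1 - r) : ℝ) : ℂ) := by
      push_cast
      rw [eq_div_iff hr1]
      linear_combination h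
    rw [this, Complex.ofReal_mem_slitPlane] at hx
    exact absurd hx (not_lt.2 (div_nonpos_of_nonneg_of_nonpos (by linarith) (by linarith)))
  · rintro ⟨r, hr, h⟩
    rw [one_sub_div h1, add_sub_cancel_right, div_eq_iff h1] at h
    have hr0 : (r : ℂ) ≠ 0 := Complex.ofReal_ne_zero.2 (by linarith)
    have : x = ((r⁻¹ - 1 : ℝ) : ℂ) := by
      push_cast
      field_simp
      linear_combination -h
    rw [this, Complex.ofReal_mem_slitPlane] at hx
    have := inv_le_one_of_one_le₀ hr
    linarith

theorem div_one_sub_mem_slitPlane {β : ℂ} (hβ : β ∈ doubleSlit) :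
    β / (1 - β) ∈ Complex.slitPlane := by
  have h1 := one_sub_ne_zero_of_mem_doubleSlit hβ
  by_contra hc
  rw [Complex.mem_slitPlane_iff] at hc
  push Not at hc
  set ρ := (β / (1 - β)).re with hρ
  have hx : β / (1 - β) = (ρ : ℂ) := Complex.ext (by simp [hρ]) (by simpa using hc.2)
  rw [div_eq_iff h1] at hx
  rcases lt_trichotomy (1 + ρ) 0 with h | h | h
  · refine (mem_doubleSlit_iff.1 hβ).1 ⟨ρ / (1 + ρ), ?_, ?_⟩
    · rw [le_div_iff_of_neg h]; linarith
    · have : (1 + (ρ : ℂ)) ≠ 0 := by exact_mod_cast h.ne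
      push_cast
      rw [eq_div_iff this]
      linear_combination hx
  · have h' : (ρ : ℂ) = -1 := by
      have : ρ = -1 := by linarith
      rw [this]; simp
    rw [h'] at hx
    exact one_ne_zero (α := ℂ) (by linear_combination hx)
  · have hm := mem_slitPlane_of_mem_doubleSlit hβ
    have : (1 + (ρ : ℂ)) ≠ 0 := by exact_mod_cast h.ne'
    have e : β = ((ρ / (1 + ρ) : ℝ) : ℂ) := by
      push_cast
      rw [eq_div_iff this]
      linear_combination hx
    rw [e, Complex.ofReal_mem_slitPlane] at hm
    exact absurd hm (not_lt.2 (div_nonpos_of_nonpos_of_nonneg hc.1 h.le))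

/-- The set is stable under scaling by `(0, 1]` and contains a small slit disk about the origin, so
every point is joined to that disk along its own ray. It need not be star-shaped about an interior
point. -/
theorem isPreconnected_slitPlane_diff_ray (b : ℂ) :
    IsPreconnected {x | x ∈ Complex.slitPlane ∧ b * x ∉ cutRay} := by
  set X := {x | x ∈ Complex.slitPlane ∧ b * x ∉ cutRay} with hX
  set ρ : ℝ := (1 + ‖b‖)⁻¹ with hρ
  have hb := norm_nonneg b
  have hρ0 : 0 < ρ := by positivity
  have hball : slitBall ρ ⊆ X := fun x hx => by
    refine ⟨hx.2, ball_subset_compl_cutRay ?_⟩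
    have h := mem_ball_zero_iff.1 hx.1
    rw [mem_ball_zero_iff, norm_mul]
    calc ‖b‖ * ‖x‖ ≤ ‖b‖ * ρ := mul_le_mul_of_nonneg_left h.le hb
      _ < 1 := by rw [hρ, ← div_eq_mul_inv, div_lt_one (by positivity)]; linarith
  have hscale : ∀ y ∈ X, ∀ s ∈ Ioc (0 : ℝ) 1, (s : ℂ) * y ∈ X := fun y hy s hs => by
    refine ⟨?_, ?_⟩
    · have h := hy.1
      rw [Complex.mem_slitPlane_iff] at h ⊢
      rcases h with h | h
      · left; simpa using mul_pos hs.1 h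
      · right; simpa using ⟨hs.1.ne', h⟩
    · have := mul_notMem_cutRay hy.2 ⟨hs.1.le, hs.2⟩
      rwa [mul_assoc, mul_comm y] at this
  refine isPreconnected_of_forall ((ρ / 2 : ℝ) : ℂ) fun y hy => ?_
  refine ⟨slitBall ρ ∪ (fun s : ℝ => (s : ℂ) * y) '' Ioc 0 1, ?_, ?_, ?_, ?_⟩
  · rintro z (hz | ⟨s, hs, rfl⟩)
    · exact hball hz
    · exact hscale y hy s hs
  · exact Or.inl (ofReal_mem_slitBall ⟨by linarith, by linarith⟩)
  · exact Or.inr ⟨1, ⟨zero_lt_one, le_rfl⟩, by simp⟩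
  · have hy0 : 0 < ‖y‖ := norm_pos_iff.2 (Complex.slitPlane_ne_zero hy.1)
    -- A scaling factor that brings `y` to norm at most `ρ / 2`, inside the slit disk.
    set s : ℝ := min 1 (ρ / (2 * ‖y‖)) with hs
    have hs' : s ∈ Ioc (0 : ℝ) 1 := ⟨lt_min one_pos (by positivity), min_le_left _ _⟩
    refine IsPreconnected.union ((s : ℂ) * y) ⟨?_, (hscale y hy s hs').1⟩ ⟨s, hs', rfl⟩
      (isPreconnected_slitBall hρ0) (isPreconnected_Ioc.image _ (by fun_prop))
    rw [mem_ball_zero_iff, norm_mul, Complex.norm_real, Real.norm_of_nonneg hs'.1.le]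
    calc s * ‖y‖ ≤ ρ / (2 * ‖y‖) * ‖y‖ :=
          mul_le_mul_of_nonneg_right (min_le_right _ _) hy0.le
      _ = ρ / 2 := by field_simp
      _ < ρ := by linarith

theorem isPreconnected_entropyDomain : IsPreconnected (entropyDomain α) := by
  have himg : entropyDomain α = (fun x : ℂ => x / (1 + x)) ''
      {x | x ∈ Complex.slitPlane ∧ (1 - α) / α * x ∉ cutRay} := by
    have hinv : ∀ x ∈ Complex.slitPlane, x / (1 + x) / (1 - x / (1 + x)) = x := fun x hx => by
      have h1 : 1 + x ≠ 0 := fun h => by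
        have : x = ((-1 : ℝ) : ℂ) := by push_cast; linear_combination h
        rw [this, Complex.ofReal_mem_slitPlane] at hx
        linarith
      rw [one_sub_div h1, add_sub_cancel_right, div_div_div_cancel_right₀ h1, div_one]
    ext β
    constructor
    · rintro ⟨hβ, hκ⟩
      refine ⟨β / (1 - β), ⟨div_one_sub_mem_slitPlane hβ, hκ⟩, ?_⟩
      have h1 := one_sub_ne_zero_of_mem_doubleSlit hβ
      dsimp only
      rw [one_add_div h1, sub_add_cancel, div_div_div_cancel_right₀ h1, div_one]
    · rintro ⟨x, ⟨hx, hκ⟩, rfl⟩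
      refine ⟨div_one_add_mem_doubleSlit hx, ?_⟩
      rwa [hinv x hx]
  rw [himg]
  refine (isPreconnected_slitPlane_diff_ray _).image _ ?_
  refine continuousOn_id.div (by fun_prop) fun x hx h => ?_
  have : x = ((-1 : ℝ) : ℂ) := by push_cast; linear_combination h
  have h' := hx.1
  rw [this, Complex.ofReal_mem_slitPlane] at h'
  linarith

theorem exists_Ioo_subset_entropyDomain (hα : α ≠ 0) :
    ∃ ε : ℝ, 0 < ε ∧ ε ≤ cycleRadius α ∧ ∀ r ∈ Ioo 0 ε, (r : ℂ) ∈ entropyDomain α := by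
  set b := (1 - α) / α with hb
  have hb0 := norm_nonneg b
  refine ⟨min (cycleRadius α) (1 + ‖b‖)⁻¹, lt_min (cycleRadius_pos hα) (by positivity),
    min_le_left _ _, fun r hr => ?_⟩
  have hr1 : r < 1 := (hr.2.trans_le (min_le_left _ _)).trans cycleRadius_lt_one
  refine ⟨ofReal_mem_doubleSlit hr.1 hr1, ball_subset_compl_cutRay ?_⟩
  have h2 : r * (1 + ‖b‖) < 1 := by
    have := hr.2.trans_le (min_le_right _ _)
    rwa [← one_div, lt_div_iff₀ (by positivity)] at this
  have e : (r : ℂ) / (1 - r) = ((r / (1 - r) : ℝ) : ℂ) := by push_cast; rfl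
  rw [← hb, mem_ball_zero_iff, norm_mul, e, Complex.norm_real,
    Real.norm_of_nonneg (div_nonneg hr.1.le (by linarith)), ← mul_div_assoc,
    div_lt_one (by linarith)]
  linarith

/-- At `β = α` the excluded ratio equals `1`, the tip of the ray, so the pole is automatically
outside the domain. -/
theorem ne_of_mem_entropyDomain (hα : α ∈ doubleSlit) {β : ℂ} (hβ : β ∈ entropyDomain α) :
    β ≠ α := by
  rintro rfl
  refine hβ.2 ⟨1, le_rfl, ?_⟩
  have h0 := ne_zero_of_mem_doubleSlit hα
  have h1 := one_sub_ne_zero_of_mem_doubleSlit hα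
  rw [div_mul_div_comm, mul_comm, div_self (mul_ne_zero h0 h1), Complex.ofReal_one]

/-- The ratio is the convex combination `u * 1 + (1 - u) * (1 - β v)⁻¹`, and the slit plane is
stable under inversion and star-shaped about `1`. -/
theorem ratio_mem_slitPlane {β : ℂ} (hβ : β ∉ cutRay) {u v : ℝ} (hu : u ∈ Icc (0 : ℝ) 1)
    (hv : v ∈ Icc (0 : ℝ) 1) : (1 - β * u * v) / (1 - β * v) ∈ Complex.slitPlane := by
  have hm := one_sub_mem_slitPlane (mul_notMem_cutRay hβ hv)
  have h0 := Complex.slitPlane_ne_zero hm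
  have hinv : (1 - β * (v : ℂ))⁻¹ ∈ Complex.slitPlane := by
    have hn := Complex.normSq_pos.2 h0
    rw [Complex.mem_slitPlane_iff] at hm ⊢
    rw [Complex.inv_re, Complex.inv_im]
    exact hm.imp (fun h => div_pos h hn) fun h => div_ne_zero (neg_ne_zero.2 h) hn.ne'
  have := Complex.starConvex_one_slitPlane hinv hu.1 (sub_nonneg.2 hu.2) (add_sub_cancel _ _)
  convert! this using 1
  simp only [Complex.real_smul]
  push_cast
  field_simp
  ring

theorem one_sub_kappa_mem_slitPlane {κ : ℂ} (hκ : κ ∉ cutRay) {u v : ℝ} (hu : u ∈ Icc (0 : ℝ) 1)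
    (hv : v ∈ Icc (0 : ℝ) 1) : 1 - κ * (1 - u) * (1 - v) ∈ Complex.slitPlane := by
  have hs : (1 - u) * (1 - v) ∈ Icc (0 : ℝ) 1 :=
    ⟨mul_nonneg (by linarith [hu.2]) (by linarith [hv.2]), by nlinarith [hu.1, hu.2, hv.1, hv.2]⟩
  have := one_sub_mem_slitPlane (mul_notMem_cutRay hκ hs)
  convert! this using 1
  push_cast
  ring

end EntropyDomain

/-! ### The entropy coupling as an Euler transform. -/

section EntropyNumerator

variable {ν : ℝ} {α : ℂ}

/-- The entropy coupling, multiplied by `P_ν(1 - 2 α) P_ν(2 α - 1) P_ν(1 - 2 β)`. -/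
noncomputable def entropyNumerator (ν : ℝ) (α β : ℂ) : ℂ :=
  legendreF ν (1 - α) *
      ∫ u, (1 - α * (u : ℂ)) ^ (ν : ℂ) *
        ∫ v, (1 - β * (v : ℂ)) ^ (ν : ℂ) * Complex.log ((1 - β * u * v) / (1 - β * v))
          ∂betaMeasure (ν + 1) (-ν) ∂betaMeasure (ν + 1) (-ν)
    - legendreF ν α *
      ∫ u, (1 - (1 - α) * (u : ℂ)) ^ (ν : ℂ) *
        ∫ v, (1 - β * (v : ℂ)) ^ ((-ν - 1 : ℝ) : ℂ) *
          Complex.log (1 - (1 - α) / α * (β / (1 - β)) * (1 - (u : ℂ)) * (1 - (v : ℂ)))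
          ∂betaMeasure (-ν) (ν + 1) ∂betaMeasure (ν + 1) (-ν)

theorem entropyNumerator_eq (h1 : -1 < ν) (h2 : ν < 0) (hα : α ∈ doubleSlit) {β : ℂ}
    (hβ : β ∉ cutRay) :
    entropyNumerator ν α β
      = legendreF ν α * legendreF ν (1 - α) * legendreF ν β * entropyH ν α β := by
  obtain ⟨m1, m2⟩ := mem_doubleSlit_iff.1 hα
  have n1 := legendreF_ne_zero h1 h2 m1
  have n2 := legendreF_ne_zero h1 h2 m2
  have n3 := legendreF_ne_zero h1 h2 hβ
  unfold entropyH entropyNumerator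
  simp only [legendreExpect_eq h1 h2, legendreExpect_eq (ν := -ν - 1) (by linarith) (by linarith),
    legendreF_neg_sub_one h1 h2 hβ, show -ν - 1 + 1 = -ν by ring,
    show -(-ν - 1) = ν + 1 by ring, ← mul_div_assoc, integral_div]
  have aux : ∀ A B p q r : ℂ, p ≠ 0 → q ≠ 0 → r ≠ 0 →
      q * A - p * B = p * q * r * (A / r / p - B / r / q) := fun A B p q r hp hq hr => by
    field_simp
  exact aux _ _ _ _ _ n1 n2 n3

/-- Both iterated integrals are integrals over the compact square of a kernel that is jointly
continuous and holomorphic in `β`, since the arguments of the logarithms stay in the slit plane. -/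
theorem differentiableOn_entropyNumerator (h1 : -1 < ν) (h2 : ν < 0) (hα : α ∈ doubleSlit) :
    DifferentiableOn ℂ (entropyNumerator ν α) (entropyDomain α) := by
  have := isProbabilityMeasure_betaMeasure (a := ν + 1) (b := -ν) (by linarith) (by linarith)
  have := isProbabilityMeasure_betaMeasure (a := -ν) (b := ν + 1) (by linarith) (by linarith)
  obtain ⟨m1, m2⟩ := mem_doubleSlit_iff.1 hα
  have hK : IsCompact (Icc (0 : ℝ) 1 ×ˢ Icc (0 : ℝ) 1) := isCompact_Icc.prod isCompact_Icc
  have hKm : MeasurableSet (Icc (0 : ℝ) 1 ×ˢ Icc (0 : ℝ) 1) :=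
    measurableSet_Icc.prod measurableSet_Icc
  have hae {a b c d : ℝ} [IsProbabilityMeasure (betaMeasure a b)]
      [IsProbabilityMeasure (betaMeasure c d)] :
      ∀ᵐ p ∂((betaMeasure a b).prod (betaMeasure c d)), p ∈ Icc (0 : ℝ) 1 ×ˢ Icc (0 : ℝ) 1 := by
    have h3 : ∀ᵐ p ∂((betaMeasure a b).prod (betaMeasure c d)), p.1 ∈ Icc (0 : ℝ) 1 :=
      Measure.quasiMeasurePreserving_fst.ae ae_betaMeasure_mem_Icc
    have h4 : ∀ᵐ p ∂((betaMeasure a b).prod (betaMeasure c d)), p.2 ∈ Icc (0 : ℝ) 1 :=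
      Measure.quasiMeasurePreserving_snd.ae ae_betaMeasure_mem_Icc
    filter_upwards [h3, h4] with p hp hp' using ⟨hp, hp'⟩
  have hcut : ∀ β ∈ entropyDomain α, β ∉ cutRay := fun β hβ => (mem_doubleSlit_iff.1 hβ.1).1
  have key {a b c d : ℝ} [IsProbabilityMeasure (betaMeasure a b)]
      [IsProbabilityMeasure (betaMeasure c d)] {ω : ℝ → ℂ} {s : ℂ} {g : ℂ → ℝ → ℝ → ℂ}
      (hω : ContinuousOn ω (Icc 0 1))
      (hg : ContinuousOn (fun p : (ℝ × ℝ) × ℂ => g p.2 p.1.1 p.1.2)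
        ((Icc (0 : ℝ) 1 ×ˢ Icc (0 : ℝ) 1) ×ˢ entropyDomain α))
      (hgm : ∀ u ∈ Icc (0 : ℝ) 1, ∀ v ∈ Icc (0 : ℝ) 1, ∀ β ∈ entropyDomain α,
        g β u v ∈ Complex.slitPlane)
      (hgd : ∀ u ∈ Icc (0 : ℝ) 1, ∀ v ∈ Icc (0 : ℝ) 1,
        DifferentiableOn ℂ (fun β => g β u v) (entropyDomain α)) :
      DifferentiableOn ℂ (fun β => ∫ u, ω u * ∫ v, (1 - β * (v : ℂ)) ^ s * Complex.log (g β u v)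
        ∂betaMeasure c d ∂betaMeasure a b) (entropyDomain α) := by
    have hcont : ContinuousOn (fun p : (ℝ × ℝ) × ℂ => ω p.1.1 * ((1 - p.2 * (p.1.2 : ℂ)) ^ s *
        Complex.log (g p.2 p.1.1 p.1.2)))
        ((Icc (0 : ℝ) 1 ×ˢ Icc (0 : ℝ) 1) ×ˢ entropyDomain α) := by
      refine ContinuousOn.mul ?_ (ContinuousOn.mul ?_ ?_)
      · exact hω.comp (f := fun p : (ℝ × ℝ) × ℂ => p.1.1) (by fun_prop) fun p hp => hp.1.1
      · refine ContinuousOn.cpow (by fun_prop) continuousOn_const fun p hp => ?_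
        exact one_sub_mem_slitPlane (mul_notMem_cutRay (hcut _ hp.2) hp.1.2)
      · exact hg.clog fun p hp => hgm _ hp.1.1 _ hp.1.2 _ hp.2
    have hdiff := differentiableOn_integral_of_continuousOn_compact
      (μ := (betaMeasure a b).prod (betaMeasure c d)) hK hKm hae isOpen_entropyDomain
      (k := fun p β => ω p.1 * ((1 - β * (p.2 : ℂ)) ^ s * Complex.log (g β p.1 p.2))) hcont ?_
    · refine hdiff.congr fun β hβ => ?_
      rw [integral_prod _ (integrable_of_continuousOn_compact hK hKm hae
        (continuousOn_slice hcont hβ))]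
      simp only [integral_const_mul]
    · rintro ⟨u, v⟩ ⟨hu, hv⟩ β hβ
      have hm := one_sub_mem_slitPlane (mul_notMem_cutRay (hcut _ hβ) hv)
      have hlin : DifferentiableWithinAt ℂ (fun β : ℂ => 1 - β * (v : ℂ)) (entropyDomain α) β := by
        fun_prop
      exact (differentiableWithinAt_const _).mul
        ((hlin.cpow_const hm).mul ((hgd u hu v hv β hβ).clog (hgm u hu v hv β hβ)))
  refine DifferentiableOn.sub ((key (continuousOn_weight_mul m1)
      (g := fun β u v => (1 - β * u * v) / (1 - β * v)) ?_ ?_ ?_).const_mul _)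
    ((key (continuousOn_weight_mul m2) (g := fun β u v =>
      1 - (1 - α) / α * (β / (1 - β)) * (1 - (u : ℂ)) * (1 - (v : ℂ))) ?_ ?_ ?_).const_mul _)
  · exact ContinuousOn.div (by fun_prop) (by fun_prop) fun p hp =>
      one_sub_mul_ne_zero (hcut _ hp.2) hp.1.2
  · exact fun u hu v hv β hβ => ratio_mem_slitPlane (hcut β hβ) hu hv
  · exact fun u hu v hv => DifferentiableOn.div (by fun_prop) (by fun_prop) fun β hβ =>
      one_sub_mul_ne_zero (hcut _ hβ) hv
  · have : ContinuousOn (fun p : (ℝ × ℝ) × ℂ => p.2 / (1 - p.2))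
        ((Icc (0 : ℝ) 1 ×ˢ Icc (0 : ℝ) 1) ×ˢ entropyDomain α) :=
      ContinuousOn.div (by fun_prop) (by fun_prop) fun p hp =>
        one_sub_ne_zero_of_mem_doubleSlit hp.2.1
    exact continuousOn_const.sub (((continuousOn_const.mul this).mul (by fun_prop)).mul
      (by fun_prop))
  · exact fun u hu v hv β hβ => one_sub_kappa_mem_slitPlane hβ.2 hu hv
  · intro u hu v hv
    have : DifferentiableOn ℂ (fun β : ℂ => β / (1 - β)) (entropyDomain α) :=
      DifferentiableOn.div (by fun_prop) (by fun_prop) fun p hp =>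
        one_sub_ne_zero_of_mem_doubleSlit hp.1
    exact (((this.const_mul _).mul_const _).mul_const _).const_sub 1

theorem integral_weight_swap (h1 : -1 < ν) (h2 : ν < 0) {ω W : ℝ → ℂ} {k : ℝ → ℝ → ℂ}
    (hω : ContinuousOn ω (Icc 0 1)) (hW : ContinuousOn W (Icc 0 1))
    (hk : ContinuousOn (fun p : ℝ × ℝ => k p.1 p.2) (Icc (0 : ℝ) 1 ×ˢ Icc (0 : ℝ) 1)) :
    ∫ u, ω u * ∫ v, W v * k u v ∂betaMeasure (ν + 1) (-ν) ∂betaMeasure (ν + 1) (-ν)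
      = ∫ v, W v * ∫ u, ω u * k u v ∂betaMeasure (ν + 1) (-ν) ∂betaMeasure (ν + 1) (-ν) := by
  have := isProbabilityMeasure_betaMeasure (a := ν + 1) (b := -ν) (by linarith) (by linarith)
  simp only [← integral_const_mul]
  rw [integral_integral_swap]
  · congr 1; ext v; congr 1; ext u; ring
  · refine integrable_of_continuousOn_compact (K := Icc (0 : ℝ) 1 ×ˢ Icc (0 : ℝ) 1)
      (isCompact_Icc.prod isCompact_Icc) (measurableSet_Icc.prod measurableSet_Icc) ?_ ?_
    · have h3 : ∀ᵐ p ∂((betaMeasure (ν + 1) (-ν)).prod (betaMeasure (ν + 1) (-ν))),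
          p.1 ∈ Icc (0 : ℝ) 1 := Measure.quasiMeasurePreserving_fst.ae ae_betaMeasure_mem_Icc
      have h4 : ∀ᵐ p ∂((betaMeasure (ν + 1) (-ν)).prod (betaMeasure (ν + 1) (-ν))),
          p.2 ∈ Icc (0 : ℝ) 1 := Measure.quasiMeasurePreserving_snd.ae ae_betaMeasure_mem_Icc
      filter_upwards [h3, h4] with p hp hp' using ⟨hp, hp'⟩
    · exact (hω.comp (f := fun p : ℝ × ℝ => p.1) continuousOn_fst fun p hp => hp.1).mul
        ((hW.comp (f := fun p : ℝ × ℝ => p.2) continuousOn_snd fun p hp => hp.2).mul hk)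

theorem log_div_ofReal {x : ℂ} (hx : x ≠ 0) {s : ℝ} (hs : 0 < s) :
    Complex.log (x / s) = Complex.log x - Complex.log s := by
  rw [div_eq_inv_mul, ← Complex.ofReal_inv, Complex.log_ofReal_mul (inv_pos.2 hs) hx,
    Real.log_inv, Complex.ofReal_neg, Complex.ofReal_log hs.le]
  ring

/-- For real `β` the involution of `V` is available, and `1 - β v > 0` allows the logarithm of the
quotient to be split without branch corrections. Fubini then moves the `U` integrals inside and
produces the logarithmic kernels. -/
theorem entropyNumerator_ofReal (h1 : -1 < ν) (h2 : ν < 0) (hα : α ∈ doubleSlit) {β : ℝ}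
    (hβ0 : 0 < β) (hβ : β < cycleRadius α) :
    entropyNumerator ν α β = weightedEuler ν (thirdKindPeriod ν α) β := by
  have := isProbabilityMeasure_betaMeasure (a := ν + 1) (b := -ν) (by linarith) (by linarith)
  obtain ⟨m1, m2⟩ := mem_doubleSlit_iff.1 hα
  have ha := ne_zero_of_mem_doubleSlit hα
  have hβ1 : β < 1 := hβ.trans cycleRadius_lt_one
  have hball : ∀ v ∈ Icc (0 : ℝ) 1, (β : ℂ) * v ∈ Metric.ball (0 : ℂ) (cycleRadius α) :=
    fun v hv => by
      rw [mem_ball_zero_iff, norm_mul, Complex.norm_real, Complex.norm_real,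
        Real.norm_of_nonneg hβ0.le, Real.norm_of_nonneg hv.1]
      nlinarith [hv.1, hv.2]
  have hcut : (β : ℂ) ∉ cutRay := (mem_doubleSlit_iff.1 (ofReal_mem_doubleSlit hβ0 hβ1)).1
  have cW := continuousOn_weight_mul (ν := ν) hcut
  have ii {F : ℝ → ℂ} (hF : ContinuousOn F (Icc 0 1)) : Integrable F (betaMeasure (ν + 1) (-ν)) :=
    integrable_of_continuousOn_Icc ae_betaMeasure_mem_Icc hF
  have hw1 : ∀ u ∈ Icc (0 : ℝ) 1, ‖(u : ℂ)‖ * cycleRadius α ≤ 1 := fun u hu =>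
    norm_firstCycle_mul_le hu
  have hw2 : ∀ u ∈ Icc (0 : ℝ) 1, ‖secondCycle α u‖ * cycleRadius α ≤ 1 := fun u hu =>
    norm_secondCycle_mul_le ha hu
  have hpos : ∀ v ∈ Icc (0 : ℝ) 1, 0 < 1 - β * v := fun v hv => by nlinarith [hv.1, hv.2]
  have hlog {w : ℝ → ℂ} (hw : ∀ u ∈ Icc (0 : ℝ) 1, ‖w u‖ * cycleRadius α ≤ 1) :
      ∀ u ∈ Icc (0 : ℝ) 1, ∀ v ∈ Icc (0 : ℝ) 1,
      Complex.log ((1 - β * v * w u) / (1 - β * v))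
        = Complex.log (1 - β * v * w u) - Complex.log (1 - β * v) := fun u hu v hv => by
    have e : (1 - (β : ℂ) * v) = ((1 - β * v : ℝ) : ℂ) := by push_cast; rfl
    rw [e, log_div_ofReal (one_sub_ne_zero_of_notMem_cutRay
      (mul_notMem_cutRay_of_mem_ball hw (hball v hv) hu)) (hpos v hv)]
  -- Under `v ↦ (1 - v) / (1 - β v)` the second logarithm takes the shape of the first one, with `u`
  -- replaced by the point `secondCycle α u`.
  have inner2 : ∀ u ∈ Icc (0 : ℝ) 1, ∫ v, (1 - β * (v : ℂ)) ^ ((-ν - 1 : ℝ) : ℂ) *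
          Complex.log (1 - (1 - α) / α * (β / (1 - β)) * (1 - (u : ℂ)) * (1 - (v : ℂ)))
          ∂betaMeasure (-ν) (ν + 1)
      = ∫ v, (1 - β * (v : ℂ)) ^ (ν : ℂ) *
          Complex.log ((1 - β * v * secondCycle α u) / (1 - β * v))
          ∂betaMeasure (ν + 1) (-ν) := fun u hu => by
    rw [← integral_betaMeasure_involution h1 h2 hβ1
      (fun v => Complex.log ((1 - β * v * secondCycle α u) / (1 - β * v)))]
    refine integral_congr_ae (ae_betaMeasure_mem_Icc.mono fun v hv => ?_)
    have hne := one_sub_mul_ne_zero hcut hv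
    have hb : (1 - (β : ℂ)) ≠ 0 := one_sub_ne_zero_of_notMem_cutRay hcut
    dsimp only
    congr 2
    have e2 : 1 - (β : ℂ) * (((1 - v) / (1 - β * v) : ℝ) : ℂ) = (1 - β) / (1 - β * v) := by
      push_cast
      rw [eq_div_iff hne, sub_mul, mul_assoc, div_mul_cancel₀ _ hne]; ring
    rw [e2, eq_div_iff (div_ne_zero hb hne), secondCycle]
    push_cast
    field_simp
    ring
  have outer {ω w : ℝ → ℂ} (hω : ContinuousOn ω (Icc 0 1)) (hwc : ContinuousOn w (Icc 0 1))
      (hw : ∀ u ∈ Icc (0 : ℝ) 1, ‖w u‖ * cycleRadius α ≤ 1) :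
      ∫ u, ω u * ∫ v, (1 - β * (v : ℂ)) ^ (ν : ℂ) *
          Complex.log ((1 - β * v * w u) / (1 - β * v))
          ∂betaMeasure (ν + 1) (-ν) ∂betaMeasure (ν + 1) (-ν)
        = (∫ v, (1 - β * (v : ℂ)) ^ (ν : ℂ) * logKernel ν ω w (β * v) ∂betaMeasure (ν + 1) (-ν))
          - (∫ u, ω u ∂betaMeasure (ν + 1) (-ν)) *
            ∫ v, (1 - β * (v : ℂ)) ^ (ν : ℂ) * Complex.log (1 - β * v)
              ∂betaMeasure (ν + 1) (-ν) := by
    have cl := continuousOn_log_kernel hwc hw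
    have cl' : ContinuousOn (fun p : ℝ × ℝ => Complex.log (1 - β * p.2 * w p.1))
        (Icc (0 : ℝ) 1 ×ˢ Icc (0 : ℝ) 1) :=
      cl.comp (f := fun p : ℝ × ℝ => (p.1, (β : ℂ) * p.2)) (by fun_prop)
        fun p hp => ⟨hp.1, hball _ hp.2⟩
    have cl1 : ContinuousOn (fun v : ℝ => Complex.log (1 - β * (v : ℂ))) (Icc 0 1) :=
      ContinuousOn.clog (by fun_prop) fun v hv => one_sub_mem_slitPlane (mul_notMem_cutRay hcut hv)
    have s1 : ∀ v ∈ Icc (0 : ℝ) 1, ∫ u, ω u * Complex.log ((1 - β * v * w u) / (1 - β * v))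
          ∂betaMeasure (ν + 1) (-ν)
        = logKernel ν ω w (β * v)
          - (∫ u, ω u ∂betaMeasure (ν + 1) (-ν)) * Complex.log (1 - β * v) := fun v hv => by
      rw [logKernel, ← integral_mul_const, ← integral_sub]
      · refine integral_congr_ae (ae_betaMeasure_mem_Icc.mono fun u hu => ?_)
        dsimp only
        rw [hlog hw u hu v hv]
        ring
      · exact ii (hω.mul (continuousOn_slice cl (hball v hv)))
      · exact ii (hω.mul continuousOn_const)
    rw [integral_weight_swap h1 h2 (k := fun u v =>
      Complex.log ((1 - β * v * w u) / (1 - β * v))) hω cW, ← integral_const_mul, ← integral_sub]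
    · refine integral_congr_ae (ae_betaMeasure_mem_Icc.mono fun v hv => ?_)
      dsimp only
      rw [s1 v hv]
      ring
    · have hL : ContinuousOn (logKernel ν ω w) (Metric.ball 0 (cycleRadius α)) := fun x hx =>
        (hasDerivAt_logKernel h1 h2 hω hwc hw hx).continuousAt.continuousWithinAt
      exact ii (cW.mul (hL.comp (f := fun v : ℝ => (β : ℂ) * v) (by fun_prop) hball))
    · exact ii (continuousOn_const.mul (cW.mul cl1))
    · refine (cl'.sub (cl1.comp (f := fun p : ℝ × ℝ => p.2) continuousOn_snd
        fun p hp => hp.2)).congr fun p hp => ?_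
      exact hlog hw _ hp.1 _ hp.2
  have o1 := outer (continuousOn_weight_mul (ν := ν) m1) (w := fun u => (u : ℂ))
    Complex.continuous_ofReal.continuousOn hw1
  have o2 := outer (continuousOn_weight_mul (ν := ν) m2) continuousOn_secondCycle hw2
  have t1 : ∫ u, (1 - α * (u : ℂ)) ^ (ν : ℂ) *
        ∫ v, (1 - β * (v : ℂ)) ^ (ν : ℂ) * Complex.log ((1 - β * u * v) / (1 - β * v))
          ∂betaMeasure (ν + 1) (-ν) ∂betaMeasure (ν + 1) (-ν)
      = ∫ u, (1 - α * (u : ℂ)) ^ (ν : ℂ) *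
        ∫ v, (1 - β * (v : ℂ)) ^ (ν : ℂ) * Complex.log ((1 - β * v * u) / (1 - β * v))
          ∂betaMeasure (ν + 1) (-ν) ∂betaMeasure (ν + 1) (-ν) := by
    simp only [mul_right_comm]
  have t2 : ∫ u, (1 - (1 - α) * (u : ℂ)) ^ (ν : ℂ) *
        ∫ v, (1 - β * (v : ℂ)) ^ ((-ν - 1 : ℝ) : ℂ) *
          Complex.log (1 - (1 - α) / α * (β / (1 - β)) * (1 - (u : ℂ)) * (1 - (v : ℂ)))
          ∂betaMeasure (-ν) (ν + 1) ∂betaMeasure (ν + 1) (-ν)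
      = ∫ u, (1 - (1 - α) * (u : ℂ)) ^ (ν : ℂ) * ∫ v, (1 - β * (v : ℂ)) ^ (ν : ℂ) *
          Complex.log ((1 - β * v * secondCycle α u) / (1 - β * v))
          ∂betaMeasure (ν + 1) (-ν) ∂betaMeasure (ν + 1) (-ν) :=
    integral_congr_ae (ae_betaMeasure_mem_Icc.mono fun u hu => by
      dsimp only
      rw [inner2 u hu])
  have f1 : ∫ u, (1 - α * (u : ℂ)) ^ (ν : ℂ) ∂betaMeasure (ν + 1) (-ν) = legendreF ν α := rfl
  have f2 : ∫ u, (1 - (1 - α) * (u : ℂ)) ^ (ν : ℂ) ∂betaMeasure (ν + 1) (-ν)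
    = legendreF ν (1 - α) := rfl
  have hcL {ω w : ℝ → ℂ} (hω : ContinuousOn ω (Icc 0 1)) (hwc : ContinuousOn w (Icc 0 1))
      (hw : ∀ u ∈ Icc (0 : ℝ) 1, ‖w u‖ * cycleRadius α ≤ 1) :
      Integrable (fun v : ℝ => (1 - β * (v : ℂ)) ^ (ν : ℂ) * logKernel ν ω w (β * v))
        (betaMeasure (ν + 1) (-ν)) := by
    have hL : ContinuousOn (logKernel ν ω w) (Metric.ball 0 (cycleRadius α)) := fun x hx =>
      (hasDerivAt_logKernel h1 h2 hω hwc hw hx).continuousAt.continuousWithinAt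
    exact ii (cW.mul (hL.comp (f := fun v : ℝ => (β : ℂ) * v) (by fun_prop) hball))
  rw [entropyNumerator, t1, t2, o1, o2, f1, f2, weightedEuler_apply]
  have split : ∫ v, (1 - β * (v : ℂ)) ^ (ν : ℂ) * thirdKindPeriod ν α (β * v)
        ∂betaMeasure (ν + 1) (-ν)
      = legendreF ν (1 - α) * (∫ v, (1 - β * (v : ℂ)) ^ (ν : ℂ) *
          logKernel ν (fun u => (1 - α * (u : ℂ)) ^ (ν : ℂ)) (fun u => u) (β * v)
          ∂betaMeasure (ν + 1) (-ν))
        - legendreF ν α * ∫ v, (1 - β * (v : ℂ)) ^ (ν : ℂ) *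
          logKernel ν (fun u => (1 - (1 - α) * (u : ℂ)) ^ (ν : ℂ)) (secondCycle α) (β * v)
          ∂betaMeasure (ν + 1) (-ν) := by
    rw [← integral_const_mul, ← integral_const_mul, ← integral_sub]
    · congr 1
      ext v
      rw [thirdKindPeriod]
      ring
    · exact (hcL (continuousOn_weight_mul m1) Complex.continuous_ofReal.continuousOn hw1).const_mul _
    · exact (hcL (continuousOn_weight_mul m2) continuousOn_secondCycle hw2).const_mul _
  -- The terms with `log (1 - β v)` carry the factor `F (1 - α) F α - F α F (1 - α)` and drop out.
  rw [split]
  ring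

end EntropyNumerator

/-! ### The inhomogeneous Legendre equation and its solution by quadratures. -/

section VariationOfConstants

variable {ν : ℝ}

theorem legendreOp_congr {y z : ℂ → ℂ} {t : ℂ} (h : y =ᶠ[𝓝 t] z) :
    legendreOp ν y t = legendreOp ν z t := by
  unfold legendreOp
  rw [h.deriv.deriv_eq, h.deriv_eq, h.eq_of_nhds]

theorem differentiableOn_legendreOp {y : ℂ → ℂ} {U : Set ℂ} (hU : IsOpen U)
    (hy : DifferentiableOn ℂ y U) : DifferentiableOn ℂ (legendreOp ν y) U := by
  have h1 := hy.deriv hU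
  have h2 := h1.deriv hU
  unfold legendreOp
  fun_prop

theorem beta_inv_ne_zero (h1 : -1 < ν) (h2 : ν < 0) :
    -((beta (ν + 1) (-ν) : ℝ) : ℂ)⁻¹ ≠ 0 :=
  neg_ne_zero.2 (inv_ne_zero (beta_add_one_neg_ne_zero h1 h2))

theorem tendsto_ofReal_nhdsGT_zero : Tendsto (fun r : ℝ => (r : ℂ)) (𝓝[>] 0) (𝓝 0) := by
  have := Complex.continuous_ofReal.tendsto (0 : ℝ)
  rw [Complex.ofReal_zero] at this
  exact this.mono_left nhdsWithin_le_nhds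

/-- Variation of constants: a solution of the inhomogeneous Legendre equation that is holomorphic
and vanishes at the origin. -/
theorem exists_variation_of_constants (h1 : -1 < ν) (h2 : ν < 0) {D : Set ℂ} (hD : IsOpen D)
    (hDs : D ⊆ doubleSlit) {y φ : ℂ → ℂ} (hy : DifferentiableOn ℂ y D)
    (hL : ∀ β ∈ D, legendreOp ν y β = -((beta (ν + 1) (-ν) : ℝ) : ℂ)⁻¹ * φ β * legendreF ν β)
    {y₀ : ℂ → ℂ} {ρ : ℝ} (hρ : 0 < ρ) (hy₀ : DifferentiableOn ℂ y₀ (Metric.ball 0 ρ))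
    (hy0 : y₀ 0 = 0) (he : ∀ᶠ r : ℝ in 𝓝[>] 0, y =ᶠ[𝓝 (r : ℂ)] y₀) :
    ∃ A B : ℂ → ℂ, (∀ β ∈ D, HasDerivAt A (φ β * legendreF ν β ^ 2) β) ∧
      (∀ β ∈ D, HasDerivAt B (φ β * (legendreF ν β * legendreF ν (1 - β))) β) ∧
      (∀ β ∈ D, legendreF ν (1 - β) * A β - legendreF ν β * B β = y β) ∧
      Tendsto (fun r : ℝ => A r) (𝓝[>] 0) (𝓝 0) ∧ Tendsto (fun r : ℝ => B r) (𝓝[>] 0) (𝓝 0) := by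
  set c : ℂ := -((beta (ν + 1) (-ν) : ℝ) : ℂ)⁻¹ with hc
  have hc0 : c ≠ 0 := beta_inv_ne_zero h1 h2
  set q : ℂ → ℂ := fun t => legendreF ν (1 - t) with hq
  have hpd := (differentiableOn_legendreF_doubleSlit h1 h2).mono hDs
  have hqd := (differentiableOn_mirror h1 h2).mono hDs
  have hb : Metric.ball (0 : ℂ) ρ ∈ 𝓝 0 := Metric.ball_mem_nhds 0 hρ
  have ly : Tendsto (fun r : ℝ => y₀ r) (𝓝[>] 0) (𝓝 0) := by
    have := (hy₀.differentiableAt hb).continuousAt.tendsto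
    rw [hy0] at this
    exact this.comp tendsto_ofReal_nhdsGT_zero
  have ly' : Tendsto (fun r : ℝ => deriv y₀ r) (𝓝[>] 0) (𝓝 (deriv y₀ 0)) :=
    ((hy₀.deriv Metric.isOpen_ball).differentiableAt hb).continuousAt.tendsto.comp
      tendsto_ofReal_nhdsGT_zero
  have h0 : cutRayᶜ ∈ 𝓝 (0 : ℂ) := isOpen_compl_cutRay.mem_nhds zero_notMem_cutRay
  have lp : Tendsto (fun r : ℝ => legendreF ν r) (𝓝[>] 0) (𝓝 (legendreF ν 0)) :=
    ((differentiableOn_legendreF h1 h2).differentiableAt h0).continuousAt.tendsto.comp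
      tendsto_ofReal_nhdsGT_zero
  have lp' : Tendsto (fun r : ℝ => deriv (legendreF ν) r) (𝓝[>] 0)
      (𝓝 (deriv (legendreF ν) 0)) :=
    (((differentiableOn_legendreF h1 h2).deriv
      isOpen_compl_cutRay).differentiableAt h0).continuousAt.tendsto.comp tendsto_ofReal_nhdsGT_zero
  have lr := tendsto_ofReal_nhdsGT_zero
  -- Lagrange's identity differentiates these two Wronskians to `φ p²` and `φ p q`. Eliminating `y'`
  -- between them gives `q A - p B = y`.
  refine ⟨fun t => legendreWronskian y (legendreF ν) t / c, fun t => legendreWronskian y q t / c,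
    fun β hβ => ?_, fun β hβ => ?_, fun β hβ => ?_, ?_, ?_⟩
  · have := (hasDerivAt_legendreWronskian ν hD hy hpd hβ).div_const c
    convert! this using 1
    rw [hL β hβ, legendreOp_legendreF h1 h2 (mem_doubleSlit_iff.1 (hDs hβ)).1]
    field_simp
    ring
  · have := (hasDerivAt_legendreWronskian ν hD hy hqd hβ).div_const c
    convert! this using 1
    rw [hL β hβ, legendreOp_mirror h1 h2 (hDs hβ)]
    field_simp
    ring
  · have hw := legendreWronskian_mirror h1 h2 (hDs hβ)
    rw [← hc] at hw
    have : y β = y β * c / c := by field_simp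
    rw [this, ← hw]
    simp only [legendreWronskian, hq]
    field_simp
    ring
  · have lim : Tendsto (fun r : ℝ => legendreWronskian y₀ (legendreF ν) r / c) (𝓝[>] 0)
        (𝓝 (0 * (1 - 0) * (deriv y₀ 0 * legendreF ν 0 - deriv (legendreF ν) 0 * 0) / c)) :=
      ((lr.mul (lr.const_sub 1)).mul ((ly'.mul lp).sub (lp'.mul ly))).div_const c
    simp only [zero_mul, zero_div] at lim
    refine lim.congr' (he.mono fun r hr => ?_)
    simp only [legendreWronskian, hr.deriv_eq, hr.eq_of_nhds]
  -- Here `t q'` tends to `c ≠ 0`, so the limit is zero only because `y₀ 0 = 0`.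
  · have lim : Tendsto (fun r : ℝ => legendreWronskian y₀ q r / c) (𝓝[>] 0)
        (𝓝 ((1 - 0) * (deriv y₀ 0 * 0 - c * 0) / c)) := by
      refine Tendsto.congr (fun r => ?_) (((lr.const_sub 1).mul
        ((ly'.mul (tendsto_mul_mirror h1 h2)).sub
          ((tendsto_mul_deriv_mirror h1 h2).mul ly))).div_const c)
      simp only [legendreWronskian, hq]
      ring
    simp only [mul_zero, sub_zero, zero_div] at lim
    refine lim.congr' (he.mono fun r hr => ?_)
    simp only [legendreWronskian, hr.deriv_eq, hr.eq_of_nhds]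

/-- Equality is known on a real interval only; the identity theorem on a small disk about `r`
upgrades it to a neighbourhood, so that derivatives agree too. Working near positive `r` avoids `0`,
which is not in `entropyDomain α`. -/
theorem eventually_entropyNumerator_eventuallyEq (h1 : -1 < ν) (h2 : ν < 0) {α : ℂ} (hα : α ∈ doubleSlit) :
    ∀ᶠ r : ℝ in 𝓝[>] 0, (r : ℂ) ∈ entropyDomain α ∧ (r : ℂ) ∈ Metric.ball 0 (cycleRadius α) ∧
      entropyNumerator ν α =ᶠ[𝓝 (r : ℂ)] weightedEuler ν (thirdKindPeriod ν α) := by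
  obtain ⟨ε, hε, hεr, hεD⟩ := exists_Ioo_subset_entropyDomain (ne_zero_of_mem_doubleSlit hα)
  filter_upwards [Ioo_mem_nhdsGT hε] with r hr
  have hrD := hεD r hr
  have hrB : (r : ℂ) ∈ Metric.ball 0 (cycleRadius α) :=
    (ofReal_mem_slitBall ⟨hr.1, hr.2.trans_le hεr⟩).1
  refine ⟨hrD, hrB, ?_⟩
  obtain ⟨δ, hδ, hδs⟩ := Metric.isOpen_iff.1
    ((isOpen_entropyDomain (α := α)).inter (Metric.isOpen_ball (x := (0 : ℂ)) (ε := cycleRadius α)))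
    r ⟨hrD, hrB⟩
  have hJ : DifferentiableOn ℂ (thirdKindPeriod ν α) (Metric.ball 0 (cycleRadius α)) :=
    fun x hx => (hasDerivAt_thirdKindPeriod h1 h2 hα hx).differentiableAt.differentiableWithinAt
  have hE : DifferentiableOn ℂ (weightedEuler ν (thirdKindPeriod ν α))
      (Metric.ball 0 (cycleRadius α)) :=
    differentiableOn_weightedEuler h1 h2 Metric.isOpen_ball (fun z hz v hv => by
      rw [mem_ball_zero_iff] at hz ⊢
      rw [norm_mul, Complex.norm_real, Real.norm_of_nonneg hv.1]
      exact (mul_le_of_le_one_right (norm_nonneg z) hv.2).trans_lt hz)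
      ((Metric.ball_subset_ball cycleRadius_lt_one.le).trans ball_subset_compl_cutRay) hJ
  have := eqOn_of_eqOn_real_interval (Metric.isOpen_ball (x := (r : ℂ)) (ε := δ))
    (convex_ball _ _).isPreconnected
    ((differentiableOn_entropyNumerator h1 h2 hα).mono (hδs.trans inter_subset_left))
    (hE.mono (hδs.trans inter_subset_right))
    (a := r) (b := min (r + δ) ε) (lt_min (by linarith) hr.2) ?_ ?_
  · exact this.eventuallyEq_of_mem (Metric.ball_mem_nhds _ hδ)
  · intro s hs
    rw [Metric.mem_ball, dist_eq_norm, ← Complex.ofReal_sub, Complex.norm_real,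
      Real.norm_of_nonneg (by linarith [hs.1])]
    linarith [hs.2.trans_le (min_le_left _ _)]
  · intro s hs
    exact entropyNumerator_ofReal h1 h2 hα (hr.1.trans hs.1)
      ((hs.2.trans_le (min_le_right _ _)).trans_le hεr)

/-- Both sides are holomorphic on the connected domain and agree for small positive `β`, where the
Euler transform of the third-kind periods is available. -/
theorem legendreOp_entropyNumerator (h1 : -1 < ν) (h2 : ν < 0) {α : ℂ} (hα : α ∈ doubleSlit)
    {β : ℂ} (hβ : β ∈ entropyDomain α) :
    (β - α) * legendreOp ν (entropyNumerator ν α) β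
      = -((beta (ν + 1) (-ν) : ℝ) : ℂ)⁻¹ * legendreF ν β := by
  obtain ⟨ε, hε, hεs⟩ := mem_nhdsGT_iff_exists_Ioo_subset.1
    (eventually_entropyNumerator_eventuallyEq h1 h2 hα)
  refine eqOn_of_eqOn_real_interval isOpen_entropyDomain isPreconnected_entropyDomain
    (f := fun β => (β - α) * legendreOp ν (entropyNumerator ν α) β)
    (g := fun β => -((beta (ν + 1) (-ν) : ℝ) : ℂ)⁻¹ * legendreF ν β) ?_ ?_ hε
    (fun r hr => (hεs hr).1) (fun r hr => ?_) hβ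
  · exact (DifferentiableOn.sub_const differentiableOn_id α).mul
      (differentiableOn_legendreOp isOpen_entropyDomain
        (differentiableOn_entropyNumerator h1 h2 hα))
  · exact ((differentiableOn_legendreF_doubleSlit h1 h2).mono fun _ h => h.1).const_mul _
  · obtain ⟨-, hrB, hre⟩ := hεs hr
    rw [legendreOp_congr hre, legendreOp_weightedEuler_thirdKind h1 h2 hα hrB]

theorem exists_entropy_primitives (h1 : -1 < ν) (h2 : ν < 0) {α : ℂ} (hα : α ∈ doubleSlit) :
    ∃ A B : ℂ → ℂ,
      (∀ β ∈ entropyDomain α, HasDerivAt A (legendreF ν β ^ 2 / (β - α)) β) ∧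
      (∀ β ∈ entropyDomain α,
        HasDerivAt B (legendreF ν β * legendreF ν (1 - β) / (β - α)) β) ∧
      (∀ β ∈ entropyDomain α,
        legendreF ν (1 - β) * A β - legendreF ν β * B β = entropyNumerator ν α β) ∧
      Tendsto (fun r : ℝ => A r) (𝓝[>] 0) (𝓝 0) ∧ Tendsto (fun r : ℝ => B r) (𝓝[>] 0) (𝓝 0) := by
  have ha := ne_zero_of_mem_doubleSlit hα
  have hJ : DifferentiableOn ℂ (thirdKindPeriod ν α) (Metric.ball 0 (cycleRadius α)) :=
    fun x hx => (hasDerivAt_thirdKindPeriod h1 h2 hα hx).differentiableAt.differentiableWithinAt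
  have hE : DifferentiableOn ℂ (weightedEuler ν (thirdKindPeriod ν α))
      (Metric.ball 0 (cycleRadius α)) :=
    differentiableOn_weightedEuler h1 h2 Metric.isOpen_ball (fun z hz v hv => by
      rw [mem_ball_zero_iff] at hz ⊢
      rw [norm_mul, Complex.norm_real, Real.norm_of_nonneg hv.1]
      exact (mul_le_of_le_one_right (norm_nonneg z) hv.2).trans_lt hz)
      ((Metric.ball_subset_ball cycleRadius_lt_one.le).trans ball_subset_compl_cutRay) hJ
  have hE0 : weightedEuler ν (thirdKindPeriod ν α) 0 = 0 := by
    simp [weightedEuler_apply, thirdKindPeriod, logKernel]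
  have hL : ∀ β ∈ entropyDomain α, legendreOp ν (entropyNumerator ν α) β
      = -((beta (ν + 1) (-ν) : ℝ) : ℂ)⁻¹ * (β - α)⁻¹ * legendreF ν β := fun β hβ => by
    have hne : β - α ≠ 0 := sub_ne_zero.2 (ne_of_mem_entropyDomain hα hβ)
    have := legendreOp_entropyNumerator h1 h2 hα hβ
    rw [mul_assoc, mul_left_comm, ← this, inv_mul_cancel_left₀ hne]
  obtain ⟨A, B, hA, hB, hAB, lA, lB⟩ := exists_variation_of_constants (φ := fun β => (β - α)⁻¹)
    h1 h2 (isOpen_entropyDomain (α := α)) (fun _ h => h.1)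
    (differentiableOn_entropyNumerator h1 h2 hα) hL (cycleRadius_pos ha) hE hE0
    ((eventually_entropyNumerator_eventuallyEq h1 h2 hα).mono fun r hr => hr.2.2)
  refine ⟨A, B, fun β hβ => ?_, fun β hβ => ?_, hAB, lA, lB⟩
  · convert! hA β hβ using 1; ring
  · convert! hB β hβ using 1; ring

end VariationOfConstants

/-! ### Path dependence measured by residues. -/

section Periods

/-- A primitive of `f / (t - α)` is multivalued with periods `2πi f α`. Dividing by `f α` and
exponentiating makes it single-valued on the punctured domain, which need not be simply connected.
-/
theorem exists_exp_primitive {U : Set ℂ} (hU : IsOpen U) {c α : ℂ} (hs : StarConvex ℝ c U)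
    {f : ℂ → ℂ} (hf : DifferentiableOn ℂ f U) (hα : α ∈ U) (h0 : f α ≠ 0) :
    ∃ X : ℂ → ℂ, (∀ t ∈ U \ {α}, X t ≠ 0) ∧
      ∀ t ∈ U \ {α}, HasDerivAt X (X t * (f t / (t - α)) / f α) t := by
  obtain ⟨G, hG⟩ := exists_primitive_of_starConvex hU hs
    ((Complex.differentiableOn_dslope (hU.mem_nhds hα)).2 hf)
  -- `G` integrates the regular part `(f t - f α) / (t - α)`; the polar part contributes the factor
  -- `t - α`.
  refine ⟨fun t => Complex.exp (G t / f α) * (t - α), fun t ht => ?_, fun t ht => ?_⟩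
  · exact mul_ne_zero (Complex.exp_ne_zero _) (sub_ne_zero.2 ht.2)
  · have hne : t - α ≠ 0 := sub_ne_zero.2 ht.2
    have := (((hG t ht.1).div_const (f α)).cexp).mul ((hasDerivAt_id t).sub_const α)
    convert! this using 1
    have hd := sub_smul_dslope f α t
    rw [smul_eq_mul] at hd
    have hd' : f t = f α + (t - α) * dslope f α t := by rw [hd]; ring
    rw [hd']
    simp only [id]
    field_simp
    ring

/-- Path integrals of `f`, compared with a primitive of `f` on a smaller domain. -/
theorem exists_int_pathIntegral_sub_eq {γ : ℝ → ℂ} {β r C : ℂ} (h : IsPiecewiseC1Path γ 0 β)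
    {f X A : ℂ → ℂ} {Ω D : Set ℂ} (hr : r ≠ 0)
    (hX : ∀ t ∈ Ω, HasDerivAt X (X t * f t / r) t) (hX0 : ∀ t ∈ Ω, X t ≠ 0)
    (hf : ∀ t ∈ Ω, ContinuousAt f t) (hγ : ∀ s ∈ Ioc (0 : ℝ) 1, γ s ∈ Ω)
    (hint : IntervalIntegrable (pullback f γ) volume 0 1)
    (hC : C ≠ 0) (hlim : Tendsto X (𝓝[Ω] 0) (𝓝 C))
    (hD : IsOpen D) (hDc : IsPreconnected D) (hDΩ : D ⊆ Ω) (hβ : β ∈ D)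
    (hD0 : ∀ᶠ s : ℝ in 𝓝[>] 0, (s : ℂ) ∈ D)
    (hA : ∀ t ∈ D, HasDerivAt A (f t) t) (hA0 : Tendsto (fun s : ℝ => A s) (𝓝[>] 0) (𝓝 0)) :
    ∃ n : ℤ, pathIntegral f γ - A β = 2 * π * Complex.I * n * r := by
  have hγ0 : Tendsto γ (𝓝[>] 0) (𝓝[Ω] 0) := by
    refine tendsto_nhdsWithin_iff.2 ⟨?_, ?_⟩
    · have := h.continuousOn 0 ⟨le_rfl, zero_le_one⟩
      rw [ContinuousWithinAt, h.1] at this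
      refine this.mono_left ?_
      rw [← nhdsWithin_Ioc_eq_nhdsGT (zero_lt_one' ℝ)]
      exact nhdsWithin_mono _ Ioc_subset_Icc_self
    · filter_upwards [Ioo_mem_nhdsGT (zero_lt_one' ℝ)] with s hs
      exact hγ s (Ioo_subset_Ioc_self hs)
  -- The path gives `X β = C exp (∫ f / r)`, while `exp (A / r) / X` is constant on `D`, equal to `1
  -- / C` by its limit at `0`. The two exponentials therefore agree at `β`.
  have e1 := h.exp_pathIntegral hX hf hγ hint (hlim.comp hγ0)
  have hd : ∀ t ∈ D, HasDerivAt (fun t => Complex.exp (A t / r) / X t) 0 t := fun t ht => by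
    have hx := hX0 t (hDΩ ht)
    have := (((hA t ht).div_const r).cexp).div (hX t (hDΩ ht)) hx
    convert! this using 1
    field_simp
    ring
  obtain ⟨k, hk⟩ := hD.exists_is_const_of_deriv_eq_zero hDc
    (fun t ht => (hd t ht).differentiableAt.differentiableWithinAt) (fun t ht => (hd t ht).deriv)
  have hreal : Tendsto (fun s : ℝ => (s : ℂ)) (𝓝[>] 0) (𝓝[Ω] 0) :=
    tendsto_nhdsWithin_iff.2 ⟨tendsto_ofReal_nhdsGT_zero, hD0.mono fun s hs => hDΩ hs⟩
  have l1 : Tendsto (fun s : ℝ => Complex.exp (A s / r) / X s) (𝓝[>] 0)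
      (𝓝 (Complex.exp (0 / r) / C)) :=
    ((hA0.div_const r).cexp).div (hlim.comp hreal) hC
  have l2 : Tendsto (fun s : ℝ => Complex.exp (A s / r) / X s) (𝓝[>] 0) (𝓝 k) :=
    tendsto_const_nhds.congr' (hD0.mono fun s hs => (hk _ hs).symm)
  have hkC := tendsto_nhds_unique l2 l1
  rw [zero_div, Complex.exp_zero] at hkC
  have e2 := hk β hβ
  rw [hkC, div_eq_div_iff (hX0 β (hDΩ hβ)) hC, one_mul, e1, mul_comm,
    mul_right_inj' hC] at e2
  obtain ⟨n, hn⟩ := Complex.exp_eq_exp_iff_exists_int.1 e2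
  refine ⟨-n, ?_⟩
  field_simp at hn
  push_cast
  rw [hn]
  ring

end Periods

/-! ### Integrability along paths and the congruence of part (a). -/

section Congruence

variable {ν : ℝ}

theorem continuousAt_legendreF (h1 : -1 < ν) (h2 : ν < 0) {t : ℂ} (ht : t ∉ cutRay) :
    ContinuousAt (legendreF ν) t :=
  ((differentiableOn_legendreF h1 h2).differentiableAt
    (isOpen_compl_cutRay.mem_nhds ht)).continuousAt

theorem continuousAt_mirror (h1 : -1 < ν) (h2 : ν < 0) {t : ℂ} (ht : t ∈ doubleSlit) :
    ContinuousAt (fun t => legendreF ν (1 - t)) t :=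
  ((differentiableOn_mirror h1 h2).differentiableAt (isOpen_doubleSlit.mem_nhds ht)).continuousAt

theorem intervalIntegrable_sq (h1 : -1 < ν) (h2 : ν < 0) {γ : ℝ → ℂ} {α β : ℂ}
    (h : IsPiecewiseC1Path γ 0 β) (hγ : ∀ s ∈ Icc (0 : ℝ) 1, γ s ∉ cutRay ∧ γ s ≠ α) :
    IntervalIntegrable (pullback (fun t => legendreF ν t ^ 2 / (t - α)) γ) volume 0 1 := by
  refine h.intervalIntegrable_of_continuousOn (Ω := {t | t ∉ cutRay ∧ t ≠ α}) (fun t ht => ?_) hγ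
  refine ContinuousAt.continuousWithinAt ?_
  exact ((continuousAt_legendreF h1 h2 ht.1).pow 2).div (by fun_prop) (sub_ne_zero.2 ht.2)

theorem exists_lower_bound_of_derivWithin_ne_zero {γ : ℝ → ℂ} {β : ℂ}
    (h : IsPiecewiseC1Path γ 0 β) (hd : derivWithin γ (Ici 0) 0 ≠ 0) :
    ∃ m > 0, ∀ᶠ s in 𝓝[>] (0 : ℝ), m * s ≤ ‖γ s‖ := by
  have h0 := (hasDerivWithinAt_iff_tendsto_slope' self_notMem_Ioi).1
    (h.hasDerivWithinAt_zero.mono Ioi_subset_Ici_self)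
  have hpos := norm_pos_iff.2 hd
  refine ⟨‖derivWithin γ (Ici 0) 0‖ / 2, half_pos hpos, ?_⟩
  have := h0.norm.eventually (lt_mem_nhds (half_lt_self hpos))
  filter_upwards [this, self_mem_nhdsWithin] with s hs hs0
  rw [slope_def_module, h.1, sub_zero, sub_zero, norm_smul, norm_inv, Real.norm_of_nonneg
    (le_of_lt hs0), inv_mul_eq_div, lt_div_iff₀ hs0] at hs
  exact hs.le

/-- Non-zero initial velocity gives `‖γ s‖ ≥ m s` near `0`, so the logarithmic singularity is
dominated by `1 + |log s|`, which is integrable. Away from `0` the integrand is continuous apart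
from the derivative of the path. -/
theorem intervalIntegrable_mir (h1 : -1 < ν) (h2 : ν < 0) {φ : ℂ → ℂ} {Ω : Set ℂ}
    (hφ : ∀ t ∈ Ω, ContinuousAt φ t) (hφ0 : ContinuousAt φ 0) (hΩ : Ω ⊆ doubleSlit) {γ : ℝ → ℂ}
    {β : ℂ} (h : IsPiecewiseC1Path γ 0 β) (hγ : ∀ s ∈ Ioc (0 : ℝ) 1, γ s ∈ Ω)
    (hd : derivWithin γ (Ici 0) 0 ≠ 0) :
    IntervalIntegrable (pullback (fun t => φ t * (legendreF ν t * legendreF ν (1 - t))) γ)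
      volume 0 1 := by
  refine h.intervalIntegrable_pullback ?_
  have hc : ContinuousOn (fun s => φ (γ s) * (legendreF ν (γ s) * legendreF ν (1 - γ s)))
      (Ioc 0 1) := fun s hs => by
    have hm := hΩ (hγ s hs)
    have hcont : ContinuousAt (fun t => φ t * (legendreF ν t * legendreF ν (1 - t))) (γ s) :=
      (hφ _ (hγ s hs)).mul
        ((continuousAt_legendreF h1 h2 (mem_doubleSlit_iff.1 hm).1).mul
          (continuousAt_mirror h1 h2 hm))
    exact hcont.comp_continuousWithinAt
      ((h.continuousOn s (Ioc_subset_Icc_self hs)).mono Ioc_subset_Icc_self)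
  obtain ⟨m, hm, hlow⟩ := exists_lower_bound_of_derivWithin_ne_zero h hd
  obtain ⟨C, hC0, hC⟩ := exists_bound_mirror h1 h2
  have hγ0 : Tendsto γ (𝓝[>] 0) (𝓝 0) := by
    have := h.continuousOn 0 ⟨le_rfl, zero_le_one⟩
    rw [ContinuousWithinAt, h.1] at this
    refine this.mono_left ?_
    rw [← nhdsWithin_Ioc_eq_nhdsGT (zero_lt_one' ℝ)]
    exact nhdsWithin_mono _ Ioc_subset_Icc_self
  set M : ℝ := ‖φ 0 * legendreF ν 0‖ + 1 with hM
  have hbd : ∀ᶠ s in 𝓝[>] (0 : ℝ), ‖φ (γ s) * legendreF ν (γ s)‖ < M :=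
    (((hφ0.mul (continuousAt_legendreF h1 h2 zero_notMem_cutRay)).tendsto.comp hγ0).norm).eventually
      (gt_mem_nhds (lt_add_one _))
  have hsmall : ∀ᶠ s in 𝓝[>] (0 : ℝ), ‖γ s‖ < 1 / 2 := by
    have := hγ0.norm
    rw [norm_zero] at this
    exact this.eventually (gt_mem_nhds (by norm_num))
  have hev : ∀ᶠ s in 𝓝[>] (0 : ℝ),
      ‖φ (γ s) * (legendreF ν (γ s) * legendreF ν (1 - γ s))‖
        ≤ M * (C * (1 + |Real.log m| + |Real.log s|)) := by
    filter_upwards [hlow, hbd, hsmall, Ioo_mem_nhdsGT (zero_lt_one' ℝ)] with s hs1 hs2 hs3 hs4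
    have hmem := hΩ (hγ s (Ioo_subset_Ioc_self hs4))
    have hq := hC (γ s) ⟨by rwa [mem_ball_zero_iff], mem_slitPlane_of_mem_doubleSlit hmem⟩
    have hms : 0 < m * s := mul_pos hm hs4.1
    -- Since `‖γ s‖ < 1 / 2`, the logarithm is non-positive and only the lower bound `m * s`
    -- matters.
    have hlog : |Real.log ‖γ s‖| ≤ |Real.log m| + |Real.log s| := by
      have hneg : Real.log ‖γ s‖ ≤ 0 := Real.log_nonpos (norm_nonneg _) (by linarith)
      have hge : Real.log (m * s) ≤ Real.log ‖γ s‖ := Real.log_le_log hms hs1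
      rw [abs_of_nonpos hneg]
      rw [Real.log_mul hm.ne' hs4.1.ne'] at hge
      linarith [neg_abs_le (Real.log m), neg_abs_le (Real.log s)]
    rw [← mul_assoc, norm_mul]
    refine mul_le_mul hs2.le (hq.trans ?_) (norm_nonneg _) (by positivity)
    exact mul_le_mul_of_nonneg_left (by linarith) hC0
  obtain ⟨δ, hδ, hδs⟩ := mem_nhdsGT_iff_exists_Ioo_subset.1 hev
  set η : ℝ := min (δ / 2) 1 with hη
  have hη0 : 0 < η := lt_min (half_pos hδ) one_pos
  have hη1 : η ≤ 1 := min_le_right _ _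
  have hηδ : η < δ := (min_le_left _ _).trans_lt (half_lt_self hδ)
  rw [← Ioc_union_Ioc_eq_Ioc hη0.le hη1]
  refine IntegrableOn.union ?_ ?_
  · have hlogint : IntegrableOn (fun s => M * (C * (1 + |Real.log m| + |Real.log s|)))
        (Ioc 0 η) := by
      rw [← intervalIntegrable_iff_integrableOn_Ioc_of_le hη0.le]
      exact ((intervalIntegrable_const.add
        (intervalIntegral.intervalIntegrable_log' (a := 0) (b := η)).abs).const_mul C).const_mul M
    refine Integrable.mono' hlogint ((hc.mono
      (Ioc_subset_Ioc_right hη1)).aestronglyMeasurable measurableSet_Ioc) ?_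
    refine (ae_restrict_iff' measurableSet_Ioc).2 (Eventually.of_forall fun s hs => ?_)
    exact hδs ⟨hs.1, hs.2.trans_lt hηδ⟩
  · refine ContinuousOn.integrableOn_Icc (hc.mono ?_) |>.mono_set Ioc_subset_Icc_self
    exact fun s hs => ⟨hη0.trans_le hs.1, hs.2⟩

/-- The integrand is meromorphic on the cut plane, with residue `F α ^ 2` at its only possible pole
`α`; the origin is a regular point of `X`. -/
theorem exists_int_sq (h1 : -1 < ν) (h2 : ν < 0) {α β : ℂ} (hα : α ∈ doubleSlit)
    (hβ : β ∈ entropyDomain α) {A : ℂ → ℂ}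
    (hA : ∀ β ∈ entropyDomain α, HasDerivAt A (legendreF ν β ^ 2 / (β - α)) β)
    (hA0 : Tendsto (fun s : ℝ => A s) (𝓝[>] 0) (𝓝 0)) {γ : ℝ → ℂ}
    (h : IsPiecewiseC1Path γ 0 β) (hγ : ∀ s ∈ Icc (0 : ℝ) 1, γ s ∉ cutRay ∧ γ s ≠ α) :
    ∃ n : ℤ, pathIntegral (fun t => legendreF ν t ^ 2 / (t - α)) γ - A β
      = 2 * π * Complex.I * n * legendreF ν α ^ 2 := by
  have hα' := (mem_doubleSlit_iff.1 hα).1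
  have ha := ne_zero_of_mem_doubleSlit hα
  have hr : legendreF ν α ^ 2 ≠ 0 := pow_ne_zero 2 (legendreF_ne_zero h1 h2 hα')
  obtain ⟨X, hX0, hX⟩ := exists_exp_primitive isOpen_compl_cutRay starConvex_compl_cutRay
    (f := fun t => legendreF ν t ^ 2) ((differentiableOn_legendreF h1 h2).pow 2) hα' hr
  obtain ⟨ε, hε, -, hεD⟩ := exists_Ioo_subset_entropyDomain ha
  have h0 : (0 : ℂ) ∈ cutRayᶜ \ {α} := ⟨zero_notMem_cutRay, fun h => ha h.symm⟩
  refine exists_int_pathIntegral_sub_eq h hr hX hX0 (fun t ht => ?_)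
    (fun s hs => hγ s (Ioc_subset_Icc_self hs)) (intervalIntegrable_sq h1 h2 h hγ) (hX0 0 h0)
    ((hX 0 h0).continuousAt.tendsto.mono_left nhdsWithin_le_nhds) isOpen_entropyDomain
    isPreconnected_entropyDomain (fun t ht => ⟨(mem_doubleSlit_iff.1 ht.1).1,
      ne_of_mem_entropyDomain hα ht⟩) hβ ?_ hA hA0
  · exact ((continuousAt_legendreF h1 h2 ht.1).pow 2).div (by fun_prop) (sub_ne_zero.2 ht.2)
  · filter_upwards [Ioo_mem_nhdsGT hε] with s hs using hεD s hs

/-- The origin is now a boundary point of the domain, and a path may approach it from any direction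
in the slit disk. The limit of `X` there comes from the local primitive `Q`, which tends to `0` in a
full neighbourhood: `X` is a constant multiple of `exp (Q / r)` on the slit disk, with `r = F α * F
(1 - α)`. -/
theorem exists_int_mir (h1 : -1 < ν) (h2 : ν < 0) {α β : ℂ} (hα : α ∈ doubleSlit)
    (hβ : β ∈ entropyDomain α) {B : ℂ → ℂ}
    (hB : ∀ β ∈ entropyDomain α,
      HasDerivAt B (legendreF ν β * legendreF ν (1 - β) / (β - α)) β)
    (hB0 : Tendsto (fun s : ℝ => B s) (𝓝[>] 0) (𝓝 0)) {γ : ℝ → ℂ}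
    (h : IsPiecewiseC1Path γ 0 β) (hγ : ∀ s ∈ Ioc (0 : ℝ) 1, γ s ∈ doubleSlit ∧ γ s ≠ α)
    (hint : IntervalIntegrable
      (pullback (fun t => legendreF ν t * legendreF ν (1 - t) / (t - α)) γ) volume 0 1) :
    ∃ n : ℤ, pathIntegral (fun t => legendreF ν t * legendreF ν (1 - t) / (t - α)) γ - B β
      = 2 * π * Complex.I * n * (legendreF ν α * legendreF ν (1 - α)) := by
  obtain ⟨m1, m2⟩ := mem_doubleSlit_iff.1 hα
  have ha := ne_zero_of_mem_doubleSlit hα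
  have hr : legendreF ν α * legendreF ν (1 - α) ≠ 0 :=
    mul_ne_zero (legendreF_ne_zero h1 h2 m1) (legendreF_ne_zero h1 h2 m2)
  obtain ⟨X, hX0, hX⟩ := exists_exp_primitive isOpen_doubleSlit starConvex_doubleSlit
    (f := fun t => legendreF ν t * legendreF ν (1 - t))
    ((differentiableOn_legendreF_doubleSlit h1 h2).mul (differentiableOn_mirror h1 h2)) hα hr
  obtain ⟨ε, hε, -, hεD⟩ := exists_Ioo_subset_entropyDomain ha
  set ρ : ℝ := min 1 ‖α‖ with hρ
  have hρ0 : 0 < ρ := lt_min one_pos (norm_pos_iff.2 ha)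
  have hne : ∀ t ∈ Metric.ball (0 : ℂ) ρ, t ≠ α := by
    rintro t ht rfl
    exact absurd (mem_ball_zero_iff.1 ht) (not_lt.2 (min_le_right _ _))
  obtain ⟨Q, hQ, hQ0⟩ := exists_local_primitive h1 h2 hρ0 (min_le_left _ _)
    (φ := fun t => (t - α)⁻¹) (DifferentiableOn.inv (by fun_prop)
      fun t ht => sub_ne_zero.2 (hne t ht))
  have hsub : ∀ t ∈ slitBall ρ, t ∈ doubleSlit \ {α} := fun t ht =>
    ⟨slitBall_subset_doubleSlit (min_le_left _ _) ht, hne t ht.1⟩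
  have hd : ∀ t ∈ slitBall ρ, HasDerivAt (fun t => X t *
      Complex.exp (-(Q t / (legendreF ν α * legendreF ν (1 - α))))) 0 t := fun t ht => by
    have := (hX t (hsub t ht)).mul
      ((((hQ t ht).div_const (legendreF ν α * legendreF ν (1 - α))).neg).cexp)
    convert! this using 1
    ring
  obtain ⟨k, hk⟩ := (isOpen_slitBall ρ).exists_is_const_of_deriv_eq_zero
    (isPreconnected_slitBall hρ0)
    (fun t ht => (hd t ht).differentiableAt.differentiableWithinAt) (fun t ht => (hd t ht).deriv)
  have hk0 : k ≠ 0 := by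
    have hm := ofReal_mem_slitBall (r := ρ) (s := ρ / 2) ⟨by linarith, by linarith⟩
    rw [← hk _ hm]
    exact mul_ne_zero (hX0 _ (hsub _ hm)) (Complex.exp_ne_zero _)
  have hlim : Tendsto X (𝓝[doubleSlit \ {α}] 0) (𝓝 k) := by
    have l : Tendsto (fun t => k * Complex.exp (Q t / (legendreF ν α * legendreF ν (1 - α))))
        (𝓝 0) (𝓝 (k * Complex.exp (0 / (legendreF ν α * legendreF ν (1 - α))))) :=
      ((hQ0.div_const _).cexp).const_mul k
    rw [zero_div, Complex.exp_zero, mul_one] at l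
    refine (l.mono_left nhdsWithin_le_nhds).congr' ?_
    filter_upwards [self_mem_nhdsWithin, nhdsWithin_le_nhds (Metric.ball_mem_nhds 0 hρ0)]
      with t ht htb
    rw [← hk t ⟨htb, mem_slitPlane_of_mem_doubleSlit ht.1⟩, mul_assoc, ← Complex.exp_add]
    simp
  refine exists_int_pathIntegral_sub_eq h hr hX hX0 (fun t ht => ?_) hγ hint hk0 hlim
    isOpen_entropyDomain isPreconnected_entropyDomain
    (fun t ht => ⟨ht.1, ne_of_mem_entropyDomain hα ht⟩) hβ ?_ hB hB0
  · exact ((continuousAt_legendreF h1 h2 (mem_doubleSlit_iff.1 ht.1).1).mul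
      (continuousAt_mirror h1 h2 ht.1)).div (by fun_prop) (sub_ne_zero.2 ht.2)
  · filter_upwards [Ioo_mem_nhdsGT hε] with s hs using hεD s hs

theorem legendreSq_eq (h1 : -1 < ν) (h2 : ν < 0) :
    legendreSq ν = fun t => legendreF ν t ^ 2 := by
  ext t
  rw [legendreSq, legendreP_one_sub h1 h2]

theorem legendreMir_eq (h1 : -1 < ν) (h2 : ν < 0) :
    legendreMir ν = fun t => legendreF ν t * legendreF ν (1 - t) := by
  ext t
  rw [legendreMir, legendreP_one_sub h1 h2, legendreP_sub_one h1 h2]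

theorem kontsevichZagier_congruence (h1 : -1 < ν) (h2 : ν < 0) {α β : ℂ} (hα : α ∈ doubleSlit)
    (hβ : β ∈ entropyDomain α) {γ₁ γ₂ : ℝ → ℂ} (hp₁ : IsPiecewiseC1Path γ₁ 0 β)
    (hγ₁ : ∀ s ∈ Icc (0 : ℝ) 1, γ₁ s ∉ cutRay ∧ γ₁ s ≠ α) (hp₂ : IsPiecewiseC1Path γ₂ 0 β)
    (hγ₂ : ∀ s ∈ Ioc (0 : ℝ) 1, γ₂ s ∈ doubleSlit ∧ γ₂ s ≠ α) :
    IntervalIntegrable (pullback (fun t => legendreSq ν t / (t - α)) γ₁) volume 0 1 ∧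
    (derivWithin γ₂ (Ici 0) 0 ≠ 0 →
      IntervalIntegrable (pullback (fun t => legendreMir ν t / (t - α)) γ₂) volume 0 1) ∧
    (IntervalIntegrable (pullback (fun t => legendreMir ν t / (t - α)) γ₂) volume 0 1 →
      ∃ p ∈ periodLattice ν α β,
        (legendreP ν (2 * β - 1) ^ 2 * pathIntegral (fun t => legendreSq ν t / (t - α)) γ₁
          - legendreP ν (1 - 2 * β) * legendreP ν (2 * β - 1)
            * pathIntegral (fun t => legendreMir ν t / (t - α)) γ₂)
        - legendreP ν (1 - 2 * α) * legendreP ν (2 * α - 1)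
            * legendreP ν (1 - 2 * β) * legendreP ν (2 * β - 1) * entropyH ν α β
        = 2 * π * Complex.I * p) := by
  have ha := ne_zero_of_mem_doubleSlit hα
  simp only [legendreSq_eq h1 h2, legendreMir_eq h1 h2]
  refine ⟨intervalIntegrable_sq h1 h2 hp₁ hγ₁, fun hd => ?_, fun hint => ?_⟩
  · have := intervalIntegrable_mir h1 h2 (φ := fun t => (t - α)⁻¹)
      (Ω := {t | t ∈ doubleSlit ∧ t ≠ α})
      (fun t ht => ContinuousAt.inv₀ (by fun_prop) (sub_ne_zero.2 ht.2))
      (ContinuousAt.inv₀ (by fun_prop) (sub_ne_zero.2 ha.symm)) (fun t ht => ht.1) hp₂ hγ₂ hd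
    simpa only [inv_mul_eq_div] using this
  · obtain ⟨A, B, hA, hB, hAB, hA0, hB0⟩ := exists_entropy_primitives h1 h2 hα
    obtain ⟨n₁, hn₁⟩ := exists_int_sq h1 h2 hα hβ hA hA0 hp₁ hγ₁
    obtain ⟨n₂, hn₂⟩ := exists_int_mir h1 h2 hα hβ hB hB0 hp₂ hγ₂ hint
    have hy := hAB β hβ
    rw [entropyNumerator_eq h1 h2 hα (mem_doubleSlit_iff.1 hβ.1).1] at hy
    -- The two integrals contribute the first two generators of the lattice; the third generator is
    -- not needed. The relation `q A - p B = y` is multiplied by `F (1 - β)`.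
    refine ⟨_, ⟨n₁, -n₂, 0, rfl⟩, ?_⟩
    simp only [legendreP_one_sub h1 h2, legendreP_sub_one h1 h2]
    push_cast
    linear_combination legendreF ν (1 - β) ^ 2 * hn₁
      - legendreF ν β * legendreF ν (1 - β) * hn₂ + legendreF ν (1 - β) * hy

end Congruence

/-! ### The logarithmic moment behind part (b). -/

section LogarithmicMoment

/-- The slope of `log (1 - z)` at the origin. -/
noncomputable def logSlope : ℂ → ℂ := dslope (fun z => Complex.log (1 - z)) 0

theorem mul_logSlope (z : ℂ) : z * logSlope z = Complex.log (1 - z) := by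
  have := sub_smul_dslope (fun z : ℂ => Complex.log (1 - z)) 0 z
  simpa [logSlope] using this

theorem hasDerivAt_log_one_sub {z : ℂ} (hz : z ∉ cutRay) :
    HasDerivAt (fun z => Complex.log (1 - z)) (-(1 - z)⁻¹) z := by
  have := ((hasDerivAt_id z).const_sub 1).clog (one_sub_mem_slitPlane hz)
  convert! this using 1
  simp only [id]
  ring

theorem logSlope_zero : logSlope 0 = -1 := by
  rw [logSlope, dslope_same, (hasDerivAt_log_one_sub zero_notMem_cutRay).deriv]
  simp

theorem differentiableOn_logSlope : DifferentiableOn ℂ logSlope cutRayᶜ :=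
  (Complex.differentiableOn_dslope (isOpen_compl_cutRay.mem_nhds zero_notMem_cutRay)).2
    fun _ hz => (hasDerivAt_log_one_sub hz).differentiableAt.differentiableWithinAt

theorem hasDerivAt_mul_logSlope {u : ℝ} (hu : u ∈ Icc (0 : ℝ) 1) {z : ℂ} (hz : z ∉ cutRay) :
    HasDerivAt (fun x => x * logSlope (x * u)) (-(1 - z * u)⁻¹) z := by
  rcases eq_or_ne u 0 with rfl | h
  · convert! (hasDerivAt_id z).neg using 1
    · ext x; simp [logSlope_zero]
    · simp
  · have hu0 : (u : ℂ) ≠ 0 := Complex.ofReal_ne_zero.2 h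
    have e : (fun x => x * logSlope (x * u)) = fun x => Complex.log (1 - x * u) / u := by
      ext x
      rw [← mul_logSlope]
      field_simp
    have := (((hasDerivAt_id z).mul_const (u : ℂ)).const_sub 1).clog
      (one_sub_mem_slitPlane (mul_notMem_cutRay hz hu))
    rw [e]
    convert! this.div_const (u : ℂ) using 1
    simp only [id]
    field_simp

variable {ν : ℝ}

/-- The logarithmic moment `∫ log (1 - x u) / u`. -/
noncomputable def logMoment (ν : ℝ) (x : ℂ) : ℂ :=
  ∫ u : ℝ, x * logSlope (x * u) ∂betaMeasure (2 * ν + 2) (-ν)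

theorem continuousOn_logSlope_mul :
    ContinuousOn (fun p : ℝ × ℂ => p.2 * logSlope (p.2 * p.1)) (Icc (0 : ℝ) 1 ×ˢ cutRayᶜ) :=
  continuousOn_snd.mul (differentiableOn_logSlope.continuousOn.comp (by fun_prop)
    fun _ hp => mul_notMem_cutRay hp.2 hp.1)

theorem continuousOn_one_sub_mul_inv :
    ContinuousOn (fun p : ℝ × ℂ => (1 - p.2 * (p.1 : ℂ))⁻¹) (Icc (0 : ℝ) 1 ×ˢ cutRayᶜ) :=
  ContinuousOn.inv₀ (by fun_prop) fun _ hp =>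
    one_sub_ne_zero_of_notMem_cutRay (mul_notMem_cutRay hp.2 hp.1)

theorem hasDerivAt_logMoment (h1 : -1 < ν) (h2 : ν < 0) {x : ℂ} (hx : x ∉ cutRay) :
    HasDerivAt (logMoment ν)
      (∫ u : ℝ, -(1 - x * u)⁻¹ ∂betaMeasure (2 * ν + 2) (-ν)) x := by
  have := isProbabilityMeasure_betaMeasure (a := 2 * ν + 2) (b := -ν) (by linarith) (by linarith)
  exact hasDerivAt_integral_of_continuousOn_compact (K := Icc (0 : ℝ) 1) isCompact_Icc
    measurableSet_Icc ae_betaMeasure_mem_Icc isOpen_compl_cutRay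
    (f := fun u x => x * logSlope (x * u)) (f' := fun u x => -(1 - x * (u : ℂ))⁻¹)
    (fun z hz => continuousOn_slice continuousOn_logSlope_mul hz)
    continuousOn_one_sub_mul_inv.neg (fun u hu z hz => hasDerivAt_mul_logSlope hu hz) hx

theorem continuousOn_mul_one_sub_mul_inv_sq :
    ContinuousOn (fun p : ℝ × ℂ => -((p.1 : ℂ) * (1 - p.2 * (p.1 : ℂ))⁻¹ ^ 2))
      (Icc (0 : ℝ) 1 ×ˢ cutRayᶜ) :=
  (ContinuousOn.mul (by fun_prop) (continuousOn_one_sub_mul_inv.pow 2)).neg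

theorem hasDerivAt_deriv_logMoment (h1 : -1 < ν) (h2 : ν < 0) {x : ℂ} (hx : x ∉ cutRay) :
    HasDerivAt (fun x : ℂ => ∫ u : ℝ, -(1 - x * u)⁻¹ ∂betaMeasure (2 * ν + 2) (-ν))
      (∫ u : ℝ, -(u * (1 - x * u)⁻¹ ^ 2) ∂betaMeasure (2 * ν + 2) (-ν)) x := by
  have := isProbabilityMeasure_betaMeasure (a := 2 * ν + 2) (b := -ν) (by linarith) (by linarith)
  refine hasDerivAt_integral_of_continuousOn_compact (K := Icc (0 : ℝ) 1) isCompact_Icc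
    measurableSet_Icc ae_betaMeasure_mem_Icc isOpen_compl_cutRay
    (f := fun u x => -(1 - x * (u : ℂ))⁻¹) (f' := fun u x => -((u : ℂ) * (1 - x * (u : ℂ))⁻¹ ^ 2))
    (fun z hz => continuousOn_slice continuousOn_one_sub_mul_inv.neg hz)
    continuousOn_mul_one_sub_mul_inv_sq (fun u hu z hz => ?_) hx
  have hne := one_sub_ne_zero_of_notMem_cutRay (mul_notMem_cutRay hz hu)
  have := (((hasDerivAt_id z).mul_const (u : ℂ)).const_sub 1).inv hne
  convert! this.neg using 1
  simp only [id]
  field_simp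

/-- Integration by parts against Beta(2ν + 2, -ν) with `k = (1 - x u)⁻¹`; the first parameter `2ν +
2` is what makes the equation close up with a constant right-hand side. -/
theorem logMoment_equation (h1 : -1 < ν) (h2 : ν < 0) {x : ℂ} (hx : x ∉ cutRay) :
    x * ((1 - x) * (∫ u : ℝ, -(u * (1 - x * u)⁻¹ ^ 2) ∂betaMeasure (2 * ν + 2) (-ν))
        - (ν + 1) * ∫ u : ℝ, -(1 - x * (u : ℂ))⁻¹ ∂betaMeasure (2 * ν + 2) (-ν))
      + (ν + 1) * (1 - x) * ∫ u : ℝ, -(1 - x * (u : ℂ))⁻¹ ∂betaMeasure (2 * ν + 2) (-ν)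
      = -(ν + 1) := by
  have := isProbabilityMeasure_betaMeasure (a := 2 * ν + 2) (b := -ν) (by linarith) (by linarith)
  have hne : ∀ u ∈ Icc (0 : ℝ) 1, 1 - x * (u : ℂ) ≠ 0 := fun u hu =>
    one_sub_ne_zero_of_notMem_cutRay (mul_notMem_cutRay hx hu)
  have c1 := continuousOn_slice continuousOn_one_sub_mul_inv hx
  have c2 := continuousOn_slice continuousOn_mul_one_sub_mul_inv_sq hx
  have ii {F : ℝ → ℂ} (hF : ContinuousOn F (Icc 0 1)) :
      Integrable F (betaMeasure (2 * ν + 2) (-ν)) :=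
    integrable_of_continuousOn_Icc ae_betaMeasure_mem_Icc hF
  have stein := integral_betaMeasure_stein (a := 2 * ν + 2) (b := -ν) (by linarith) (by linarith)
    (k := fun u => (1 - x * (u : ℂ))⁻¹) (k' := fun u => x * (1 - x * (u : ℂ))⁻¹ ^ 2) c1
    (continuousOn_const.mul (c1.pow 2)) fun u hu => by
      have := ((((hasDerivAt_id u).ofReal_comp).const_mul x).const_sub 1).inv
        (hne u (Ioo_subset_Icc_self hu))
      convert! this using 1
      simp only [id, Complex.ofReal_one, mul_one, neg_neg, div_eq_mul_inv, inv_pow]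
  have i1 : Integrable (fun u : ℝ => -(1 - x * (u : ℂ))⁻¹) (betaMeasure (2 * ν + 2) (-ν)) :=
    (ii c1).neg
  have i2 : Integrable (fun u : ℝ => -(u * (1 - x * (u : ℂ))⁻¹ ^ 2))
    (betaMeasure (2 * ν + 2) (-ν)) := ii c2
  have i3 : Integrable (fun u : ℝ => x * (1 - x) * -(u * (1 - x * (u : ℂ))⁻¹ ^ 2)
      + ((ν + 1) * (1 - x) - x * (ν + 1)) * -(1 - x * (u : ℂ))⁻¹)
      (betaMeasure (2 * ν + 2) (-ν)) := (i2.const_mul _).add (i1.const_mul _)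
  have hone : ∫ _u : ℝ, (-(ν + 1) : ℂ) ∂betaMeasure (2 * ν + 2) (-ν) = -(ν + 1) := by simp
  rw [← sub_eq_zero, ← hone, ← mul_zero x, ← stein]
  have e : ∀ P Q : ℂ, x * ((1 - x) * Q - (ν + 1) * P) + (ν + 1) * (1 - x) * P
      = x * (1 - x) * Q + ((ν + 1) * (1 - x) - x * (ν + 1)) * P := fun P Q => by ring
  rw [e, ← integral_const_mul, ← integral_const_mul, ← integral_const_mul,
    ← integral_add (i2.const_mul _) (i1.const_mul _), ← integral_sub i3 (integrable_const _)]
  refine integral_congr_ae (ae_betaMeasure_mem_Icc.mono fun u hu => ?_)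
  have := hne u hu
  push_cast
  field_simp
  ring

theorem compl_cutRay_mul {z : ℂ} (hz : z ∈ cutRayᶜ) {v : ℝ} (hv : v ∈ Icc (0 : ℝ) 1) :
    z * v ∈ cutRayᶜ := mul_notMem_cutRay hz hv

theorem differentiableOn_weightedEuler_logMoment (h1 : -1 < ν) (h2 : ν < 0) :
    DifferentiableOn ℂ (weightedEuler ν (logMoment ν)) cutRayᶜ :=
  differentiableOn_weightedEuler h1 h2 isOpen_compl_cutRay (fun _ hz _ hv => compl_cutRay_mul hz hv)
    subset_rfl fun _ hx => (hasDerivAt_logMoment h1 h2 hx).differentiableAt.differentiableWithinAt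

theorem legendreOp_weightedEuler_logMoment (h1 : -1 < ν) (h2 : ν < 0) {β : ℂ} (hβ : β ∉ cutRay) :
    legendreOp ν (weightedEuler ν (logMoment ν)) β = -(ν + 1) * legendreF ν β := by
  have := isProbabilityMeasure_betaMeasure (a := 2 * ν + 2) (b := -ν) (by linarith) (by linarith)
  refine legendreOp_weightedEuler_of_eq h1 h2 isOpen_compl_cutRay
    (fun _ hz _ hv => compl_cutRay_mul hz hv) subset_rfl
    (fun x hx => hasDerivAt_logMoment h1 h2 hx) (fun x hx => hasDerivAt_deriv_logMoment h1 h2 hx)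
    ?_ (fun x hx => logMoment_equation h1 h2 hx) hβ
  refine (differentiableOn_integral_of_continuousOn_compact (K := Icc (0 : ℝ) 1) isCompact_Icc
    measurableSet_Icc ae_betaMeasure_mem_Icc isOpen_compl_cutRay
    (k := fun u x => -((u : ℂ) * (1 - x * (u : ℂ))⁻¹ ^ 2))
    continuousOn_mul_one_sub_mul_inv_sq fun u hu => ?_).continuousOn
  refine (DifferentiableOn.const_mul (DifferentiableOn.pow (DifferentiableOn.inv (by fun_prop)
    fun x hx => ?_) 2) _).neg
  exact one_sub_ne_zero_of_notMem_cutRay (mul_notMem_cutRay hx hu)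

theorem weightedEuler_logMoment_zero : weightedEuler ν (logMoment ν) 0 = 0 := by
  simp [weightedEuler_apply, logMoment]

end LogarithmicMoment

/-! ### The double integral as an Euler transform. -/

section DoubleIntegral

variable {ν : ℝ} {β : ℂ}

/-- The continuous factor of the double integrand. -/
noncomputable def doubleKernel (ν : ℝ) (β : ℂ) (u v : ℝ) : ℂ :=
  (1 - β * v) ^ (ν : ℂ) * (β * v * logSlope (β * v * u))

theorem continuousOn_doubleKernel (hβ : β ∉ cutRay) :
    ContinuousOn (fun p : ℝ × ℝ => doubleKernel ν β p.1 p.2) (Icc (0 : ℝ) 1 ×ˢ Icc (0 : ℝ) 1) := by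
  refine ContinuousOn.mul (ContinuousOn.cpow (by fun_prop) continuousOn_const fun p hp =>
    one_sub_mem_slitPlane (mul_notMem_cutRay hβ hp.2)) (ContinuousOn.mul (by fun_prop) ?_)
  exact differentiableOn_logSlope.continuousOn.comp (by fun_prop)
    fun p hp => mul_notMem_cutRay (mul_notMem_cutRay hβ hp.2) hp.1

/-- `U ^ ν` times the weight at `t = 0` behaves like `u ^ (2ν)`, which need not be integrable at
`0`. The factor `u` borrowed from the zero of the logarithm raises the exponent to `2ν + 1 > -1` and
yields the density of Beta(2ν + 2, -ν), up to normalisation. -/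
theorem cpow_mul_legendreWeight_zero {u : ℝ} (hu : u ∈ Ioo (0 : ℝ) 1) :
    (u : ℂ) ^ (ν : ℂ) * legendreWeight ν 0 u * u
      = ((u ^ (2 * ν + 2 - 1) * (1 - u) ^ (-ν - 1) : ℝ) : ℂ) := by
  have e : u ^ (2 * ν + 2 - 1) = u ^ ν * u ^ (ν + 1 - 1) * u := by
    rw [← Real.rpow_add hu.1, ← Real.rpow_add_one hu.1.ne']
    ring_nf
  rw [legendreWeight_eq hu, ← Complex.ofReal_cpow hu.1.le, e]
  simp
  ring

theorem double_integrand_eq {u v : ℝ} (hu : u ∈ Ioo (0 : ℝ) 1) (hv : v ∈ Ioo (0 : ℝ) 1) :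
    (u : ℂ) ^ (ν : ℂ) * Complex.log (1 - β * u * v) * legendreWeight ν β v * legendreWeight ν 0 u
      = ((u ^ (2 * ν + 2 - 1) * (1 - u) ^ (-ν - 1) : ℝ) : ℂ)
        * ((v ^ (ν + 1 - 1) * (1 - v) ^ (-ν - 1) : ℝ) : ℂ) * doubleKernel ν β u v := by
  rw [← cpow_mul_legendreWeight_zero hu, legendreWeight_eq hv β, ← mul_logSlope, doubleKernel,
    mul_right_comm β (u : ℂ)]
  ring

theorem integrableOn_double_integrand (h1 : -1 < ν) (h2 : ν < 0) (hβ : β ∉ cutRay) :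
    IntegrableOn (fun p : ℝ × ℝ => (p.1 : ℂ) ^ (ν : ℂ) * Complex.log (1 - β * p.1 * p.2)
      * legendreWeight ν β p.2 * legendreWeight ν 0 p.1) (Ioo (0 : ℝ) 1 ×ˢ Ioo (0 : ℝ) 1) := by
  have hm : MeasurableSet (Ioo (0 : ℝ) 1 ×ˢ Ioo (0 : ℝ) 1) := measurableSet_Ioo.prod measurableSet_Ioo
  have hi {a b : ℝ} (ha : 0 < a) (hb : 0 < b) :
      IntegrableOn (fun u : ℝ => ((u ^ (a - 1) * (1 - u) ^ (b - 1) : ℝ) : ℂ)) (Ioo 0 1) :=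
    (((intervalIntegrable_iff_integrableOn_Ioo_of_le zero_le_one).1
      (intervalIntegrable_beta_density ha hb)).ofReal)
  have hp := (hi (a := 2 * ν + 2) (b := -ν) (by linarith) (by linarith)).mul_prod
    (hi (a := ν + 1) (b := -ν) (by linarith) (by linarith))
  rw [Measure.prod_restrict] at hp
  refine (IntegrableOn.mul_continuousOn_of_subset hp (continuousOn_doubleKernel (ν := ν) hβ) hm
    (isCompact_Icc.prod isCompact_Icc)
    (prod_mono Ioo_subset_Icc_self Ioo_subset_Icc_self)).congr_fun (fun p hp => ?_) hm
  exact (double_integrand_eq hp.1 hp.2).symm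

theorem double_integral_eq (h1 : -1 < ν) (h2 : ν < 0) (hβ : β ∉ cutRay) :
    ∫ u in (0 : ℝ)..1, ∫ v in (0 : ℝ)..1,
        (u : ℂ) ^ (ν : ℂ) * Complex.log (1 - β * u * v)
          * legendreWeight ν β v * legendreWeight ν 0 u
      = (beta (2 * ν + 2) (-ν) : ℝ) * (beta (ν + 1) (-ν) : ℝ)
        * weightedEuler ν (logMoment ν) β := by
  have p1 := isProbabilityMeasure_betaMeasure (a := 2 * ν + 2) (b := -ν) (by linarith) (by linarith)
  have p2 := isProbabilityMeasure_betaMeasure (a := ν + 1) (b := -ν) (by linarith) (by linarith)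
  have n1 : ((beta (2 * ν + 2) (-ν) : ℝ) : ℂ) ≠ 0 :=
    Complex.ofReal_ne_zero.2 (beta_pos (by linarith) (by linarith)).ne'
  have n2 := beta_add_one_neg_ne_zero h1 h2
  have e1 : ∀ u ∈ Ioo (0 : ℝ) 1, ∫ v in (0 : ℝ)..1,
      (u : ℂ) ^ (ν : ℂ) * Complex.log (1 - β * u * v)
        * legendreWeight ν β v * legendreWeight ν 0 u
      = (beta (ν + 1) (-ν) : ℝ) * (((u ^ (2 * ν + 2 - 1) * (1 - u) ^ (-ν - 1) : ℝ) : ℂ)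
        * ∫ v, doubleKernel ν β u v ∂betaMeasure (ν + 1) (-ν)) := fun u hu => by
    rw [integral_betaMeasure (by linarith) (by linarith), mul_left_comm, mul_inv_cancel_left₀ n2,
      ← intervalIntegral.integral_const_mul, intervalIntegral.integral_of_le zero_le_one,
      intervalIntegral.integral_of_le zero_le_one, integral_Ioc_eq_integral_Ioo,
      integral_Ioc_eq_integral_Ioo]
    refine setIntegral_congr_fun measurableSet_Ioo fun v hv => ?_
    rw [double_integrand_eq hu hv, mul_assoc]
  have e2 : ∫ u in (0 : ℝ)..1, ∫ v in (0 : ℝ)..1,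
        (u : ℂ) ^ (ν : ℂ) * Complex.log (1 - β * u * v)
          * legendreWeight ν β v * legendreWeight ν 0 u
      = (beta (2 * ν + 2) (-ν) : ℝ) * (beta (ν + 1) (-ν) : ℝ)
        * ∫ u, ∫ v, doubleKernel ν β u v ∂betaMeasure (ν + 1) (-ν)
          ∂betaMeasure (2 * ν + 2) (-ν) := by
    rw [integral_betaMeasure (a := 2 * ν + 2) (by linarith) (by linarith),
      mul_right_comm, mul_inv_cancel_left₀ n1, mul_comm, ← intervalIntegral.integral_const_mul,
      intervalIntegral.integral_of_le zero_le_one, intervalIntegral.integral_of_le zero_le_one,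
      integral_Ioc_eq_integral_Ioo, integral_Ioc_eq_integral_Ioo]
    exact setIntegral_congr_fun measurableSet_Ioo e1
  rw [e2, integral_integral_swap, weightedEuler_apply]
  · simp only [doubleKernel, logMoment, integral_const_mul]
  · refine integrable_of_continuousOn_compact (K := Icc (0 : ℝ) 1 ×ˢ Icc (0 : ℝ) 1)
      (isCompact_Icc.prod isCompact_Icc) (measurableSet_Icc.prod measurableSet_Icc) ?_
      (continuousOn_doubleKernel hβ)
    have h3 : ∀ᵐ p ∂((betaMeasure (2 * ν + 2) (-ν)).prod (betaMeasure (ν + 1) (-ν))),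
        p.1 ∈ Icc (0 : ℝ) 1 := Measure.quasiMeasurePreserving_fst.ae ae_betaMeasure_mem_Icc
    have h4 : ∀ᵐ p ∂((betaMeasure (2 * ν + 2) (-ν)).prod (betaMeasure (ν + 1) (-ν))),
        p.2 ∈ Icc (0 : ℝ) 1 := Measure.quasiMeasurePreserving_snd.ae ae_betaMeasure_mem_Icc
    filter_upwards [h3, h4] with p hp hp' using ⟨hp, hp'⟩

end DoubleIntegral

/-! ### Integrals along straight segments. -/

section SegmentIntegral

variable {β : ℂ}

theorem hasDerivAt_segmentTo (β : ℂ) (s : ℝ) : HasDerivAt (segmentTo β) β s := by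
  have := ((hasDerivAt_id s).ofReal_comp).mul_const β
  convert! this using 1
  simp

theorem isPiecewiseC1Path_segmentTo (β : ℂ) : IsPiecewiseC1Path (segmentTo β) 0 β := by
  refine ⟨by simp [segmentTo], by simp [segmentTo], 1, fun i => i, by simp, by simp,
    fun i _ => ⟨by simp, ContDiff.contDiffOn ?_⟩⟩
  exact Complex.ofRealCLM.contDiff.mul contDiff_const

theorem segmentTo_mem_doubleSlit (hβ : β ∈ doubleSlit) {s : ℝ} (hs : s ∈ Ioc (0 : ℝ) 1) :
    segmentTo β s ∈ doubleSlit := by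
  rcases hβ with h | ⟨r, hr0, hr1, rfl⟩
  · exact Or.inl (by simp [segmentTo, hs.1.ne', h])
  · refine Or.inr ⟨s * r, mul_pos hs.1 hr0, ?_, by simp [segmentTo]⟩
    exact (mul_le_of_le_one_left hr0.le hs.2).trans_lt hr1

/-- The primitive `A` is known to vanish at `0` only along the positive axis, while the segment may
leave in another direction. The local primitive `Q`, which vanishes at `0` from every direction,
transfers the limit. -/
theorem pathIntegral_segmentTo {f A Q : ℂ → ℂ} (hβ : β ∈ doubleSlit)
    (hA : ∀ t ∈ doubleSlit, HasDerivAt A (f t) t)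
    (hA0 : Tendsto (fun r : ℝ => A r) (𝓝[>] 0) (𝓝 0))
    (hQ : ∀ t ∈ slitBall 1, HasDerivAt Q (f t) t) (hQ0 : Tendsto Q (𝓝 0) (𝓝 0))
    (hint : IntervalIntegrable (pullback f (segmentTo β)) volume 0 1) :
    pathIntegral f (segmentTo β) = A β := by
  have hsub : slitBall 1 ⊆ doubleSlit := slitBall_subset_doubleSlit le_rfl
  have hd : ∀ t ∈ slitBall 1, HasDerivAt (fun t => A t - Q t) 0 t := fun t ht => by
    convert! (hA t (hsub ht)).sub (hQ t ht) using 1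
    exact (sub_self _).symm
  obtain ⟨k, hk⟩ := (isOpen_slitBall 1).exists_is_const_of_deriv_eq_zero
    (isPreconnected_slitBall one_pos)
    (fun t ht => (hd t ht).differentiableAt.differentiableWithinAt) (fun t ht => (hd t ht).deriv)
  have hk0 : k = 0 := by
    have l1 : Tendsto (fun r : ℝ => A r - Q r) (𝓝[>] 0) (𝓝 (0 - 0)) :=
      hA0.sub (hQ0.comp tendsto_ofReal_nhdsGT_zero)
    rw [sub_zero] at l1
    refine tendsto_nhds_unique (tendsto_const_nhds.congr' ?_) l1
    filter_upwards [Ioo_mem_nhdsGT (zero_lt_one' ℝ)] with r hr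
    exact (hk r (ofReal_mem_slitBall hr)).symm
  have hγ0 : Tendsto (segmentTo β) (𝓝[>] 0) (𝓝 0) := by
    have := (hasDerivAt_segmentTo β 0).continuousAt.tendsto
    have e : segmentTo β 0 = 0 := by simp [segmentTo]
    rw [e] at this
    exact this.mono_left nhdsWithin_le_nhds
  have lA : Tendsto (fun s => A (segmentTo β s)) (𝓝[>] 0) (𝓝 0) := by
    refine (hQ0.comp hγ0).congr' ?_
    filter_upwards [hγ0.eventually (Metric.ball_mem_nhds 0 one_pos),
      Ioo_mem_nhdsGT (zero_lt_one' ℝ)] with s hs hs'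
    have := hk (segmentTo β s) ⟨hs, mem_slitPlane_of_mem_doubleSlit
      (segmentTo_mem_doubleSlit hβ (Ioo_subset_Ioc_self hs'))⟩
    rw [hk0, sub_eq_zero] at this
    exact this.symm
  have hdA : ∀ s ∈ Ioc (0 : ℝ) 1,
      HasDerivAt (fun s => A (segmentTo β s)) (pullback f (segmentTo β) s) s := fun s hs => by
    rw [pullback, (hasDerivAt_segmentTo β s).deriv]
    exact (hA _ (segmentTo_mem_doubleSlit hβ hs)).comp s (hasDerivAt_segmentTo β s)
  have := intervalIntegral.integral_eq_sub_of_hasDerivAt_of_tendsto zero_lt_one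
    (fun s hs => hdA s (Ioo_subset_Ioc_self hs)) hint lA
    ((hdA 1 ⟨zero_lt_one, le_rfl⟩).continuousAt.tendsto.mono_left nhdsWithin_le_nhds)
  rw [pathIntegral, this]
  simp [segmentTo]

end SegmentIntegral

/-! ### The exact identity of part (b). -/

section DoubleIntegralIdentity

variable {ν : ℝ} {β : ℂ}

theorem intervalIntegrable_legendreSq (h1 : -1 < ν) (h2 : ν < 0) (hβ : β ∈ doubleSlit) :
    IntervalIntegrable (pullback (legendreSq ν) (segmentTo β)) volume 0 1 := by
  rw [legendreSq_eq h1 h2]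
  refine (isPiecewiseC1Path_segmentTo β).intervalIntegrable_of_continuousOn (Ω := cutRayᶜ)
    ((differentiableOn_legendreF h1 h2).continuousOn.pow 2) fun s hs => ?_
  rw [segmentTo, mul_comm]
  exact mul_notMem_cutRay (mem_doubleSlit_iff.1 hβ).1 hs

theorem intervalIntegrable_legendreMir (h1 : -1 < ν) (h2 : ν < 0) (hβ : β ∈ doubleSlit) :
    IntervalIntegrable (pullback (legendreMir ν) (segmentTo β)) volume 0 1 := by
  rw [legendreMir_eq h1 h2]
  have hd : derivWithin (segmentTo β) (Ici 0) 0 = β :=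
    (hasDerivAt_segmentTo β 0).hasDerivWithinAt.derivWithin (uniqueDiffWithinAt_Ici 0)
  have := intervalIntegrable_mir h1 h2 (φ := fun _ => 1) (Ω := doubleSlit)
    (fun _ _ => continuousAt_const) continuousAt_const subset_rfl (isPiecewiseC1Path_segmentTo β)
    (fun s hs => segmentTo_mem_doubleSlit hβ hs) (by rw [hd]; exact ne_zero_of_mem_doubleSlit hβ)
  simpa only [one_mul] using this

theorem add_one_mul_beta (h1 : -1 < ν) (h2 : ν < 0) :
    √π / ((2 : ℝ) ^ (2 * ν + 1) * Real.Gamma (-ν) * Real.Gamma (ν + 3 / 2))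
      * (beta (2 * ν + 2) (-ν) * (ν + 1)) = 1 := by
  -- Legendre's duplication formula, relating `Γ (ν + 1) Γ (ν + 3/2)` to `Γ (2ν + 2)`.
  have hd := Real.Gamma_mul_Gamma_add_half (ν + 1)
  have g1 : Real.Gamma (ν + 1 + 1) = (ν + 1) * Real.Gamma (ν + 1) :=
    Real.Gamma_add_one (by linarith)
  have p1 : 0 < Real.Gamma (ν + 1) := Real.Gamma_pos_of_pos (by linarith)
  have p2 : 0 < Real.Gamma (-ν) := Real.Gamma_pos_of_pos (by linarith)
  have p3 : 0 < Real.Gamma (ν + 3 / 2) := Real.Gamma_pos_of_pos (by linarith)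
  have p4 : (0 : ℝ) < 2 ^ (2 * ν + 1) := Real.rpow_pos_of_pos two_pos _
  have p5 : ν + 1 ≠ 0 := by linarith
  rw [show ν + 1 + 1 / 2 = ν + 3 / 2 by ring, show 2 * (ν + 1) = 2 * ν + 2 by ring,
    show 1 - (2 * ν + 2) = -(2 * ν + 1) by ring, Real.rpow_neg two_pos.le] at hd
  rw [beta, show 2 * ν + 2 + -ν = ν + 1 + 1 by ring, g1]
  generalize Real.Gamma (ν + 3 / 2) = c at *
  generalize (2 : ℝ) ^ (2 * ν + 1) = d at *
  generalize Real.Gamma (2 * ν + 2) = e at *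
  field_simp at hd ⊢
  linarith

theorem double_integral_legendre_identity (h1 : -1 < ν) (h2 : ν < 0) (hβ : β ∈ doubleSlit) :
    ((π ^ 2 / Real.sin (ν * π) ^ 2 : ℝ) : ℂ)
        * (legendreP ν (2 * β - 1) * pathIntegral (legendreSq ν) (segmentTo β)
          - legendreP ν (1 - 2 * β) * pathIntegral (legendreMir ν) (segmentTo β))
      = ((√π / ((2 : ℝ) ^ (2 * ν + 1) * Real.Gamma (-ν) * Real.Gamma (ν + 3 / 2)) : ℝ) : ℂ)
        * ∫ U in (0 : ℝ)..1, ∫ V in (0 : ℝ)..1,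
            (U : ℂ) ^ (ν : ℂ) * Complex.log (1 - β * U * V)
              * legendreWeight ν β V * legendreWeight ν 0 U := by
  have n0 := beta_add_one_neg_ne_zero h1 h2
  have hsub : doubleSlit ⊆ cutRayᶜ := fun z hz => (mem_doubleSlit_iff.1 hz).1
  set N : ℂ := ((beta (ν + 1) (-ν) : ℝ) : ℂ) with hN
  set C : ℝ := √π / ((2 : ℝ) ^ (2 * ν + 1) * Real.Gamma (-ν) * Real.Gamma (ν + 3 / 2)) with hC
  set b : ℝ := beta (2 * ν + 2) (-ν) with hb
  have hCb : (C : ℂ) * (b * (ν + 1)) = 1 := by exact_mod_cast add_one_mul_beta h1 h2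
  have hN2 : ((π ^ 2 / Real.sin (ν * π) ^ 2 : ℝ) : ℂ) = N ^ 2 := by
    rw [hN, beta_add_one_neg]
    push_cast
    ring
  set W := weightedEuler ν (logMoment ν) with hW
  have hWd : DifferentiableOn ℂ W cutRayᶜ := differentiableOn_weightedEuler_logMoment h1 h2
  have hWd' := hWd.deriv isOpen_compl_cutRay
  -- The Euler transform satisfies `L W = -(ν + 1) p`, and `C b (ν + 1) = 1`, so this multiple has
  -- right-hand side `-N⁻¹ p`: variation of constants applies with `φ = 1`.
  set y : ℂ → ℂ := fun β => C * b / N * W β with hy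
  have hyd : DifferentiableOn ℂ y cutRayᶜ := hWd.const_mul _
  have hL : ∀ β ∈ doubleSlit, legendreOp ν y β = -N⁻¹ * 1 * legendreF ν β := fun β hβ => by
    have e := legendreOp_weightedEuler_logMoment h1 h2 (hsub hβ)
    have : legendreOp ν y β = C * b / N * legendreOp ν W β := by
      simp only [legendreOp, hy, deriv_const_mul_field']
      ring
    rw [this, e]
    linear_combination -(N⁻¹ * legendreF ν β) * hCb
  obtain ⟨A, B, hA, hB, hAB, lA, lB⟩ := exists_variation_of_constants (φ := fun _ => 1) h1 h2
    isOpen_doubleSlit subset_rfl (hyd.mono hsub) hL one_pos (y₀ := y)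
    (hyd.mono ball_subset_compl_cutRay) (by simp [hy, hW, weightedEuler_logMoment_zero])
    (Eventually.of_forall fun _ => EventuallyEq.rfl)
  simp only [one_mul] at hA hB
  have eA : pathIntegral (legendreSq ν) (segmentTo β) = A β := by
    have hint := intervalIntegrable_legendreSq h1 h2 hβ
    rw [legendreSq_eq h1 h2] at hint ⊢
    obtain ⟨G, hG⟩ := exists_primitive_of_starConvex isOpen_compl_cutRay starConvex_compl_cutRay
      ((differentiableOn_legendreF h1 h2).pow 2)
    refine pathIntegral_segmentTo (Q := fun t => G t - G 0) hβ hA lA (fun t ht => ?_) ?_ hint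
    · exact (hG t (hsub (slitBall_subset_doubleSlit le_rfl ht))).sub_const _
    · have := ((hG 0 zero_notMem_cutRay).continuousAt.tendsto).sub_const (G 0)
      rwa [sub_self] at this
  have eB : pathIntegral (legendreMir ν) (segmentTo β) = B β := by
    have hint := intervalIntegrable_legendreMir h1 h2 hβ
    rw [legendreMir_eq h1 h2] at hint ⊢
    obtain ⟨Q, hQ, hQ0⟩ := exists_local_primitive h1 h2 one_pos le_rfl (φ := fun _ => 1)
      (differentiableOn_const _)
    simp only [one_mul] at hQ
    exact pathIntegral_segmentTo hβ hB lB hQ hQ0 hint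
  rw [double_integral_eq h1 h2 (hsub hβ), eA, eB, legendreP_one_sub h1 h2, legendreP_sub_one h1 h2,
    hAB β hβ, hN2]
  simp only [hy, ← hN, ← hb, ← hW]
  field_simp

end DoubleIntegralIdentity

theorem mainTheorem5 :
    -- Part (a)
    (∀ (ν : ℝ) (α β : ℂ), ν ∈ ({-1 / 6, -1 / 4, -1 / 3, -1 / 2} : Set ℝ) →
      α ∉ cutRay → 1 - α ∉ cutRay → β ∉ cutRay → 1 - β ∉ cutRay →
      β * (1 - α) / (α * (1 - β)) ∉ cutRay →
      ∀ γ₁ γ₂ : ℝ → ℂ,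
        IsPiecewiseC1Path γ₁ 0 β → (∀ s ∈ Icc (0 : ℝ) 1, γ₁ s ∉ cutRay ∧ γ₁ s ≠ α) →
        IsPiecewiseC1Path γ₂ 0 β → (∀ s ∈ Ioc (0 : ℝ) 1, γ₂ s ∈ doubleSlit ∧ γ₂ s ≠ α) →
        -- the first path integral converges absolutely
        IntervalIntegrable (pullback (fun t => legendreSq ν t / (t - α)) γ₁) volume 0 1 ∧
        -- the second one does so if the path leaves the logarithmic singularity at `0` with
        -- non-zero velocity
        (derivWithin γ₂ (Ici 0) 0 ≠ 0 →
          IntervalIntegrable (pullback (fun t => legendreMir ν t / (t - α)) γ₂) volume 0 1) ∧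
        -- the congruence
        (IntervalIntegrable (pullback (fun t => legendreMir ν t / (t - α)) γ₂) volume 0 1 →
          ∃ p ∈ periodLattice ν α β,
            (legendreP ν (2 * β - 1) ^ 2 * pathIntegral (fun t => legendreSq ν t / (t - α)) γ₁
              - legendreP ν (1 - 2 * β) * legendreP ν (2 * β - 1)
                * pathIntegral (fun t => legendreMir ν t / (t - α)) γ₂)
            - legendreP ν (1 - 2 * α) * legendreP ν (2 * α - 1)
                * legendreP ν (1 - 2 * β) * legendreP ν (2 * β - 1) * entropyH ν α β
            = 2 * π * Complex.I * p)) ∧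
    -- Part (b)
    (∀ (ν : ℝ) (β : ℂ), -1 < ν → ν < 0 → β ∈ doubleSlit →
      IntervalIntegrable (pullback (legendreSq ν) (segmentTo β)) volume 0 1 ∧
      IntervalIntegrable (pullback (legendreMir ν) (segmentTo β)) volume 0 1 ∧
      IntegrableOn (fun p : ℝ × ℝ =>
          (p.1 : ℂ) ^ (ν : ℂ) * Complex.log (1 - β * p.1 * p.2)
            * legendreWeight ν β p.2 * legendreWeight ν 0 p.1)
        (Ioo (0 : ℝ) 1 ×ˢ Ioo (0 : ℝ) 1) ∧
      ((π ^ 2 / Real.sin (ν * π) ^ 2 : ℝ) : ℂ)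
          * (legendreP ν (2 * β - 1) * pathIntegral (legendreSq ν) (segmentTo β)
            - legendreP ν (1 - 2 * β) * pathIntegral (legendreMir ν) (segmentTo β))
        = ((√π / ((2 : ℝ) ^ (2 * ν + 1) * Real.Gamma (-ν) * Real.Gamma (ν + 3 / 2)) : ℝ) : ℂ)
          * ∫ U in (0 : ℝ)..1, ∫ V in (0 : ℝ)..1,
              (U : ℂ) ^ (ν : ℂ) * Complex.log (1 - β * U * V)
                * legendreWeight ν β V * legendreWeight ν 0 U) := by
  refine ⟨fun ν α β hν a1 a2 b1 b2 hκ γ₁ γ₂ hp₁ hγ₁ hp₂ hγ₂ => ?_, fun ν β h1 h2 hβ => ?_⟩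
  · have hν' : -1 < ν ∧ ν < 0 := by
      simp only [mem_insert_iff, mem_singleton_iff] at hν
      rcases hν with rfl | rfl | rfl | rfl <;> norm_num
    refine kontsevichZagier_congruence hν'.1 hν'.2 (mem_doubleSlit_iff.2 ⟨a1, a2⟩)
      ⟨mem_doubleSlit_iff.2 ⟨b1, b2⟩, ?_⟩ hp₁ hγ₁ hp₂ hγ₂
    rwa [div_mul_div_comm, mul_comm (1 - α) β]
  · exact ⟨intervalIntegrable_legendreSq h1 h2 hβ, intervalIntegrable_legendreMir h1 h2 hβ,
      integrableOn_double_integrand h1 h2 (mem_doubleSlit_iff.1 hβ).1,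
      double_integral_legendre_identity h1 h2 hβ⟩
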